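/- **Setting.** Let $\mathfrak g$ be a finite-dimensional real Lie algebra with a complex structure $J$: an endomorphism with $J^2=-1$ and $[JX,JY]-[X,Y]-J[JX,Y]-J[X,JY]=0$ for all $X,Y\in\mathfrak g$. Let $\mathfrak g_{\mathbb C}=\mathfrak g\otimes_{\mathbb R}\mathbb C=\mathfrak g^{1,0}\oplus\mathfrak g^{0,1}$ be the decomposition into the $\pm\sqrt{-1}$-eigenspaces of $J$, with projections $v\mapsto v^{1,0},v^{0,1}$. Let $A^q:=\Lambda^{0,q}\otimes\mathfrak g^{1,0}$ be the space of alternating $q$-linear maps $(\mathfrak g^{0,1})^q\to\mathfrak g^{1,0}$, and let $\bar\partial:A^q\to A^{q+1}$ be the Chevalley–Eilenberg differential of the Lie algebra $\mathfrak g^{0,1}$ with coefficients in $\mathfrak g^{1,0}$, on which $\bar x\in\mathfrak g^{0,1}$ acts by $Y\mapsto[\bar x,Y]^{1,0}$. Let $[\cdot,\cdot]:A^1\times A^1\to A^2$ be the Frölicher–Nijenhuis bracket $$[\varphi,\psi](\bar x,\bar y)=[\varphi\bar x,\psi\bar y]+[\psi\bar x,\varphi\bar y]-\varphi\big([\bar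 x,\psi\bar y]+[\psi\bar x,\bar y]\big)^{0,1}-\psi\big([\bar x,\varphi\bar y]+[\varphi\bar x,\bar y]\big)^{0,1}.$$ **Deformations.** Let $B$ be an analytic subset of an open set of $\mathbb C^m$, with $0\in B$. A *holomorphic deformation* of $(\mathfrak g,J)$ over $B$ is a map $\phi:B\to A^1$ that is holomorphic (locally the restriction of a holomorphic map of the ambient variables) with $\phi(0)=0$ and $\bar\partial\phi(t)=\tfrac12[\phi(t),\phi(t)]$ for all $t\in B$. A *small deformation* is a germ at $0$ of a holomorphic deformation. An element $\varphi\in A^1$ *determines* the complex structure $J_\varphi$ on $\mathfrak g$ if the $(-\sqrt{-1})$-eigenspace of $J_\varphi$ on $\mathfrak g_{\mathbb C}$ is $\mathfrak g^{0,1}_\varphi:=(1-\varphi)\mathfrak g^{0,1}$. Two small deformations $\phi,\tilde\phi$ over the same $B$ are *equivalent* if for $t\in B$ near $0$ 1. there are Lie algebra automorphisms $F_t$ of $\mathfrak g_{\mathbb C}$ with $F_t(\mathfrak g^{0,1}_{\tilde\phi(t)})=\mathfrak g^{0,1}_{\phi(t)}$ such that $t\mapsto F_t(x)$ is holomorphic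 for every $x\in\mathfrak g_{\mathbb C}$; and 2. $\phi(t)$ and $\tilde\phi(t)$ determine complex structures on $\mathfrak g$, and $J_{\tilde\phi(t)}=f_t^{-1}J_{\phi(t)}f_t$ for some Lie algebra automorphism $f_t$ of $\mathfrak g$. A small deformation $\phi$ over $B$ is *complete* if for every small deformation $\psi$ of $(\mathfrak g,J)$, over any base $D$, there is a germ of holomorphic map $h:(D,0)\to(B,0)$ such that $\psi$ is equivalent to the pull back $s\mapsto\phi(h(s))$. **Theorem 1.1.** Every $(\mathfrak g,J)$ has a complete small deformation. More precisely, choose any Hermitian inner products on $A^0=\mathfrak g^{1,0}$, $A^1$ and $A^2$ (for example those induced by a Hermitian inner product on $\mathfrak g_{\mathbb C}$). Let $\bar\partial^\dagger:A^{q+1}\to A^{q}$ ($q=0,1$) be the Moore–Penrose inverse of $\bar\partial:A^q\to A^{q+1}$, that is, $\bar\partial^\dagger\bar\partial x=x$ for $x\perp\ker\bar\partial$ and $\bar\partial^\dagger y=0$ for $y\perp\operatorname{Im}\bar\partial$. Let $\mathcal H^{0,q}=\ker\bar\partial\cap\ker\bar\partial^\dagger\subseteq A^q$ for $q=1,2$,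 and write $\mathcal H^{0,2}$ also for the orthogonal projection of $A^2$ onto this subspace. Let $\eta_1,\dots,\eta_r$ be a basis of $\mathcal H^{0,1}$. For $t\in\mathbb C^r$ put $$\phi_1=\sum_{\nu=1}^r\eta_\nu t_\nu,\qquad \phi_k=\frac12\sum_{j=1}^{k-1}\bar\partial^\dagger[\phi_j,\phi_{k-j}]\quad(k>1).$$ Then there is $\epsilon_0>0$ such that $\phi(t)=\sum_{k\ge1}\phi_k$ converges for $|t|:=\max_\nu|t_\nu|<\epsilon_0$, and for every $0<\epsilon\le\epsilon_0$ the family $\phi(t)$ over $$\mathfrak B=\{t\in\mathbb C^r:\ |t|<\epsilon,\ \mathcal H^{0,2}[\phi(t),\phi(t)]=0\}$$ (the *Kuranishi deformation*) is a holomorphic deformation of $(\mathfrak g,J)$ and is complete. -/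

import Mathlib

open scoped TensorProduct Topology

noncomputable section

/-! ### Moore-Penrose inverses and orthogonal projections -/

section MoorePenrose

variable {V W : Type*}

/-- The Moore-Penrose inverse of a linear map `T : V → W` between finite-dimensional Hermitian
spaces: project orthogonally onto the range of `T`, then invert `T` on `(ker T)ᗮ`. -/
def moorePenrose [NormedAddCommGroup V] [InnerProductSpace ℂ V] [FiniteDimensional ℂ V]
    [NormedAddCommGroup W] [InnerProductSpace ℂ W] [FiniteDimensional ℂ W]
    (T : V →ₗ[ℂ] W) : W →ₗ[ℂ] V :=
  (LinearMap.ker T)ᗮ.subtype ∘ₗ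
    (Submodule.quotientEquivOfIsCompl (LinearMap.ker T) (LinearMap.ker T)ᗮ
      (Submodule.isCompl_orthogonal _)).toLinearMap ∘ₗ
    T.quotKerEquivRange.symm.toLinearMap ∘ₗ
    (Submodule.orthogonalProjectionOnto (LinearMap.range T)).toLinearMap

theorem moorePenrose_apply_map [NormedAddCommGroup V] [InnerProductSpace ℂ V]
    [FiniteDimensional ℂ V] [NormedAddCommGroup W] [InnerProductSpace ℂ W]
    [FiniteDimensional ℂ W] (T : V →ₗ[ℂ] W) {x : V} (hx : x ∈ (LinearMap.ker T)ᗮ) :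
    moorePenrose T (T x) = x := by
  have h1 : (Submodule.orthogonalProjectionOnto (LinearMap.range T)) (T x) =
      (⟨T x, LinearMap.mem_range_self T x⟩ : LinearMap.range T) :=
    Submodule.orthogonalProjectionOnto_mem_subspace_eq_self
      (⟨T x, LinearMap.mem_range_self T x⟩ : LinearMap.range T)
  have h2 : T.quotKerEquivRange.symm ⟨T x, LinearMap.mem_range_self T x⟩ =
      (LinearMap.ker T).mkQ x := T.quotKerEquivRange_symm_apply_image x _
  simp only [moorePenrose, LinearMap.comp_apply, ContinuousLinearMap.coe_coe,
    LinearEquiv.coe_coe, h1, h2]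
  exact congrArg Subtype.val (Submodule.quotientEquivOfIsCompl_apply_mk_right
    (Submodule.isCompl_orthogonal _) (⟨x, hx⟩ : (LinearMap.ker T)ᗮ))

theorem moorePenrose_apply_orthogonal [NormedAddCommGroup V] [InnerProductSpace ℂ V]
    [FiniteDimensional ℂ V] [NormedAddCommGroup W] [InnerProductSpace ℂ W]
    [FiniteDimensional ℂ W] (T : V →ₗ[ℂ] W) {y : W} (hy : y ∈ (LinearMap.range T)ᗮ) :
    moorePenrose T y = 0 := by
  have h1 : (Submodule.orthogonalProjectionOnto (LinearMap.range T)) y = 0 :=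
    Submodule.orthogonalProjectionOnto_eq_zero_iff.2 hy
  simp only [moorePenrose, LinearMap.comp_apply, ContinuousLinearMap.coe_coe, h1, map_zero]

variable [AddCommGroup V] [Module ℂ V] [FiniteDimensional ℂ V]
  [AddCommGroup W] [Module ℂ W] [FiniteDimensional ℂ W]

/-- The Moore-Penrose inverse of `T` with respect to Hermitian inner products `c` on `V` and
`d` on `W`. -/
def mpInverse (c : InnerProductSpace.Core ℂ V) (d : InnerProductSpace.Core ℂ W)
    (T : V →ₗ[ℂ] W) : W →ₗ[ℂ] V :=
  letI := c.toNormedAddCommGroup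
  letI := InnerProductSpace.ofCore c.toCore
  letI := d.toNormedAddCommGroup
  letI := InnerProductSpace.ofCore d.toCore
  moorePenrose T

/-- The orthogonal projection of `V` onto `K` with respect to the Hermitian inner product `c`. -/
def orthProj (c : InnerProductSpace.Core ℂ V) (K : Submodule ℂ V) : V →ₗ[ℂ] V :=
  letI := c.toNormedAddCommGroup
  letI := InnerProductSpace.ofCore c.toCore
  K.starProjection.toLinearMap

end MoorePenrose

/-! ### Holomorphic functions on, and analytic subsets of, `ℂᵐ` -/

/-- A function on a subset `S` of `ℂᵐ` with values in a finite-dimensional complex vector space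
is holomorphic if each of its complex linear coordinates is, near every point of `S`, the
restriction to `S` of an analytic function of the ambient variables. -/
def HolomorphicOnSet {m : ℕ} {V : Type*} [AddCommGroup V] [Module ℂ V]
    (S : Set (Fin m → ℂ)) (f : (Fin m → ℂ) → V) : Prop :=
  ∀ ℓ : V →ₗ[ℂ] ℂ, ∀ p ∈ S, ∃ g : (Fin m → ℂ) → ℂ, AnalyticAt ℂ g p ∧
    ∀ᶠ t in 𝓝[S] p, ℓ (f t) = g t

/-- `B` is an analytic subset of the open set `Ω`: near each point of `Ω` it is the set of common
zeros of finitely many holomorphic functions. -/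
structure IsAnalyticSubset {m : ℕ} (Ω B : Set (Fin m → ℂ)) : Prop where
  isOpen : IsOpen Ω
  subset : B ⊆ Ω
  local_eq : ∀ p ∈ Ω, ∃ U : Set (Fin m → ℂ), IsOpen U ∧ p ∈ U ∧ U ⊆ Ω ∧
    ∃ (k : ℕ) (F : Fin k → (Fin m → ℂ) → ℂ), (∀ i, DifferentiableOn ℂ (F i) U) ∧
      ∀ t ∈ U, t ∈ B ↔ ∀ i, F i t = 0

/-! ### Complex structures on a real Lie algebra -/

/-- The complexification `𝔤_ℂ = ℂ ⊗ 𝔤` of a real Lie algebra. -/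
def Complexification (𝔤 : Type*) [LieRing 𝔤] [LieAlgebra ℝ 𝔤] : Type _ := ℂ ⊗[ℝ] 𝔤

namespace Complexification

variable {𝔤 : Type*} [LieRing 𝔤] [LieAlgebra ℝ 𝔤]

instance instLieRing : LieRing (Complexification 𝔤) := inferInstanceAs (LieRing (ℂ ⊗[ℝ] 𝔤))

instance instLieAlgebra : LieAlgebra ℂ (Complexification 𝔤) :=
  inferInstanceAs (LieAlgebra ℂ (ℂ ⊗[ℝ] 𝔤))

instance instFiniteDimensional [FiniteDimensional ℝ 𝔤] :
    FiniteDimensional ℂ (Complexification 𝔤) :=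
  inferInstanceAs (FiniteDimensional ℂ (ℂ ⊗[ℝ] 𝔤))

/-- The element `a ⊗ x` of `𝔤_ℂ`. -/
def tmul (a : ℂ) (x : 𝔤) : Complexification 𝔤 := a ⊗ₜ[ℝ] x

theorem bracket_tmul (a b : ℂ) (x y : 𝔤) : ⁅tmul a x, tmul b y⁆ = tmul (a * b) ⁅x, y⁆ := rfl

theorem tmul_sub (a : ℂ) (x y : 𝔤) : tmul a (x - y) = tmul a x - tmul a y :=
  TensorProduct.tmul_sub a x y

theorem tmul_neg (a : ℂ) (x : 𝔤) : tmul a (-x) = -tmul a x :=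
  TensorProduct.tmul_neg a x

theorem tmul_zero (a : ℂ) : tmul a (0 : 𝔤) = 0 := TensorProduct.tmul_zero 𝔤 a

@[elab_as_elim]
theorem induction_on {motive : Complexification 𝔤 → Prop} (z : Complexification 𝔤)
    (zero : motive 0) (tmul : ∀ (a : ℂ) (x : 𝔤), motive (tmul a x))
    (add : ∀ x y, motive x → motive y → motive (x + y)) : motive z :=
  TensorProduct.induction_on (motive := motive) z zero tmul add

end Complexification

open Complexification (tmul)

/-- A complex structure on the real Lie algebra `𝔤`. -/
structure LieComplexStructure (𝔤 : Type*) [LieRing 𝔤] [LieAlgebra ℝ 𝔤] where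
  J : 𝔤 →ₗ[ℝ] 𝔤
  sq : ∀ x, J (J x) = -x
  integrable : ∀ x y, ⁅J x, J y⁆ - ⁅x, y⁆ - J ⁅J x, y⁆ - J ⁅x, J y⁆ = 0

namespace LieComplexStructure

variable {𝔤 : Type*} [LieRing 𝔤] [LieAlgebra ℝ 𝔤] (𝒥 : LieComplexStructure 𝔤)

/-- The complex linear extension of `J` to `𝔤_ℂ = ℂ ⊗ 𝔤`. -/
def JC : Complexification 𝔤 →ₗ[ℂ] Complexification 𝔤 := 𝒥.J.baseChange ℂ

theorem JC_tmul (a : ℂ) (x : 𝔤) : 𝒥.JC (tmul a x) = tmul a (𝒥.J x) := rfl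

theorem JC_sq (x : Complexification 𝔤) : 𝒥.JC (𝒥.JC x) = -x := by
  induction x using Complexification.induction_on with
  | zero => simp
  | tmul a x => simp [JC_tmul, 𝒥.sq, Complexification.tmul_neg]
  | add x y hx hy => rw [map_add, map_add, hx, hy, neg_add]

theorem JC_integrable (x y : Complexification 𝔤) :
    ⁅𝒥.JC x, 𝒥.JC y⁆ - ⁅x, y⁆ - 𝒥.JC ⁅𝒥.JC x, y⁆ - 𝒥.JC ⁅x, 𝒥.JC y⁆ = 0 := by
  induction x using Complexification.induction_on with
  | zero => simp
  | add x x' hx hx' =>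
    simp only [map_add, add_lie]
    rw [← add_zero (0 : Complexification 𝔤)]
    nth_rewrite 1 [← hx]
    rw [← hx']
    abel
  | tmul a x =>
    induction y using Complexification.induction_on with
    | zero => simp
    | add y y' hy hy' =>
      simp only [map_add, lie_add]
      rw [← add_zero (0 : Complexification 𝔤)]
      nth_rewrite 1 [← hy]
      rw [← hy']
      abel
    | tmul b y =>
      simp only [JC_tmul, Complexification.bracket_tmul, ← Complexification.tmul_sub,
        𝒥.integrable, Complexification.tmul_zero]

theorem lie_mem_eigenspace {μ : ℂ} (hμ : μ * μ = -1) {x y : Complexification 𝔤}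
    (hx : 𝒥.JC x = μ • x) (hy : 𝒥.JC y = μ • y) : 𝒥.JC ⁅x, y⁆ = μ • ⁅x, y⁆ := by
  have h := 𝒥.JC_integrable x y
  rw [hx, hy] at h
  simp only [smul_lie, lie_smul, map_smul, smul_smul, hμ] at h
  have hμ0 : (-2 * μ) ≠ 0 := by
    intro h0
    have : μ = 0 := by simpa using h0
    rw [this] at hμ
    norm_num at hμ
  have h2 : (-2 * μ) • 𝒥.JC ⁅x, y⁆ = (-2 * μ) • (μ • ⁅x, y⁆) := by
    rw [← sub_eq_zero, ← h, smul_smul, mul_assoc, hμ]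
    module
  exact smul_right_injective _ hμ0 h2

/-- `𝔤^{1,0}`, the `√-1`-eigenspace of `J` on `𝔤_ℂ`; a Lie subalgebra by integrability. -/
def g10 : LieSubalgebra ℂ (Complexification 𝔤) where
  toSubmodule := Module.End.eigenspace 𝒥.JC Complex.I
  lie_mem' hx hy := Module.End.mem_eigenspace_iff.2 (𝒥.lie_mem_eigenspace Complex.I_mul_I
    (Module.End.mem_eigenspace_iff.1 hx) (Module.End.mem_eigenspace_iff.1 hy))

theorem mem_g10 {x : Complexification 𝔤} : x ∈ 𝒥.g10 ↔ 𝒥.JC x = Complex.I • x :=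
  Module.End.mem_eigenspace_iff

/-- `𝔤^{0,1}`, the `-√-1`-eigenspace of `J` on `𝔤_ℂ`; a Lie subalgebra by integrability. -/
def g01 : LieSubalgebra ℂ (Complexification 𝔤) where
  toSubmodule := Module.End.eigenspace 𝒥.JC (-Complex.I)
  lie_mem' hx hy := Module.End.mem_eigenspace_iff.2 (𝒥.lie_mem_eigenspace
    (by rw [neg_mul_neg, Complex.I_mul_I])
    (Module.End.mem_eigenspace_iff.1 hx) (Module.End.mem_eigenspace_iff.1 hy))

theorem mem_g01 {x : Complexification 𝔤} : x ∈ 𝒥.g01 ↔ 𝒥.JC x = (-Complex.I) • x :=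
  Module.End.mem_eigenspace_iff

/-- The projection `𝔤_ℂ → 𝔤^{1,0}` along `𝔤^{0,1}`. -/
def P10 : Complexification 𝔤 →ₗ[ℂ] 𝒥.g10 :=
  LinearMap.codRestrict 𝒥.g10.toSubmodule ((1 / 2 : ℂ) • (LinearMap.id - Complex.I • 𝒥.JC)) (by
    intro x
    rw [LieSubalgebra.mem_toSubmodule, mem_g10]
    simp only [LinearMap.smul_apply, LinearMap.sub_apply, LinearMap.id_apply, map_smul, map_sub,
      JC_sq, smul_sub, smul_neg, smul_smul]
    have e : Complex.I * (1 / 2 * Complex.I) = -(1 / 2) := by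
      rw [mul_left_comm, Complex.I_mul_I]; norm_num
    rw [e]
    module)

/-- The projection `𝔤_ℂ → 𝔤^{0,1}` along `𝔤^{1,0}`. -/
def P01 : Complexification 𝔤 →ₗ[ℂ] 𝒥.g01 :=
  LinearMap.codRestrict 𝒥.g01.toSubmodule ((1 / 2 : ℂ) • (LinearMap.id + Complex.I • 𝒥.JC)) (by
    intro x
    rw [LieSubalgebra.mem_toSubmodule, mem_g01]
    simp only [LinearMap.smul_apply, LinearMap.add_apply, LinearMap.id_apply, map_smul, map_add,
      JC_sq, smul_add, smul_neg, smul_smul]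
    have e : -Complex.I * (1 / 2 * Complex.I) = 1 / 2 := by
      rw [mul_left_comm, neg_mul, Complex.I_mul_I]; norm_num
    rw [e]
    module)

theorem coe_P10 (x : Complexification 𝔤) :
    (𝒥.P10 x : Complexification 𝔤) = (1 / 2 : ℂ) • (x - Complex.I • 𝒥.JC x) := rfl

theorem coe_P01 (x : Complexification 𝔤) :
    (𝒥.P01 x : Complexification 𝔤) = (1 / 2 : ℂ) • (x + Complex.I • 𝒥.JC x) := rfl

theorem P10_add_P01 (x : Complexification 𝔤) : (𝒥.P10 x : Complexification 𝔤) + 𝒥.P01 x = x := by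
  rw [coe_P10, coe_P01]
  module

theorem P10_of_mem_g01 {x : Complexification 𝔤} (hx : x ∈ 𝒥.g01) : 𝒥.P10 x = 0 := by
  apply Subtype.ext
  rw [coe_P10, (𝒥.mem_g01).1 hx, smul_smul, mul_neg, Complex.I_mul_I]
  simp

theorem P10_lie_P10 (x : 𝒥.g01) (y : Complexification 𝔤) :
    𝒥.P10 ⁅(x : Complexification 𝔤), (𝒥.P10 y : Complexification 𝔤)⁆ = 𝒥.P10 ⁅(x : Complexification 𝔤), y⁆ := by
  conv_rhs => rw [← 𝒥.P10_add_P01 y, lie_add, map_add,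
    𝒥.P10_of_mem_g01 (𝒥.g01.lie_mem x.2 (𝒥.P01 y).2), add_zero]

/-- The action `x̄ · Y = [x̄, Y]^{1,0}` of `𝔤^{0,1}` on `𝔤^{1,0} ≅ 𝔤_ℂ / 𝔤^{0,1}`. -/
instance instLieRingModule : LieRingModule 𝒥.g01 𝒥.g10 where
  bracket x Y := 𝒥.P10 ⁅(x : Complexification 𝔤), (Y : Complexification 𝔤)⁆
  add_lie x y Y := by
    change 𝒥.P10 _ = 𝒥.P10 _ + 𝒥.P10 _
    rw [← map_add, ← add_lie]; rfl
  lie_add x Y Z := by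
    change 𝒥.P10 _ = 𝒥.P10 _ + 𝒥.P10 _
    rw [← map_add, ← lie_add]; rfl
  leibniz_lie x y Y := by
    change 𝒥.P10 ⁅(x : Complexification 𝔤), (𝒥.P10 _ : Complexification 𝔤)⁆ =
      𝒥.P10 ⁅⁅(x : Complexification 𝔤), (y : Complexification 𝔤)⁆, (Y : Complexification 𝔤)⁆ +
      𝒥.P10 ⁅(y : Complexification 𝔤), (𝒥.P10 _ : Complexification 𝔤)⁆
    rw [P10_lie_P10, P10_lie_P10, ← map_add, ← leibniz_lie]

theorem lie_g10_def (x : 𝒥.g01) (Y : 𝒥.g10) :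
    ⁅x, Y⁆ = 𝒥.P10 ⁅(x : Complexification 𝔤), (Y : Complexification 𝔤)⁆ := rfl

instance instLieModule : LieModule ℂ 𝒥.g01 𝒥.g10 where
  smul_lie a x Y := by
    rw [lie_g10_def, lie_g10_def, ← map_smul, ← smul_lie]; rfl
  lie_smul a x Y := by
    rw [lie_g10_def, lie_g10_def, ← map_smul, ← lie_smul]; rfl

/-! ### The Dolbeault complex `Λ^{0,q} ⊗ 𝔤^{1,0}` in degrees `q ≤ 3` and its bracket

It is the Chevalley-Eilenberg complex of the Lie algebra `𝔤^{0,1}` with coefficients in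
`𝔤^{1,0}`; elements of `Λ^{0,q} ⊗ 𝔤^{1,0}` are alternating `q`-linear maps
`𝔤^{0,1} × ⋯ × 𝔤^{0,1} → 𝔤^{1,0}`. -/

/-- `Λ^{0,1} ⊗ 𝔤^{1,0}`. -/
abbrev A01 : Type _ := LieModule.Cohomology.oneCochain ℂ 𝒥.g01 𝒥.g10

/-- `Λ^{0,2} ⊗ 𝔤^{1,0}`. -/
abbrev A02 : Type _ := LieModule.Cohomology.twoCochain ℂ 𝒥.g01 𝒥.g10

/-- `∂̄ : 𝔤^{1,0} → Λ^{0,1} ⊗ 𝔤^{1,0}`, `(∂̄X)(x̄) = [x̄, X]^{1,0}`. -/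
def dbar0 : 𝒥.g10 →ₗ[ℂ] 𝒥.A01 :=
  LinearMap.mk₂ ℂ (fun (X : 𝒥.g10) (x : 𝒥.g01) => ⁅x, X⁆)
    (fun _ _ _ => lie_add _ _ _) (fun _ _ _ => lie_smul _ _ _)
    (fun _ _ _ => add_lie _ _ _) (fun _ _ _ => smul_lie _ _ _)

/-- `∂̄ : Λ^{0,1} ⊗ 𝔤^{1,0} → Λ^{0,2} ⊗ 𝔤^{1,0}`,
`(∂̄φ)(x̄, ȳ) = [x̄, φ ȳ]^{1,0} - [ȳ, φ x̄]^{1,0} - φ [x̄, ȳ]`. -/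
def dbar1 : 𝒥.A01 →ₗ[ℂ] 𝒥.A02 := LieModule.Cohomology.d₁₂ ℂ 𝒥.g01 𝒥.g10

/-- `∂̄` on `Λ^{0,2} ⊗ 𝔤^{1,0}`, with values in the trilinear maps (which contain
`Λ^{0,3} ⊗ 𝔤^{1,0}`). -/
def dbar2 : 𝒥.A02 →ₗ[ℂ] 𝒥.g01 →ₗ[ℂ] 𝒥.g01 →ₗ[ℂ] 𝒥.g01 →ₗ[ℂ] 𝒥.g10 :=
  LieModule.Cohomology.d₂₃ ℂ 𝒥.g01 𝒥.g10

theorem coe_add' {K : LieSubalgebra ℂ (Complexification 𝔤)} (x y : K) :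
    ((x + y : K) : Complexification 𝔤) = x + y := rfl

theorem coe_smul' {K : LieSubalgebra ℂ (Complexification 𝔤)} (a : ℂ) (x : K) :
    ((a • x : K) : Complexification 𝔤) = a • (x : Complexification 𝔤) := rfl

/-- The bilinear map `(x̄, ȳ) ↦ [φ x̄, ψ ȳ]^{1,0} - φ([x̄, ψ ȳ]^{0,1} + [ψ x̄, ȳ]^{0,1})`. -/
def fnAux (φ ψ : 𝒥.A01) : 𝒥.g01 →ₗ[ℂ] 𝒥.g01 →ₗ[ℂ] 𝒥.g10 :=
  LinearMap.mk₂ ℂ (fun x y : 𝒥.g01 =>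
      𝒥.P10 ⁅(φ x : Complexification 𝔤), (ψ y : Complexification 𝔤)⁆
      - φ (𝒥.P01 ⁅(x : Complexification 𝔤), (ψ y : Complexification 𝔤)⁆
          + 𝒥.P01 ⁅(ψ x : Complexification 𝔤), (y : Complexification 𝔤)⁆))
    (by
      intro x x' y
      rw [coe_add', map_add φ x, map_add ψ x, coe_add', coe_add', add_lie, add_lie,
        add_lie]
      simp only [map_add]
      abel)
    (by
      intro a x y
      rw [coe_smul', map_smul φ a x, map_smul ψ a x, coe_smul', coe_smul', smul_lie,
        smul_lie, smul_lie]
      simp only [map_add, map_smul, smul_add, smul_sub])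
    (by
      intro x y y'
      rw [coe_add', map_add ψ y, coe_add', lie_add, lie_add, lie_add]
      simp only [map_add]
      abel)
    (by
      intro a x y
      rw [coe_smul', map_smul ψ a y, coe_smul', lie_smul, lie_smul, lie_smul]
      simp only [map_add, map_smul, smul_add, smul_sub])

theorem fnAux_apply (φ ψ : 𝒥.A01) (x y : 𝒥.g01) : 𝒥.fnAux φ ψ x y =
    𝒥.P10 ⁅(φ x : Complexification 𝔤), (ψ y : Complexification 𝔤)⁆
      - φ (𝒥.P01 ⁅(x : Complexification 𝔤), (ψ y : Complexification 𝔤)⁆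
          + 𝒥.P01 ⁅(ψ x : Complexification 𝔤), (y : Complexification 𝔤)⁆) := rfl

/-- The Frölicher-Nijenhuis bracket on `Λ^{0,1} ⊗ 𝔤^{1,0}`. On decomposable elements it is
`[α ⊗ X, β ⊗ Y] = α ∧ β ⊗ [X, Y] - (i_Y dα ∧ β ⊗ X + i_X dβ ∧ α ⊗ Y)`
with `dα(u, v) = -α[u, v]`; evaluated on `x̄, ȳ` and extended bilinearly, `[φ, ψ](x̄, ȳ)` is
`[φ x̄, ψ ȳ] + [ψ x̄, φ ȳ] - φ([x̄, ψ ȳ] + [ψ x̄, ȳ])^{0,1} - ψ([x̄, φ ȳ] + [φ x̄, ȳ])^{0,1}`. -/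
def fnBracket (φ ψ : 𝒥.A01) : 𝒥.A02 :=
  ⟨𝒥.fnAux φ ψ + 𝒥.fnAux ψ φ, by
    intro x
    have skew : ∀ u v : Complexification 𝔤, ⁅u, v⁆ + ⁅v, u⁆ = 0 := fun u v => by
      rw [← lie_skew u v, neg_add_cancel]
    rw [LinearMap.add_apply, LinearMap.add_apply, fnAux_apply, fnAux_apply, ← map_add 𝒥.P01,
      ← map_add 𝒥.P01, skew, skew, map_zero, map_zero, map_zero, sub_zero, sub_zero, ← map_add,
      skew, map_zero]⟩

/-! ### Deformations -/

/-- `𝔤^{0,1}_φ = (1 - φ) 𝔤^{0,1}`. -/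
def deformed01 (φ : 𝒥.A01) : Submodule ℂ (Complexification 𝔤) :=
  LinearMap.range (𝒥.g01.toSubmodule.subtype - 𝒥.g10.toSubmodule.subtype ∘ₗ φ)

/-- A complex structure on `𝔤` is the one determined by `φ` if its space of `(0,1)`-vectors is
`(1 - φ) 𝔤^{0,1}` (its space of `(1,0)`-vectors is then the conjugate space). -/
def Determines (φ : 𝒥.A01) (𝒥' : LieComplexStructure 𝔤) : Prop :=
  𝒥'.g01.toSubmodule = 𝒥.deformed01 φ

/-- A holomorphic deformation of `(𝔤, J)` over the analytic subset `B ∋ 0` of the open set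
`Ω ⊆ ℂᵐ`. -/
structure IsHolomorphicDeformation {m : ℕ} (Ω B : Set (Fin m → ℂ))
    (φ : (Fin m → ℂ) → 𝒥.A01) : Prop where
  analytic : IsAnalyticSubset Ω B
  zero_mem : 0 ∈ B
  holomorphic : HolomorphicOnSet B φ
  map_zero : φ 0 = 0
  maurerCartan : ∀ t ∈ B, 𝒥.dbar1 (φ t) = (1 / 2 : ℂ) • 𝒥.fnBracket (φ t) (φ t)

/-- Equivalence of the germs at `0` of two families over `B`. Over a neighbourhood of `0` in `B`
there is a family `F t` of Lie algebra automorphisms of `𝔤_ℂ`, holomorphic in `t`, that carries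
the `(0,1)`-vectors of the structure determined by `φ' t` to those of the structure determined by
`φ t`; moreover both parameters determine complex structures on `𝔤` itself, and these are
conjugate by a Lie algebra automorphism of `𝔤`. -/
def GermEquivalent {m : ℕ} (B : Set (Fin m → ℂ)) (φ φ' : (Fin m → ℂ) → 𝒥.A01) : Prop :=
  ∃ U ∈ 𝓝 (0 : Fin m → ℂ),
    (∃ F : (Fin m → ℂ) → ((Complexification 𝔤) ≃ₗ⁅ℂ⁆ (Complexification 𝔤)),
      (∀ x : Complexification 𝔤, HolomorphicOnSet (B ∩ U) (fun t => F t x)) ∧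
      ∀ t ∈ B ∩ U, ∀ x : Complexification 𝔤,
        x ∈ 𝒥.deformed01 (φ' t) ↔ F t x ∈ 𝒥.deformed01 (φ t)) ∧
    ∀ t ∈ B ∩ U, ∃ 𝒥₁ 𝒥₂ : LieComplexStructure 𝔤,
      𝒥.Determines (φ t) 𝒥₁ ∧ 𝒥.Determines (φ' t) 𝒥₂ ∧
      ∃ f : 𝔤 ≃ₗ⁅ℝ⁆ 𝔤, ∀ x, 𝒥₂.J x = f.symm (𝒥₁.J (f x))

/-- The deformation `φ` over `B` is complete: (the germ of) every holomorphic deformation `ψ` of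
`(𝔤, J)` is equivalent to the pull back of `φ` by a germ of holomorphic map
`h : (D, 0) → (B, 0)`. -/
def IsComplete {m : ℕ} (B : Set (Fin m → ℂ)) (φ : (Fin m → ℂ) → 𝒥.A01) : Prop :=
  ∀ (l : ℕ) (Ω D : Set (Fin l → ℂ)) (ψ : (Fin l → ℂ) → 𝒥.A01),
    𝒥.IsHolomorphicDeformation Ω D ψ →
    ∃ h : (Fin l → ℂ) → (Fin m → ℂ), ∃ U ∈ 𝓝 (0 : Fin l → ℂ),
      HolomorphicOnSet (D ∩ U) h ∧ h 0 = 0 ∧ Set.MapsTo h (D ∩ U) B ∧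
      𝒥.GermEquivalent D ψ (φ ∘ h)

/-! ### The Kuranishi deformation -/

section Kuranishi

variable [FiniteDimensional ℝ 𝔤]

/-- `∂̄† : Λ^{0,1} ⊗ 𝔤^{1,0} → 𝔤^{1,0}`. -/
def dbarDagger0 (c₀ : InnerProductSpace.Core ℂ 𝒥.g10) (c₁ : InnerProductSpace.Core ℂ 𝒥.A01) :
    𝒥.A01 →ₗ[ℂ] 𝒥.g10 := mpInverse c₀ c₁ 𝒥.dbar0

/-- `∂̄† : Λ^{0,2} ⊗ 𝔤^{1,0} → Λ^{0,1} ⊗ 𝔤^{1,0}`. -/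
def dbarDagger1 (c₁ : InnerProductSpace.Core ℂ 𝒥.A01) (c₂ : InnerProductSpace.Core ℂ 𝒥.A02) :
    𝒥.A02 →ₗ[ℂ] 𝒥.A01 := mpInverse c₁ c₂ 𝒥.dbar1

/-- `ℋ^{0,1} = ker ∂̄ ∩ ker ∂̄†` in `Λ^{0,1} ⊗ 𝔤^{1,0}`. -/
def harmonic1 (c₀ : InnerProductSpace.Core ℂ 𝒥.g10) (c₁ : InnerProductSpace.Core ℂ 𝒥.A01) :
    Submodule ℂ 𝒥.A01 := LinearMap.ker 𝒥.dbar1 ⊓ LinearMap.ker (𝒥.dbarDagger0 c₀ c₁)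

/-- `ℋ^{0,2} = ker ∂̄ ∩ ker ∂̄†` in `Λ^{0,2} ⊗ 𝔤^{1,0}`. -/
def harmonic2 (c₁ : InnerProductSpace.Core ℂ 𝒥.A01) (c₂ : InnerProductSpace.Core ℂ 𝒥.A02) :
    Submodule ℂ 𝒥.A02 := LinearMap.ker 𝒥.dbar2 ⊓ LinearMap.ker (𝒥.dbarDagger1 c₁ c₂)

/-- The term `φ_k(t)` of the Kuranishi series: `φ_1 = ∑ t_ν η_ν` and
`φ_k = ½ ∑_{0<j<k} ∂̄†[φ_j, φ_{k-j}]` for `k > 1` (and `φ_0 = 0`). -/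
def kuranishiTerm (c₁ : InnerProductSpace.Core ℂ 𝒥.A01) (c₂ : InnerProductSpace.Core ℂ 𝒥.A02)
    {r : ℕ} (η : Fin r → 𝒥.A01) (t : Fin r → ℂ) : ℕ → 𝒥.A01
  | 0 => 0
  | 1 => ∑ ν, t ν • η ν
  | k + 2 => (1 / 2 : ℂ) • ∑ j : Fin (k + 1), 𝒥.dbarDagger1 c₁ c₂
      (𝒥.fnBracket (kuranishiTerm c₁ c₂ η t (j + 1)) (kuranishiTerm c₁ c₂ η t (k + 1 - j)))
  decreasing_by all_goals omega

/-- The base `𝔅 = {|t| < ε : ℋ^{0,2}[φ(t), φ(t)] = 0}`. -/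
def kuranishiBase (c₁ : InnerProductSpace.Core ℂ 𝒥.A01) (c₂ : InnerProductSpace.Core ℂ 𝒥.A02)
    {r : ℕ} (φ : (Fin r → ℂ) → 𝒥.A01) (ε : ℝ) : Set (Fin r → ℂ) :=
  {t | ‖t‖ < ε ∧ orthProj c₂ (𝒥.harmonic2 c₁ c₂) (𝒥.fnBracket (φ t) (φ t)) = 0}

end Kuranishi

end LieComplexStructure

end

/-! A parameter `φ` is encoded by the subspace `𝔤^{0,1}_φ`, the kernel of `graphMap φ`. This
subspace is a subalgebra exactly when `φ` satisfies the Maurer-Cartan equation, and its failure to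
be one is `mcDefect φ`, that is `½[φ,φ] - ∂̄φ`.

Existence. The Kuranishi series is the formal solution of `φ = φ₁ + ½∂̄†[φ,φ]`. A quadratic majorant
estimate makes it converge (`hasSum_quadratic_recursion`). Small solutions being unique, the sum is
the analytic local inverse of `v ↦ v - Q(v,v)` evaluated at `φ₁`
(`exists_analytic_quadratic_solution`). The equation forces `∂̄†` of the defect to vanish, and the
equation of the base removes its harmonic component. The Jacobi identity for vectors of `𝔤^{0,1}_φ`
gives a Bianchi identity: `∂̄` of the defect plus a term linear in `φ` and in the defect is zero
(`dbar2_mcDefect`). As `ξ ↦ (∂̄ξ, ∂̄†ξ, ℋξ)` is injective on `A²`, so are its small perturbations,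
and the defect is zero for small `φ` (`eventually_maurerCartan`).

Completeness. By the inverse function theorem every small `ψ` has a `Z ∈ 𝔤^{1,0}` and a `Φ` with
`∂̄†Φ = 0`, both analytic in `ψ`, such that `exp (ad Z)` carries `𝔤^{0,1}_Φ` to `𝔤^{0,1}_ψ`
(`exists_gauge_fixing`). If `ψ` satisfies Maurer-Cartan then so does `Φ`, hence `Φ = (Φ - ∂̄†∂̄Φ) +
½∂̄†[Φ,Φ]`, and the first summand is harmonic. With `h` its coordinates, uniqueness of small
solutions gives `Φ = φ(h)`. Since `[Φ,Φ] = 2∂̄Φ` has no harmonic component, `h` lands in the base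
(`kuranishi_isComplete`).

Real conjugacy. The automorphism `exp (ad Z)` does not respect the real form. For small `Φ`, `𝔤_ℂ`
is the direct sum of `𝔤` and `V = 𝔤^{0,1}_Φ`; let `ρ` be the projection to `𝔤` along `V`. The flow
`m' = -ad(ρ(mZ)) m` consists of real automorphisms, while `m exp (s ad Z)` moves with velocity
`ad(mZ - ρ(mZ))`, where `mZ - ρ(mZ) ∈ V`, and so preserves the subalgebra `V`. At time 1 the real
automorphism `m` therefore carries `𝔤^{0,1}_ψ` to `V` (`exists_real_automorphism`). The bound on `ρ`
in `exists_projection_to_real` is uniform in `Φ`, so one smallness condition on `Z` suffices. -/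

noncomputable section

open Complexification (tmul)

/-! ### Differential equations on the unit interval -/

section LinearODE

variable {V : Type*} [NormedAddCommGroup V] [NormedSpace ℝ V]

/-- A solution on `[0, 1]` of a linear differential inequality with zero initial value vanishes. -/
theorem eq_zero_of_norm_deriv_le {d d' : ℝ → V} {C : ℝ}
    (hd : ∀ s ∈ Set.Icc (0 : ℝ) 1, HasDerivWithinAt d (d' s) (Set.Icc 0 1) s)
    (hb : ∀ s ∈ Set.Icc (0 : ℝ) 1, ‖d' s‖ ≤ C * ‖d s‖) (h0 : d 0 = 0) :
    ∀ s ∈ Set.Icc (0 : ℝ) 1, d s = 0 :=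
  eq_zero_of_abs_deriv_le_mul_abs_self_of_eq_zero_right
    (fun s hs => (hd s hs).continuousWithinAt)
    (fun s hs => (hd s ⟨hs.1, hs.2.le⟩).mono_of_mem_nhdsWithin (Icc_mem_nhdsGE_of_mem hs))
    h0 (fun s hs => hb s ⟨hs.1, hs.2.le⟩)

/-- An autonomous differential equation whose right hand side is bounded by `1/2` on the ball of
radius `1/2` around the initial value has a solution on `[0, 1]` that stays in this ball. -/
theorem exists_solution_mem_closedBall [CompleteSpace V] {v : V → V} {x₀ : V} {K : NNReal}
    (hlip : LipschitzOnWith K v (Metric.closedBall x₀ (1 / 2)))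
    (hb : ∀ x ∈ Metric.closedBall x₀ (1 / 2), ‖v x‖ ≤ 1 / 2) :
    ∃ m : ℝ → V, m 0 = x₀ ∧ ∀ s ∈ Set.Icc (0 : ℝ) 1, m s ∈ Metric.closedBall x₀ (1 / 2) ∧
      HasDerivWithinAt m (v (m s)) (Set.Icc 0 1) s := by
  have hf : IsPicardLindelof (fun _ => v) (⟨0, by simp⟩ : Set.Icc (0 : ℝ) 1) x₀ (1 / 2) 0
      (1 / 2) K := by
    refine IsPicardLindelof.of_time_independent ?_ ?_ ?_
    · simpa using hb
    · simpa using hlip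
    · simp
  -- The solution is taken as a fixed point of the Picard map, since its values must be known to
  -- stay in the ball: speed at most `1/2` during time 1 matches the radius `1/2`.
  obtain ⟨α, hα⟩ := ODE.FunSpace.exists_isFixedPt_next hf (Metric.mem_closedBall_self le_rfl)
  refine ⟨α.compProj, α.compProj_val.trans (by rw [← hα, ODE.FunSpace.next_apply₀]),
    fun s hs => ⟨?_, ?_⟩⟩
  · simpa using α.compProj_mem_closedBall hf.mul_max_le (t := s)
  · apply ODE.hasDerivWithinAt_picard_Icc (t₀ := 0) (by simp) hf.continuousOn_uncurry
      α.continuous_compProj.continuousOn (fun _ ht' => α.compProj_mem_closedBall hf.mul_max_le)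
      x₀ hs |>.congr_of_mem _ hs
    intro t' ht'
    nth_rw 1 [← hα]
    rw [ODE.FunSpace.compProj_of_mem ht', ODE.FunSpace.next_apply]

/-- The quadratic differential equation `m' = T(m) m`, `m(0) = 1`, in a Banach algebra. -/
theorem exists_solution_mul {𝔸 : Type*} [NormedRing 𝔸] [NormedSpace ℝ 𝔸] [CompleteSpace 𝔸]
    (T : 𝔸 →L[ℝ] 𝔸) (h1 : ‖(1 : 𝔸)‖ ≤ 1) (hT : ‖T‖ ≤ 1 / 5) :
    ∃ m : ℝ → 𝔸, m 0 = 1 ∧ ∀ s ∈ Set.Icc (0 : ℝ) 1, ‖m s - 1‖ ≤ 1 / 2 ∧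
      HasDerivWithinAt m (T (m s) * m s) (Set.Icc 0 1) s := by
  have hn : ∀ x ∈ Metric.closedBall (1 : 𝔸) (1 / 2), ‖x‖ ≤ 3 / 2 := fun x hx => by
    rw [mem_closedBall_iff_norm] at hx
    calc ‖x‖ = ‖(x - 1) + 1‖ := by rw [sub_add_cancel]
      _ ≤ ‖x - 1‖ + ‖(1 : 𝔸)‖ := norm_add_le _ _
      _ ≤ 3 / 2 := by linarith
  have hTn : ∀ x, ‖T x‖ ≤ 1 / 5 * ‖x‖ := fun x => T.le_of_opNorm_le hT x
  -- With `‖x‖ ≤ 3/2` on the ball, the speed is at most `1/5 · 9/4 = 9/20 ≤ 1/2` and the Lipschitz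
  -- constant at most `2 · 1/5 · 3/2 = 3/5 ≤ 1`.
  obtain ⟨m, hm0, hm⟩ := exists_solution_mem_closedBall (v := fun x => T x * x) (x₀ := (1 : 𝔸))
    (K := 1) (by
      refine LipschitzOnWith.of_dist_le_mul fun x hx y hy => ?_
      rw [dist_eq_norm, dist_eq_norm]
      have e : T x * x - T y * y = T (x - y) * x + T y * (x - y) := by
        rw [map_sub]; noncomm_ring
      have a1 : ‖T (x - y) * x‖ ≤ (1 / 5 * ‖x - y‖) * (3 / 2) :=
        (norm_mul_le _ _).trans (mul_le_mul (hTn _) (hn x hx) (norm_nonneg _) (by positivity))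
      have a2 : ‖T y * (x - y)‖ ≤ (1 / 5 * (3 / 2)) * ‖x - y‖ :=
        (norm_mul_le _ _).trans (mul_le_mul_of_nonneg_right
          ((hTn _).trans (by linarith [hn y hy])) (norm_nonneg _))
      rw [e]
      refine (norm_add_le _ _).trans ?_
      have := norm_nonneg (x - y)
      simp only [NNReal.coe_one]
      linarith)
    (fun x hx => by
      refine (norm_mul_le _ _).trans ?_
      have := hn x hx
      have h2 := hTn x
      have := norm_nonneg x
      calc ‖T x‖ * ‖x‖ ≤ (1 / 5 * (3 / 2)) * (3 / 2) := by
            apply mul_le_mul <;> linarith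
        _ ≤ 1 / 2 := by norm_num)
  exact ⟨m, hm0, fun s hs => ⟨mem_closedBall_iff_norm.1 (hm s hs).1, (hm s hs).2⟩⟩

end LinearODE

/-! ### Exponentials of derivations -/

section ExpDerivation

variable {E : Type*} [NormedAddCommGroup E] [NormedSpace ℂ E] [CompleteSpace E]

theorem hasDerivAt_exp_smul_apply (D : E →L[ℂ] E) (x : E) (s : ℝ) :
    HasDerivAt (fun u : ℝ => NormedSpace.exp (u • D) x) (D (NormedSpace.exp (s • D) x)) s := by
  have h := hasDerivAt_exp_smul_const' (𝕂 := ℝ) D s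
  exact ((ContinuousLinearMap.apply ℂ E x).restrictScalars ℝ).hasFDerivAt.comp_hasDerivAt s h

/-- The exponential of a derivation preserves the bracket. -/
theorem exp_derivation_bracket (br : E →L[ℂ] E →L[ℂ] E) (D : E →L[ℂ] E)
    (hD : ∀ x y, D (br x y) = br (D x) y + br x (D y)) (x y : E) :
    NormedSpace.exp D (br x y) = br (NormedSpace.exp D x) (NormedSpace.exp D y) := by
  have hbr : ∀ s : ℝ, HasDerivAt
      (fun u : ℝ => br (NormedSpace.exp (u • D) x) (NormedSpace.exp (u • D) y))
      (br (D (NormedSpace.exp (s • D) x)) (NormedSpace.exp (s • D) y) +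
        br (NormedSpace.exp (s • D) x) (D (NormedSpace.exp (s • D) y))) s := fun s => by
    have h1 := hasDerivAt_exp_smul_apply D x s
    have h2 := hasDerivAt_exp_smul_apply D y s
    have h3 : HasDerivAt (fun u : ℝ => br (NormedSpace.exp (u • D) x))
        (br (D (NormedSpace.exp (s • D) x))) s :=
      (br.restrictScalars ℝ).hasFDerivAt.comp_hasDerivAt s h1
    have h4 := ((ContinuousLinearMap.restrictScalarsL ℂ E E ℝ ℝ).hasFDerivAt.comp_hasDerivAt s
      h3).clm_apply h2
    exact h4
  -- By the derivation rule the difference `d` of the two sides along `exp (sD)` satisfies `d' = D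
  -- d`.
  have := eq_zero_of_norm_deriv_le (C := ‖D‖)
    (d := fun u : ℝ => NormedSpace.exp (u • D) (br x y) -
      br (NormedSpace.exp (u • D) x) (NormedSpace.exp (u • D) y))
    (fun s _ => ((hasDerivAt_exp_smul_apply D (br x y) s).sub (hbr s)).hasDerivWithinAt)
    (fun s _ => by
      rw [← hD, ← map_sub]
      exact D.le_opNorm _)
    (by simp) 1 (by simp)
  rw [one_smul] at this
  exact sub_eq_zero.1 this

end ExpDerivation

/-! ### From `exp (ad Z)` to an automorphism of the real form -/

section RealGauge

variable {E : Type*} [NormedAddCommGroup E] [NormedSpace ℂ E] [FiniteDimensional ℂ E]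
  {P : Type*} [NormedAddCommGroup P] [NormedSpace ℂ P]

/-- An injective endomorphism that maps a subspace into itself detects membership in it. -/
theorem mem_iff_of_isUnit_of_mapsTo {w : E →L[ℂ] E} (hw : IsUnit w) {V : Submodule ℂ E}
    (h : ∀ x ∈ V, w x ∈ V) (x : E) : w x ∈ V ↔ x ∈ V := by
  obtain ⟨w', hw'⟩ := hw.exists_left_inv
  have hinj : Function.Injective w := fun a b hab => by
    have := congrArg w' hab
    rwa [← mul_apply_eq_comp, ← mul_apply_eq_comp, hw'] at this
  refine ⟨fun hx => ?_, h x⟩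
  have hr : Function.Injective (w.toLinearMap.restrict h) := fun a b hab =>
    Subtype.ext (hinj (congrArg Subtype.val hab))
  obtain ⟨y, hy⟩ := LinearMap.surjective_of_injective hr ⟨w x, hx⟩
  have : w y = w x := congrArg Subtype.val hy
  rw [← hinj this]
  exact y.2

theorem isUnit_of_norm_sub_one_le {m : E →L[ℂ] E} (hm : ‖m - 1‖ ≤ 1 / 2) : IsUnit m := by
  have := FiniteDimensional.complete ℂ E
  have h : ‖1 - m‖ < 1 := by rw [norm_sub_rev]; linarith
  have e : m = Units.oneSub (1 - m) h := by simp
  rw [e]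
  exact Units.isUnit _

/-- Let `V = ker q` be a complex subalgebra, complementary to the real form fixed by `σ`, and let
`ρ` be the corresponding projection to the real form. For small `Z`, the automorphism
`exp (ad Z)` agrees, up to an automorphism preserving `V`, with a real automorphism. -/
theorem exists_real_automorphism (br : E →L[ℂ] E →L[ℂ] E)
    (hjac : ∀ x y z, br x (br y z) = br (br x y) z + br y (br x z))
    (σ : E →L[ℝ] E) (hσ : ∀ x y, σ (br x y) = br (σ x) (σ y))
    (q : E →L[ℂ] P) (j : P →L[ℂ] E) (hqj : ∀ p, q (j p) = p)
    (hV : ∀ x y, q x = 0 → q y = 0 → q (br x y) = 0)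
    (ρ : E →L[ℝ] E) (hρσ : ∀ e, σ (ρ e) = ρ e) (hρq : ∀ e, q (e - ρ e) = 0)
    (Z : E) (hZ : ‖br‖ * ‖ρ‖ * ‖Z‖ ≤ 1 / 5) :
    ∃ m : E →L[ℂ] E, IsUnit m ∧ (∀ x y, m (br x y) = br (m x) (m y)) ∧
      (∀ x, m (σ x) = σ (m x)) ∧
      ∀ e, q (m (NormedSpace.exp (br Z) e)) = 0 ↔ q e = 0 := by
  have := FiniteDimensional.complete ℂ E
  -- The flow is `m' = -ad(ρ(mZ)) m`. The generator is real, and it differs from `-ad(mZ)` by the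
  -- adjoint of a vector of `V`.
  let T₀ : (E →L[ℂ] E) →L[ℝ] E :=
    ρ.comp ((ContinuousLinearMap.apply ℂ E Z).restrictScalars ℝ)
  let T : (E →L[ℂ] E) →L[ℝ] (E →L[ℂ] E) := -((br.restrictScalars ℝ).comp T₀)
  have hTm : ∀ m : E →L[ℂ] E, T m = -br (ρ (m Z)) := fun m => rfl
  have hTb : ∀ m : E →L[ℂ] E, ‖br (ρ (m Z))‖ ≤ 1 / 5 * ‖m‖ := fun m => by
    calc ‖br (ρ (m Z))‖ ≤ ‖br‖ * (‖ρ‖ * (‖m‖ * ‖Z‖)) := by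
          refine (br.le_opNorm _).trans ?_
          gcongr
          refine (ρ.le_opNorm _).trans ?_
          gcongr
          exact m.le_opNorm _
      _ = (‖br‖ * ‖ρ‖ * ‖Z‖) * ‖m‖ := by ring
      _ ≤ 1 / 5 * ‖m‖ := by gcongr
  obtain ⟨m, hm0, hm⟩ := exists_solution_mul T ContinuousLinearMap.norm_id_le
    (ContinuousLinearMap.opNorm_le_bound _ (by norm_num) fun m => by
      rw [hTm, norm_neg]; exact hTb m)
  have hmn : ∀ s ∈ Set.Icc (0 : ℝ) 1, ‖m s‖ ≤ 3 / 2 := fun s hs => by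
    calc ‖m s‖ = ‖(m s - 1) + 1‖ := by rw [sub_add_cancel]
      _ ≤ ‖m s - 1‖ + ‖(1 : E →L[ℂ] E)‖ := norm_add_le _ _
      _ ≤ 1 / 2 + 1 := add_le_add (hm s hs).1 ContinuousLinearMap.norm_id_le
      _ = 3 / 2 := by norm_num
  have hadX : ∀ s ∈ Set.Icc (0 : ℝ) 1, ∀ e, ‖br (ρ (m s Z)) e‖ ≤ 1 / 2 * ‖e‖ := fun s hs e => by
    refine (ContinuousLinearMap.le_opNorm _ _).trans ?_
    gcongr
    refine (hTb _).trans ?_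
    linarith [hmn s hs]
  have hme : ∀ s ∈ Set.Icc (0 : ℝ) 1, ∀ e, HasDerivWithinAt (fun u => m u e)
      (-br (ρ (m s Z)) (m s e)) (Set.Icc 0 1) s := fun s hs e =>
    ((ContinuousLinearMap.apply ℂ E e).restrictScalars ℝ).hasFDerivAt.comp_hasDerivWithinAt s
      (hm s hs).2
  have h01 : (1 : ℝ) ∈ Set.Icc (0 : ℝ) 1 := by simp
  have hjac' : ∀ X a b, br X (br a b) = br (br X a) b + br a (br X b) := fun X a b => hjac X a b
  -- By the Jacobi identity the failure to preserve the bracket solves the same linear equation `d'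
  -- = -ad(ρ(mZ)) d`, starting from 0. The failure to commute with `σ` does too, because `ρ(mZ)` is
  -- fixed by `σ`.
  have haut : ∀ x y, ∀ s ∈ Set.Icc (0 : ℝ) 1, m s (br x y) - br (m s x) (m s y) = 0 := by
    intro x y
    refine eq_zero_of_norm_deriv_le (C := 1 / 2)
      (d' := fun s => -br (ρ (m s Z)) (m s (br x y) - br (m s x) (m s y))) (fun s hs => ?_)
      (fun s hs => ?_) (by simp [hm0])
    · have h3 : HasDerivWithinAt (fun u : ℝ => br (m u x))
          (br (-br (ρ (m s Z)) (m s x))) (Set.Icc 0 1) s :=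
        (br.restrictScalars ℝ).hasFDerivAt.comp_hasDerivWithinAt s (hme s hs x)
      have h4 := ((ContinuousLinearMap.restrictScalarsL ℂ E E ℝ ℝ).hasFDerivAt.comp_hasDerivWithinAt
        s h3).clm_apply (hme s hs y)
      refine ((hme s hs (br x y)).sub h4).congr_deriv ?_
      change _ - (br (-br (ρ (m s Z)) (m s x)) (m s y) + br (m s x) (-br (ρ (m s Z)) (m s y))) = _
      rw [map_sub, hjac']
      simp only [map_neg, neg_apply]
      abel
    · rw [norm_neg]
      exact hadX s hs _
  have hreal : ∀ x, ∀ s ∈ Set.Icc (0 : ℝ) 1, m s (σ x) - σ (m s x) = 0 := by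
    intro x
    refine eq_zero_of_norm_deriv_le (C := 1 / 2)
      (d' := fun s => -br (ρ (m s Z)) (m s (σ x) - σ (m s x))) (fun s hs => ?_)
      (fun s hs => ?_) (by simp [hm0])
    · refine ((hme s hs (σ x)).sub
        (σ.hasFDerivAt.comp_hasDerivWithinAt s (hme s hs x))).congr_deriv ?_
      rw [map_neg, hσ, hρσ, map_sub]
      abel
    · rw [norm_neg]
      exact hadX s hs _
  refine ⟨m 1, isUnit_of_norm_sub_one_le (hm 1 h01).1, fun x y => sub_eq_zero.1 (haut x y 1 h01),
    fun x => sub_eq_zero.1 (hreal x 1 h01), fun e => ?_⟩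
  -- For `w = m exp (s ad Z) e` one has `w' = [v, w]` with `v = mZ - ρ(mZ) ∈ V`. As `V` is a
  -- subalgebra, `q [v, w]` depends only on `q w`, so `q w` obeys a linear equation and stays 0.
  have hpres : ∀ e, q e = 0 → ∀ s ∈ Set.Icc (0 : ℝ) 1,
      q (m s (NormedSpace.exp (s • br Z) e)) = 0 := by
    intro e he
    refine eq_zero_of_norm_deriv_le
      (C := ‖q‖ * (‖br‖ * ((3 / 2 * ‖Z‖) + ‖ρ‖ * (3 / 2 * ‖Z‖))) * ‖j‖)
      (d' := fun s => q (br (m s Z - ρ (m s Z)) (j (q (m s (NormedSpace.exp (s • br Z) e))))))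
      (fun s hs => ?_) (fun s hs => ?_) (by simp [hm0, he])
    · have h1 : HasDerivWithinAt (fun u : ℝ => (m u) (NormedSpace.exp (u • br Z) e))
          (-br (ρ (m s Z)) (m s (NormedSpace.exp (s • br Z) e)) +
            m s (br Z (NormedSpace.exp (s • br Z) e))) (Set.Icc 0 1) s :=
        ((ContinuousLinearMap.restrictScalarsL ℂ E E ℝ ℝ).hasFDerivAt.comp_hasDerivWithinAt
          s (hm s hs).2).clm_apply (hasDerivAt_exp_smul_apply (br Z) e s).hasDerivWithinAt
      refine ((q.restrictScalars ℝ).hasFDerivAt.comp_hasDerivWithinAt s h1).congr_deriv ?_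
      change q _ = q _
      set w := m s (NormedSpace.exp (s • br Z) e) with hw
      have h2 : m s (br Z (NormedSpace.exp (s • br Z) e)) = br (m s Z) w :=
        sub_eq_zero.1 (haut _ _ s hs)
      have h3 : q (br (m s Z - ρ (m s Z)) (w - j (q w))) = 0 :=
        hV _ _ (hρq _) (by rw [map_sub, hqj, sub_self])
      rw [h2, ← sub_eq_zero, ← map_sub, ← h3]
      congr 1
      simp only [map_sub, sub_apply]
      abel
    · refine (q.le_opNorm _).trans ?_
      rw [mul_assoc, mul_assoc, mul_assoc]
      gcongr
      refine (ContinuousLinearMap.le_opNorm _ _).trans ?_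
      rw [← mul_assoc]
      have hmZ : ‖m s Z‖ ≤ 3 / 2 * ‖Z‖ := (m s).le_of_opNorm_le (hmn s hs) Z
      gcongr
      · refine (br.le_opNorm _).trans ?_
        gcongr
        refine (norm_sub_le _ _).trans ?_
        gcongr
        refine (ρ.le_opNorm _).trans ?_
        gcongr
      · exact j.le_opNorm _
  let _ : NormedAlgebra ℚ (E →L[ℂ] E) := NormedAlgebra.restrictScalars ℚ ℂ (E →L[ℂ] E)
  have hu : IsUnit (m 1 * NormedSpace.exp (br Z)) :=
    (isUnit_of_norm_sub_one_le (hm 1 h01).1).mul (NormedSpace.isUnit_exp (br Z))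
  -- Invertibility and finite dimension upgrade invariance of `V` to an equivalence.
  have := mem_iff_of_isUnit_of_mapsTo hu (V := LinearMap.ker q.toLinearMap)
    (fun x hx => by simpa using hpres x hx 1 h01) e
  simpa using this

/-- For small `φ`, the graph `{pP e = -φ (pN e)}` is complementary to the real form fixed by `σ`,
and the projections to the real form along these graphs are uniformly bounded. -/
theorem exists_projection_to_real {N : Type*} [NormedAddCommGroup N] [NormedSpace ℂ N]
    (iP : P →L[ℂ] E) (iN : N →L[ℂ] E) (pP : E →L[ℂ] P) (pN : E →L[ℂ] N)
    (hPP : ∀ x, pP (iP x) = x) (hNN : ∀ x, pN (iN x) = x) (hPN : ∀ x, pP (iN x) = 0)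
    (hNP : ∀ x, pN (iP x) = 0) (hsum : ∀ e, iP (pP e) + iN (pN e) = e)
    (σ : E →L[ℝ] E) (hσσ : ∀ e, σ (σ e) = e) (hσN : ∀ e, σ (iN (pN e)) = iP (pP (σ e))) :
    ∃ C : ℝ, ∀ᶠ φ : N →L[ℂ] P in 𝓝 0,
      (∃ ρ : E →L[ℝ] E, ‖ρ‖ ≤ C ∧ (∀ e, σ (ρ e) = ρ e) ∧
        ∀ e, pP (e - ρ e) + φ (pN (e - ρ e)) = 0) ∧
      ∀ x, σ x = x → pP x + φ (pN x) = 0 → x = 0 := by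
  have := FiniteDimensional.complete ℂ E
  -- This bounds `id - W ∘ D` below, using `‖φ‖ < 1` (the factor 1) and `‖(1 - K)⁻¹‖ ≤ 2`.
  refine ⟨1 + (‖iN‖ + ‖iP‖ * 1) * (‖pN‖ * (2 * (1 + ‖σ‖))), ?_⟩
  have hc : ∀ᶠ φ : N →L[ℂ] P in 𝓝 0, (1 + ‖σ‖) * (‖iP‖ * (‖φ‖ * ‖pN‖)) < 1 / 2 := by
    have : Continuous fun φ : N →L[ℂ] P => (1 + ‖σ‖) * (‖iP‖ * (‖φ‖ * ‖pN‖)) := by fun_prop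
    exact (this.tendsto 0).eventually_lt_const (by simp)
  have hc1 : ∀ᶠ φ : N →L[ℂ] P in 𝓝 0, ‖φ‖ < 1 :=
    (continuous_norm.tendsto 0).eventually_lt_const (by simp)
  filter_upwards [hc, hc1] with φ hφ hφ1
  have hk : ∀ e, ‖iP (φ (pN e))‖ ≤ (‖iP‖ * (‖φ‖ * ‖pN‖)) * ‖e‖ := fun e => by
    rw [mul_assoc, mul_assoc]
    refine iP.le_opNorm_of_le (φ.le_opNorm_of_le (pN.le_opNorm e))
  have hkσ : ∀ e, ‖iP (φ (pN e))‖ + ‖σ (iP (φ (pN e)))‖ ≤ 1 / 2 * ‖e‖ := fun e => by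
    calc _ ≤ ‖iP (φ (pN e))‖ + ‖σ‖ * ‖iP (φ (pN e))‖ := by gcongr; exact σ.le_opNorm _
      _ = (1 + ‖σ‖) * ‖iP (φ (pN e))‖ := by ring
      _ ≤ (1 + ‖σ‖) * ((‖iP‖ * (‖φ‖ * ‖pN‖)) * ‖e‖) := by gcongr; exact hk e
      _ = ((1 + ‖σ‖) * (‖iP‖ * (‖φ‖ * ‖pN‖))) * ‖e‖ := by ring
      _ ≤ 1 / 2 * ‖e‖ := by gcongr
  constructor
  -- The projection is sought as `e - W y`, where `W y = y^{0,1} - φ y^{0,1}` lies in the graph and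
  -- `σ y = -y`. For such `y`, `W y - σ (W y) = y - K y`, so reality of `e - W y` amounts to `(1 -
  -- K) y = e - σ e`, solved by inverting `1 - K`.
  · let K₀ : E →L[ℝ] E := (iP.comp (φ.comp pN)).restrictScalars ℝ
    let K : E →L[ℝ] E := K₀ - σ.comp K₀
    have hKe : ∀ e, K e = iP (φ (pN e)) - σ (iP (φ (pN e))) := fun e => rfl
    have hK : ‖K‖ ≤ 1 / 2 := ContinuousLinearMap.opNorm_le_bound _ (by norm_num) fun e => by
      rw [hKe]; exact (norm_sub_le _ _).trans (hkσ e)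
    let u : (E →L[ℝ] E)ˣ := Units.oneSub K (by linarith)
    let R : E →L[ℝ] E := ↑u⁻¹
    have hR : ∀ x, R x = x + K (R x) := fun x => by
      have h : (u : E →L[ℝ] E) * R = 1 := u.mul_inv
      have h1 : (1 - K) * R = 1 := h
      have h2 := DFunLike.congr_fun h1 x
      simp only [sub_mul, one_mul, sub_apply, mul_apply_eq_comp, one_apply_eq_self] at h2
      exact sub_eq_iff_eq_add.1 h2
    have hRn : ∀ x, ‖R x‖ ≤ 2 * ‖x‖ := fun x => by
      have h1 : ‖R x‖ ≤ ‖x‖ + 1 / 2 * ‖R x‖ := by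
        conv_lhs => rw [hR x]
        exact (norm_add_le _ _).trans (by gcongr; exact K.le_of_opNorm_le hK _)
      linarith
    let D : E →L[ℝ] E := R.comp (ContinuousLinearMap.id ℝ E - σ)
    have hD : ∀ e, D e = R (e - σ e) := fun e => rfl
    let W : E →L[ℝ] E := ((iN - iP.comp φ).comp pN).restrictScalars ℝ
    have hW : ∀ y, W y = iN (pN y) - iP (φ (pN y)) := fun y => rfl
    have hanti : ∀ e, σ (D e) = -D e := fun e => by
      rw [hD, hR, hKe]
      simp only [map_add, map_sub, hσσ]
      abel
    have hWσ : ∀ e, W (D e) - σ (W (D e)) = e - σ e := fun e => by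
      have h1 : D e = (e - σ e) + K (D e) := hR _
      have h2 : σ (iN (pN (D e))) = -iP (pP (D e)) := by rw [hσN, hanti, map_neg, map_neg]
      rw [hKe] at h1
      rw [hW, map_sub, h2, ← sub_eq_of_eq_add h1]
      nth_rewrite 5 [← hsum (D e)]
      abel
    refine ⟨ContinuousLinearMap.id ℝ E - W.comp D, ?_, fun e => ?_, fun e => ?_⟩
    · refine ContinuousLinearMap.opNorm_le_bound _ (by positivity) fun e => ?_
      have h1 : ‖D e‖ ≤ 2 * (1 + ‖σ‖) * ‖e‖ := by
        rw [hD]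
        refine (hRn _).trans ?_
        rw [mul_assoc, add_mul, one_mul]
        gcongr
        exact (norm_sub_le _ _).trans (by gcongr; exact σ.le_opNorm e)
      have h2 : ‖W (D e)‖ ≤ (‖iN‖ + ‖iP‖ * 1) * (‖pN‖ * ‖D e‖) := by
        rw [hW, add_mul]
        refine (norm_sub_le _ _).trans (add_le_add ?_ ?_)
        · exact iN.le_opNorm_of_le (pN.le_opNorm _)
        · rw [mul_assoc]
          exact iP.le_opNorm_of_le (φ.le_of_opNorm_le_of_le hφ1.le (pN.le_opNorm _))
      change ‖e - W (D e)‖ ≤ _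
      calc _ ≤ ‖e‖ + ‖W (D e)‖ := norm_sub_le _ _
        _ ≤ ‖e‖ + (‖iN‖ + ‖iP‖ * 1) * (‖pN‖ * (2 * (1 + ‖σ‖) * ‖e‖)) := by
          gcongr; exact h2.trans (by gcongr)
        _ = _ := by ring
    · change σ (e - W (D e)) = e - W (D e)
      have := hWσ e
      rw [map_sub, sub_eq_sub_iff_sub_eq_sub, ← neg_sub, ← this]
      abel
    · change pP (e - (e - W (D e))) + φ (pN (e - (e - W (D e)))) = 0
      rw [sub_sub_cancel, hW]
      simp [hPP, hNN, hPN, hNP]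
  · intro x hx h
    have h1 : iP (pP x) = -iP (φ (pN x)) := by
      rw [eq_neg_of_add_eq_zero_left h, map_neg]
    -- The `(0,1)`-part of a real vector is the conjugate of its `(1,0)`-part, so a real vector in
    -- the graph is bounded by half its own norm.
    have h2 : iN (pN x) = -σ (iP (φ (pN x))) := by
      rw [← map_neg, ← h1, ← hσσ (iN (pN x)), hσN, hx]
    have h3 : ‖x‖ ≤ 1 / 2 * ‖x‖ := by
      conv_lhs => rw [← hsum x, h1, h2]
      refine (norm_add_le _ _).trans ?_
      rw [norm_neg, norm_neg]
      exact hkσ x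
    exact norm_le_zero_iff.1 (by linarith)

end RealGauge

/-! ### The quadratic equation `x = v + Q(x, x)` -/

section QuadraticSeries

variable {V : Type*} [NormedAddCommGroup V] [NormedSpace ℂ V]

/-- Small solutions of `x = v + Q(x, x)` are unique. -/
theorem quadratic_solution_unique (Q : V →L[ℂ] V →L[ℂ] V) {v x y : V}
    (hx : x = v + Q x x) (hy : y = v + Q y y) (h : ‖Q‖ * (‖x‖ + ‖y‖) < 1) : x = y := by
  have e : x - y = Q x (x - y) + Q (x - y) y := by
    have h1 : x - y = (v + Q x x) - (v + Q y y) := by rw [← hx, ← hy]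
    have h2 : Q x (x - y) + Q (x - y) y = (v + Q x x) - (v + Q y y) := by
      simp only [map_sub, sub_apply]
      abel
    rw [h2, ← h1]
  have hn : ‖x - y‖ ≤ ‖Q‖ * (‖x‖ + ‖y‖) * ‖x - y‖ := by
    calc ‖x - y‖ = ‖Q x (x - y) + Q (x - y) y‖ := by rw [← e]
      _ ≤ ‖Q‖ * ‖x‖ * ‖x - y‖ + ‖Q‖ * ‖x - y‖ * ‖y‖ :=
        (norm_add_le _ _).trans (add_le_add (Q.le_opNorm₂ _ _) (Q.le_opNorm₂ _ _))
      _ = _ := by ring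
  by_contra hne
  have hpos : 0 < ‖x - y‖ := norm_pos_iff.2 (sub_ne_zero.2 hne)
  nlinarith

variable [CompleteSpace V]

/-- The antidiagonals of index below `n` are disjoint and contained in the square `[0, n)²`, over
which the products sum to the right hand side. -/
theorem sum_range_antidiagonal_le (a : ℕ → ℝ) (ha : ∀ k, 0 ≤ a k) (n : ℕ) :
    ∑ k ∈ Finset.range n, ∑ p ∈ Finset.HasAntidiagonal.antidiagonal k, a p.1 * a p.2 ≤
      (∑ k ∈ Finset.range n, a k) ^ 2 := by
  rw [sq, Finset.sum_mul_sum, ← Finset.sum_product', ← Finset.sum_biUnion]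
  · refine Finset.sum_le_sum_of_subset_of_nonneg (fun p hp => ?_)
      (fun p _ _ => mul_nonneg (ha _) (ha _))
    simp only [Finset.mem_biUnion, Finset.mem_range, Finset.HasAntidiagonal.mem_antidiagonal,
      Finset.mem_product] at hp ⊢
    omega
  · intro i _ j _ hij
    refine Finset.disjoint_left.2 fun p hi hj => hij ?_
    rw [Finset.HasAntidiagonal.mem_antidiagonal] at hi hj
    omega

/-- The formal solution of `x = v + Q(x, x)` converges to a solution when `v` is small. -/
theorem hasSum_quadratic_recursion (Q : V →L[ℂ] V →L[ℂ] V) (w : ℕ → V)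
    (hw : ∀ k, w (k + 1) = ∑ p ∈ Finset.HasAntidiagonal.antidiagonal k, Q (w p.1) (w p.2))
    (h0 : 4 * ‖Q‖ * ‖w 0‖ ≤ 1) :
    ∃ x, HasSum w x ∧ ‖x‖ ≤ 2 * ‖w 0‖ ∧ x = w 0 + Q x x := by
  have hS : ∀ n, ∑ k ∈ Finset.range n, ‖w k‖ ≤ 2 * ‖w 0‖ := by
    intro n
    induction n with
    | zero => simp
    | succ n ih =>
      rw [Finset.sum_range_succ']
      -- The bound `2‖w 0‖` reproduces itself: `‖Q‖ (2‖w 0‖)² = (4‖Q‖‖w 0‖) ‖w 0‖ ≤ ‖w 0‖`, and the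
      -- remaining `‖w 0‖` is the initial term.
      have h1 : ∑ k ∈ Finset.range n, ‖w (k + 1)‖ ≤ ‖Q‖ * (2 * ‖w 0‖) ^ 2 := by
        calc _ ≤ ∑ k ∈ Finset.range n, ‖Q‖ * ∑ p ∈ Finset.HasAntidiagonal.antidiagonal k, ‖w p.1‖ * ‖w p.2‖ := by
              refine Finset.sum_le_sum fun k _ => ?_
              rw [hw, Finset.mul_sum]
              refine (norm_sum_le _ _).trans (Finset.sum_le_sum fun p _ => ?_)
              rw [← mul_assoc]
              exact Q.le_opNorm₂ _ _
          _ ≤ ‖Q‖ * (∑ k ∈ Finset.range n, ‖w k‖) ^ 2 := by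
              rw [← Finset.mul_sum]
              gcongr
              exact sum_range_antidiagonal_le _ (fun _ => norm_nonneg _) n
          _ ≤ _ := by
              gcongr
      have h2 : ‖Q‖ * (2 * ‖w 0‖) ^ 2 = (4 * ‖Q‖ * ‖w 0‖) * ‖w 0‖ := by ring
      have h3 : (4 * ‖Q‖ * ‖w 0‖) * ‖w 0‖ ≤ 1 * ‖w 0‖ := by gcongr
      linarith
  have hsn : Summable fun k => ‖w k‖ :=
    summable_of_sum_range_le (fun _ => norm_nonneg _) hS
  have hs : Summable w := hsn.of_norm
  refine ⟨∑' k, w k, hs.hasSum, (norm_tsum_le_tsum_norm hsn).trans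
    (Real.tsum_le_of_sum_range_le (fun _ => norm_nonneg _) hS), ?_⟩
  have hF : Summable fun p : ℕ × ℕ => Q (w p.1) (w p.2) := by
    refine Summable.of_norm_bounded
      (g := fun p : ℕ × ℕ => ‖Q‖ * (‖w p.1‖ * ‖w p.2‖))
      ((hsn.mul_of_nonneg hsn (fun _ => norm_nonneg _) (fun _ => norm_nonneg _)).mul_left _)
      fun p => ?_
    rw [← mul_assoc]
    exact Q.le_opNorm₂ _ _
  have e1 : ∑' p : ℕ × ℕ, Q (w p.1) (w p.2) = Q (∑' k, w k) (∑' k, w k) := by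
    rw [hF.tsum_prod, Q.map_tsum hs]
    have : ∀ i, ∑' j, Q (w i) (w j) = Q (w i) (∑' k, w k) := fun i => ((Q (w i)).map_tsum hs).symm
    simp only [this]
    exact (((ContinuousLinearMap.apply ℂ V (∑' k, w k)).map_tsum (hs.mapL Q))).symm
  -- The absolutely convergent double series is regrouped along antidiagonals, where the recursion
  -- identifies each partial sum.
  have e2 : ∑' p : ℕ × ℕ, Q (w p.1) (w p.2) = ∑' k, w (k + 1) := by
    have hF' := (Finset.HasAntidiagonal.sigmaAntidiagonalEquivProd (A := ℕ)).summable_iff.2 hF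
    rw [← (Finset.HasAntidiagonal.sigmaAntidiagonalEquivProd (A := ℕ)).tsum_eq]
    refine (hF'.tsum_sigma' ?_).trans ?_
    rotate_left
    · refine tsum_congr fun k => ?_
      rw [hw, tsum_fintype, Finset.univ_eq_attach,
        ← Finset.sum_attach (Finset.HasAntidiagonal.antidiagonal k)]
      rfl
    · exact fun _ => Summable.of_finite
  rw [← e1, e2]
  exact hs.tsum_eq_zero_add

open scoped ContDiff in
/-- The solution of `x = L t + Q(x, x)` given by the recursive power series is analytic near `0`,
and satisfies any given property of small vectors. -/
theorem exists_analytic_quadratic_solution {T : Type*} [NormedAddCommGroup T] [NormedSpace ℂ T]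
    (L : T →L[ℂ] V) (Q : V →L[ℂ] V →L[ℂ] V) (w : T → ℕ → V) (hw0 : ∀ t, w t 0 = L t)
    (hw : ∀ t k, w t (k + 1) = ∑ p ∈ Finset.HasAntidiagonal.antidiagonal k, Q (w t p.1) (w t p.2))
    {p : V → Prop} (hp : ∀ᶠ v in 𝓝 0, p v) :
    ∃ ε > 0, ∃ φ : T → V, φ 0 = 0 ∧ ∀ t, ‖t‖ < ε → HasSum (w t) (φ t) ∧ AnalyticAt ℂ φ t ∧
      φ t = L t + Q (φ t) (φ t) ∧ p (φ t) := by
  -- The derivative of `f` at 0 is the identity, so `f` has an analytic local inverse `R`.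
  -- Analyticity of the solution comes from `R`, and uniqueness of small solutions transfers it to
  -- the sum of the series.
  let f : V → V := fun v => v - Q v v
  have hf : ContDiffAt ℂ ω f 0 :=
    contDiffAt_id.sub ((Q.contDiff.contDiffAt).clm_apply contDiffAt_id)
  have hf0 : f 0 = 0 := by simp [f]
  have hf' : HasFDerivAt f ((ContinuousLinearEquiv.refl ℂ V : V ≃L[ℂ] V) : V →L[ℂ] V) 0 := by
    refine ((hasFDerivAt_id (𝕜 := ℂ) (0 : V)).sub
      ((Q.hasFDerivAt (x := 0)).clm_apply (hasFDerivAt_id (𝕜 := ℂ) (0 : V)))).congr_fderiv ?_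
    ext v
    simp
  have hω : (ω : WithTop ℕ∞) ≠ 0 := by simp
  let R := hf.localInverse hf' hω
  have hR0 : R 0 = 0 := by
    have := hf.localInverse_apply_image hf' hω
    rwa [hf0] at this
  have hRan : AnalyticAt ℂ R 0 := by
    have := hf.to_localInverse hf' hω
    rw [hf0] at this
    exact this.analyticAt
  have hfR : ∀ᶠ x in 𝓝 0, f (R x) = x := by
    have := (hf.hasStrictFDerivAt' hf' hω).eventually_right_inverse
    rwa [hf0] at this
  have hRt : Filter.Tendsto (fun t => R (L t)) (𝓝 0) (𝓝 0) := by
    have h := hRan.continuousAt.tendsto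
    rw [hR0] at h
    exact h.comp (by simpa using L.continuous.tendsto 0)
  have hL : Filter.Tendsto L (𝓝 0) (𝓝 0) := by simpa using L.continuous.tendsto 0
  have hall : ∀ᶠ t in 𝓝 (0 : T), HasSum (w t) (R (L t)) ∧ AnalyticAt ℂ (fun t => R (L t)) t ∧
      R (L t) = L t + Q (R (L t)) (R (L t)) ∧ p (R (L t)) := by
    have hc : ∀ᶠ t in 𝓝 (0 : T), 4 * ‖Q‖ * ‖L t‖ < 1 := by
      have : Continuous fun t => 4 * ‖Q‖ * ‖L t‖ := by fun_prop
      exact (this.tendsto 0).eventually_lt_const (by simp)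
    have hc2 : ∀ᶠ t in 𝓝 (0 : T), ‖Q‖ * (2 * ‖L t‖ + ‖R (L t)‖) < 1 := by
      have h1 := ((hL.norm.const_mul 2).add hRt.norm).const_mul ‖Q‖
      exact h1.eventually_lt_const (by simp)
    filter_upwards [hc, hc2, hL.eventually hfR, hL.eventually hRan.eventually_analyticAt,
      hRt.eventually hp] with t h1 h2 h3 h4 h5
    have h3' : R (L t) = L t + Q (R (L t)) (R (L t)) := sub_eq_iff_eq_add.1 h3
    obtain ⟨x, hx, hxn, hxe⟩ := hasSum_quadratic_recursion Q (w t) (hw t) (by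
      rw [hw0]; exact h1.le)
    rw [hw0] at hxn hxe
    have : x = R (L t) := quadratic_solution_unique Q hxe h3'
      (lt_of_le_of_lt (by gcongr) h2)
    exact ⟨this ▸ hx, h4.comp (L.analyticAt t), h3', h5⟩
  obtain ⟨ε, hε, hball⟩ := Metric.eventually_nhds_iff.1 hall
  exact ⟨ε, hε, fun t => R (L t), by simp [hR0], fun t ht => hball (by simpa using ht)⟩

end QuadraticSeries

/-! ### Gauge fixing by the inverse function theorem -/

section GaugeFixing

variable {E N P : Type*} [NormedAddCommGroup E] [NormedSpace ℂ E]
  [NormedAddCommGroup N] [NormedSpace ℂ N] [NormedAddCommGroup P] [NormedSpace ℂ P]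

theorem exp_mul_exp_neg [CompleteSpace E] (D : E →L[ℂ] E) : NormedSpace.exp D * NormedSpace.exp (-D) = 1 := by
  let _ : NormedAlgebra ℚ (E →L[ℂ] E) := NormedAlgebra.restrictScalars ℚ ℂ (E →L[ℂ] E)
  rw [← NormedSpace.exp_add_of_commute (Commute.neg_right (Commute.refl D)), add_neg_cancel,
    NormedSpace.exp_zero]

/-- The graph of `-ψ` over `N`, moved by `exp (-ad Z)` for `Z ∈ P`. -/
def movedGraph (br : E →L[ℂ] E →L[ℂ] E) (iP : P →L[ℂ] E) (iN : N →L[ℂ] E)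
    (x : P × (N →L[ℂ] P)) : N →L[ℂ] E :=
  (NormedSpace.exp (-br (iP x.1)) : E →L[ℂ] E).comp (iN - iP.comp x.2)

/-- The map `φ : N → P` such that the graph of `-φ` is the graph of `-ψ` moved by
`exp (-ad Z)`. -/
def gaugeAction (br : E →L[ℂ] E →L[ℂ] E) (iP : P →L[ℂ] E) (iN : N →L[ℂ] E) (pP : E →L[ℂ] P)
    (pN : E →L[ℂ] N) (x : P × (N →L[ℂ] P)) : N →L[ℂ] P :=
  -(pP.comp (movedGraph br iP iN x)).comp (Ring.inverse (pN.comp (movedGraph br iP iN x)))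

variable (br : E →L[ℂ] E →L[ℂ] E) (iP : P →L[ℂ] E) (iN : N →L[ℂ] E) (pP : E →L[ℂ] P)
  (pN : E →L[ℂ] N)

theorem movedGraph_zero : movedGraph br iP iN 0 = iN := by
  ext v
  simp [movedGraph]

open scoped ContDiff in
theorem contDiff_movedGraph [CompleteSpace E] : ContDiff ℂ ω (movedGraph br iP iN) := by
  have h1 : ContDiff ℂ ω (NormedSpace.exp : (E →L[ℂ] E) → (E →L[ℂ] E)) :=
    contDiff_iff_contDiffAt.2 fun D => (NormedSpace.exp_analytic (𝕂 := ℂ) D).contDiffAt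
  have h2 : ContDiff ℂ ω fun x : P × (N →L[ℂ] P) => -br (iP x.1) :=
    (br.contDiff.comp (iP.contDiff.comp contDiff_fst)).neg
  have h3 : ContDiff ℂ ω fun x : P × (N →L[ℂ] P) => iN - iP.comp x.2 :=
    contDiff_const.sub (contDiff_const.clm_comp contDiff_snd)
  exact (h1.comp h2).clm_comp h3

theorem fderiv_movedGraph_zero [CompleteSpace E] (x : P × (N →L[ℂ] P)) :
    fderiv ℂ (movedGraph br iP iN) 0 x = -(br (iP x.1)).comp iN - iP.comp x.2 := by
  have h2 : HasFDerivAt (fun x : P × (N →L[ℂ] P) => -br (iP x.1))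
      (-(br.comp (iP.comp (ContinuousLinearMap.fst ℂ P (N →L[ℂ] P))))) 0 :=
    (br.comp (iP.comp (ContinuousLinearMap.fst ℂ P (N →L[ℂ] P)))).hasFDerivAt.neg
  have h1 : HasFDerivAt (NormedSpace.exp : (E →L[ℂ] E) → (E →L[ℂ] E))
      (1 : (E →L[ℂ] E) →L[ℂ] (E →L[ℂ] E))
      (-br (iP (0 : P × (N →L[ℂ] P)).1)) := by
    simpa using (hasFDerivAt_exp_zero (𝕂 := ℂ) (𝔸 := E →L[ℂ] E))
  have h3 : HasFDerivAt (fun x : P × (N →L[ℂ] P) => iN - iP.comp x.2)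
      (-((ContinuousLinearMap.compL ℂ N P E iP).comp
        (ContinuousLinearMap.snd ℂ P (N →L[ℂ] P)))) 0 :=
    ((ContinuousLinearMap.compL ℂ N P E iP).comp
        (ContinuousLinearMap.snd ℂ P (N →L[ℂ] P))).hasFDerivAt.const_sub iN
  have h := (h1.comp 0 h2).clm_comp h3
  have h' := h.fderiv
  change fderiv ℂ (movedGraph br iP iN) 0 = _ at h'
  rw [h']
  ext v
  simp
  abel

open scoped ContDiff in
theorem contDiffAt_gaugeAction_zero [CompleteSpace E] [CompleteSpace N]
    (hNN : ∀ x, pN (iN x) = x) : ContDiffAt ℂ ω (gaugeAction br iP iN pP pN) 0 := by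
  have hM := (contDiff_movedGraph br iP iN).contDiffAt (x := 0)
  have h1 : pN.comp (movedGraph br iP iN 0) = ((1 : (N →L[ℂ] N)ˣ) : N →L[ℂ] N) := by
    rw [movedGraph_zero]
    ext v
    simp [hNN]
  have hinv : ContDiffAt ℂ ω (Ring.inverse : (N →L[ℂ] N) → (N →L[ℂ] N))
      (pN.comp (movedGraph br iP iN 0)) := by
    rw [h1]
    exact contDiffAt_ringInverse ℂ 1
  have ha : ContDiffAt ℂ ω (fun x => pN.comp (movedGraph br iP iN x)) 0 :=
    contDiffAt_const.clm_comp hM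
  exact ((contDiffAt_const.clm_comp hM).neg).clm_comp
    (ContDiffAt.comp 0 (g := (Ring.inverse : (N →L[ℂ] N) → (N →L[ℂ] N))) hinv ha)

theorem gaugeAction_zero (hPN : ∀ x, pP (iN x) = 0) : gaugeAction br iP iN pP pN 0 = 0 := by
  have : pP.comp iN = 0 := by ext v; simp [hPN]
  simp [gaugeAction, movedGraph_zero, this]

/-- The derivative of the inverse factor drops out because it is multiplied by `pP ∘ iN = 0`. In the
notation of `exists_gauge_fixing` the result is `ψ - d Z`, which makes the gauge condition solvable
for `Z`. -/
theorem fderiv_gaugeAction_zero [CompleteSpace E] [CompleteSpace N]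
    (hNN : ∀ x, pN (iN x) = x) (hPN : ∀ x, pP (iN x) = 0) (hPP : ∀ x, pP (iP x) = x)
    (x : P × (N →L[ℂ] P)) : fderiv ℂ (gaugeAction br iP iN pP pN) 0 x =
      x.2 + pP.comp ((br (iP x.1)).comp iN) := by
  have hM : HasFDerivAt (movedGraph br iP iN) (fderiv ℂ (movedGraph br iP iN) 0) 0 :=
    ((contDiff_movedGraph br iP iN).differentiable (by simp) 0).hasFDerivAt
  have h1 : pN.comp (movedGraph br iP iN 0) = ((1 : (N →L[ℂ] N)ˣ) : N →L[ℂ] N) := by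
    rw [movedGraph_zero]
    ext v
    simp [hNN]
  have hi : HasFDerivAt (Ring.inverse : (N →L[ℂ] N) → (N →L[ℂ] N))
      (fderiv ℂ Ring.inverse (pN.comp (movedGraph br iP iN 0)))
      (pN.comp (movedGraph br iP iN 0)) := by
    rw [h1]
    exact (hasFDerivAt_ringInverse (𝕜 := ℂ) (1 : (N →L[ℂ] N)ˣ)).differentiableAt.hasFDerivAt
  have hb := (((ContinuousLinearMap.compL ℂ N E P pP).hasFDerivAt.comp 0 hM).neg)
  have ha := hi.comp 0 ((ContinuousLinearMap.compL ℂ N E N pN).hasFDerivAt.comp 0 hM)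
  have h := (hb.clm_comp ha).fderiv
  change fderiv ℂ (gaugeAction br iP iN pP pN) 0 = _ at h
  rw [h]
  ext v
  have h2 : pN.comp iN = 1 := by rw [movedGraph_zero] at h1; exact h1
  simp [fderiv_movedGraph_zero, movedGraph_zero, hPN, hPP, h2]

/-- The gauge action on graphs: membership in the graph of `-gaugeAction (Z, ψ)` is membership in
the graph of `-ψ` after applying `exp (ad Z)`. -/
theorem gaugeAction_graph [CompleteSpace E] (hNN : ∀ x, pN (iN x) = x)
    (hPN : ∀ x, pP (iN x) = 0) (hPP : ∀ x, pP (iP x) = x)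
    (hNP : ∀ x, pN (iP x) = 0) (hsum : ∀ e, iP (pP e) + iN (pN e) = e)
    (x : P × (N →L[ℂ] P)) (hx : IsUnit (pN.comp (movedGraph br iP iN x))) (e : E) :
    pP e + gaugeAction br iP iN pP pN x (pN e) = 0 ↔
      pP (NormedSpace.exp (br (iP x.1)) e) + x.2 (pN (NormedSpace.exp (br (iP x.1)) e)) = 0 := by
  set M := movedGraph br iP iN x with hM
  set g : E →L[ℂ] E := NormedSpace.exp (br (iP x.1)) with hg
  have hgg : ∀ v, g (NormedSpace.exp (-br (iP x.1)) v) = v := fun v =>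
    DFunLike.congr_fun (exp_mul_exp_neg (br (iP x.1))) v
  have hgg' : ∀ v, NormedSpace.exp (-br (iP x.1)) (g v) = v := fun v => by
    have := DFunLike.congr_fun (exp_mul_exp_neg (-br (iP x.1))) v
    rwa [neg_neg] at this
  have hMv : ∀ u, M u = NormedSpace.exp (-br (iP x.1)) (iN u - iP (x.2 u)) := fun u => rfl
  have hA : ∀ v, gaugeAction br iP iN pP pN x v = -pP (M (Ring.inverse (pN.comp M) v)) :=
    fun v => rfl
  constructor
  · intro h
    -- `u` is the parameter at which the moved graph passes through `e`, that is `M u = e`.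
    set u := Ring.inverse (pN.comp M) (pN e) with hu
    have h1 : pN (M u) = pN e :=
      DFunLike.congr_fun (Ring.mul_inverse_cancel _ hx) (pN e)
    have h2 : pP (M u) = pP e := by
      rw [hA] at h
      exact (sub_eq_zero.1 (by rw [sub_eq_add_neg]; exact h)).symm
    have h3 : M u = e := by rw [← hsum (M u), h1, h2, hsum]
    have h4 : g e = iN u - iP (x.2 u) := by rw [← h3, hMv, hgg]
    rw [h4]
    simp [hNN, hPN, hPP, hNP]
  · intro h
    set u := pN (g e) with hu
    have h1 : g e = iN u - iP (x.2 u) := by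
      conv_lhs => rw [← hsum (g e), eq_neg_of_add_eq_zero_left h, map_neg]
      abel
    have h2 : M u = e := by rw [hMv, ← h1, hgg']
    have h3 : Ring.inverse (pN.comp M) (pN e) = u := by
      rw [← h2]
      exact DFunLike.congr_fun (Ring.inverse_mul_cancel _ hx) u
    rw [hA, h3, h2, add_neg_cancel]

open scoped ContDiff in
/-- Gauge fixing: near `0`, each `ψ` can be moved analytically into the kernel of `δ` by
`exp (ad Z)` with `Z ∈ P`. Here `d` is the infinitesimal action and `δ` is a generalized inverse
of `d`. -/
theorem exists_gauge_fixing [CompleteSpace E] [CompleteSpace N] [CompleteSpace P]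
    (hNN : ∀ x, pN (iN x) = x)
    (hPN : ∀ x, pP (iN x) = 0) (hPP : ∀ x, pP (iP x) = x)
    (hNP : ∀ x, pN (iP x) = 0) (hsum : ∀ e, iP (pP e) + iN (pN e) = e)
    (d : P →L[ℂ] (N →L[ℂ] P)) (hd : ∀ Z, d Z = -pP.comp ((br (iP Z)).comp iN))
    (δ : (N →L[ℂ] P) →L[ℂ] P) (hδ : ∀ φ, δ (d (δ φ)) = δ φ) :
    ∃ (ζ : (N →L[ℂ] P) → P) (Φ : (N →L[ℂ] P) → (N →L[ℂ] P)),
      AnalyticAt ℂ ζ 0 ∧ AnalyticAt ℂ Φ 0 ∧ ζ 0 = 0 ∧ Φ 0 = 0 ∧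
      ∀ᶠ ψ in 𝓝 0, δ (Φ ψ) = 0 ∧ ∀ e, pP e + Φ ψ (pN e) = 0 ↔
        pP (NormedSpace.exp (br (iP (ζ ψ))) e) + ψ (pN (NormedSpace.exp (br (iP (ζ ψ))) e)) = 0 := by
  let Γ := gaugeAction br iP iN pP pN
  have hΓ : ContDiffAt ℂ ω Γ 0 := contDiffAt_gaugeAction_zero br iP iN pP pN hNN
  have hΓ0 : Γ 0 = 0 := gaugeAction_zero br iP iN pP pN hPN
  -- The equation `δ Γ = 0` alone cannot determine `Z`, since `d` may have a kernel. Subtracting `Z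
  -- - δ d Z` turns the derivative at 0 into `(Z, ψ) ↦ (δψ - Z, ψ)`, an involution.
  let G : P × (N →L[ℂ] P) → P × (N →L[ℂ] P) :=
    fun x => (δ (Γ x) - (x.1 - δ (d x.1)), x.2)
  let L : P × (N →L[ℂ] P) →L[ℂ] P × (N →L[ℂ] P) :=
    (δ.comp (ContinuousLinearMap.snd ℂ _ _) - ContinuousLinearMap.fst ℂ _ _).prod
      (ContinuousLinearMap.snd ℂ _ _)
  have hLL : Function.Involutive L := fun x => by
    ext <;> simp [L]
  let Le : (P × (N →L[ℂ] P)) ≃L[ℂ] P × (N →L[ℂ] P) := ContinuousLinearEquiv.equivOfInverse L L hLL hLL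
  have hG : ContDiffAt ℂ ω G 0 :=
    ((δ.contDiff.contDiffAt.comp 0 hΓ).sub (contDiffAt_fst.sub
      (δ.contDiff.contDiffAt.comp 0 (d.contDiff.contDiffAt.comp 0 contDiffAt_fst)))).prodMk
      contDiffAt_snd
  have hG0 : G 0 = 0 := by simp [G, hΓ0]
  have hG' : HasFDerivAt G (Le : P × (N →L[ℂ] P) →L[ℂ] P × (N →L[ℂ] P)) 0 := by
    have hΓ' : HasFDerivAt Γ (fderiv ℂ Γ 0) 0 := (hΓ.differentiableAt (by simp)).hasFDerivAt
    have h1 : HasFDerivAt (fun x : P × (N →L[ℂ] P) => x.1 - δ (d x.1))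
        (ContinuousLinearMap.fst ℂ P (N →L[ℂ] P) -
          δ.comp (d.comp (ContinuousLinearMap.fst ℂ P (N →L[ℂ] P)))) 0 :=
      (ContinuousLinearMap.fst ℂ P (N →L[ℂ] P) -
          δ.comp (d.comp (ContinuousLinearMap.fst ℂ P (N →L[ℂ] P)))).hasFDerivAt
    refine (((δ.hasFDerivAt.comp 0 hΓ').sub h1).prodMk hasFDerivAt_snd).congr_fderiv ?_
    have key : ∀ x, δ (fderiv ℂ Γ 0 x) = δ x.2 - δ (d x.1) := fun x => by
      rw [show fderiv ℂ Γ 0 x = x.2 + pP.comp ((br (iP x.1)).comp iN) from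
        fderiv_gaugeAction_zero br iP iN pP pN hNN hPN hPP x, hd, map_add, map_neg, sub_neg_eq_add]
    refine ContinuousLinearMap.ext fun x => Prod.ext ?_ rfl
    change δ (fderiv ℂ Γ 0 x) - (x.1 - δ (d x.1)) = δ x.2 - x.1
    rw [key]
    abel
  have hω : (ω : WithTop ℕ∞) ≠ 0 := by simp
  let R := hG.localInverse hG' hω
  have hR0 : R 0 = 0 := by
    have := hG.localInverse_apply_image hG' hω
    rwa [hG0] at this
  have hR : ContDiffAt ℂ ω R 0 := by
    have := hG.to_localInverse hG' hω
    rwa [hG0] at this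
  have hGR : ∀ᶠ x in 𝓝 0, G (R x) = x := by
    have := (hG.hasStrictFDerivAt' hG' hω).eventually_right_inverse
    rwa [hG0] at this
  let S : (N →L[ℂ] P) → P × (N →L[ℂ] P) := fun ψ => R (0, ψ)
  have hin : ContDiff ℂ ω (fun ψ : N →L[ℂ] P => ((0 : P), ψ)) := contDiff_const.prodMk contDiff_id
  have hS : ContDiffAt ℂ ω S 0 := ContDiffAt.comp 0 (g := R) hR hin.contDiffAt
  have hS0 : S 0 = 0 := hR0
  have hΓS : ContDiffAt ℂ ω (fun ψ => Γ (S ψ)) 0 :=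
    ContDiffAt.comp 0 (g := Γ) (by rw [hS0]; exact hΓ) hS
  have hunit : ∀ᶠ ψ in 𝓝 0, IsUnit (pN.comp (movedGraph br iP iN (S ψ))) := by
    have hc : ContinuousAt (fun ψ => pN.comp (movedGraph br iP iN (S ψ))) 0 :=
      (ContinuousLinearMap.compL ℂ N E N pN).continuous.continuousAt.comp
        ((contDiff_movedGraph br iP iN).continuous.continuousAt.comp hS.continuousAt)
    refine hc.eventually (Units.isOpen.mem_nhds ?_)
    have : pN.comp (movedGraph br iP iN (S 0)) = 1 := by
      rw [hS0, movedGraph_zero]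
      ext v
      simp [hNN]
    change IsUnit (pN.comp (movedGraph br iP iN (S 0)))
    rw [this]
    exact isUnit_one
  refine ⟨fun ψ => (S ψ).1, fun ψ => Γ (S ψ),
    (contDiff_fst.contDiffAt.comp 0 hS).analyticAt, hΓS.analyticAt,
    by simp [hS0], by simp [hS0, hΓ0], ?_⟩
  have hin0 : Filter.Tendsto (fun ψ : N →L[ℂ] P => ((0 : P), ψ)) (𝓝 0) (𝓝 0) :=
    hin.continuous.tendsto 0
  filter_upwards [hin0.eventually hGR, hunit] with ψ h1 h2
  have e1 : δ (Γ (S ψ)) - ((S ψ).1 - δ (d (S ψ).1)) = 0 := congrArg Prod.fst h1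
  have e2 : (S ψ).2 = ψ := congrArg Prod.snd h1
  constructor
  -- Here `δ Γ = Z - δ d Z`. The idempotent `δ d` fixes the left side and kills the right side, so
  -- both vanish.
  · have h3 := sub_eq_zero.1 e1
    rw [← hδ, h3, map_sub, map_sub, hδ, sub_self]
  · intro e
    have := gaugeAction_graph br iP iN pP pN hNN hPN hPP hNP hsum (S ψ) h2 e
    rwa [e2] at this

end GaugeFixing

/-! ### Identities for the Moore-Penrose inverse -/

section MoorePenroseFacts

variable {U V W : Type*}

/-- The target is split along `range T` and a preimage along `ker T`. The identities for `mpInverse`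
below are read off from this normal form. -/
theorem moorePenrose_spec [NormedAddCommGroup V] [InnerProductSpace ℂ V]
    [FiniteDimensional ℂ V] [NormedAddCommGroup W] [InnerProductSpace ℂ W]
    [FiniteDimensional ℂ W] (T : V →ₗ[ℂ] W) (y : W) :
    ∃ x ∈ (LinearMap.ker T)ᗮ, ∃ z ∈ (LinearMap.range T)ᗮ, y = T x + z ∧ moorePenrose T y = x := by
  obtain ⟨_, ⟨x₀, rfl⟩, z, hz, hy⟩ := (LinearMap.range T).exists_add_mem_mem_orthogonal y
  obtain ⟨k, hk, x, hx, hx₀⟩ := (LinearMap.ker T).exists_add_mem_mem_orthogonal x₀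
  have hTx : T x₀ = T x := by rw [hx₀, map_add, LinearMap.mem_ker.1 hk, zero_add]
  refine ⟨x, hx, z, hz, by rw [hy, hTx], ?_⟩
  rw [hy, map_add, moorePenrose_apply_orthogonal T hz, hTx, moorePenrose_apply_map T hx, add_zero]

variable [AddCommGroup U] [Module ℂ U] [FiniteDimensional ℂ U]
  [AddCommGroup V] [Module ℂ V] [FiniteDimensional ℂ V]
  [AddCommGroup W] [Module ℂ W] [FiniteDimensional ℂ W]

theorem map_mpInverse_map (c : InnerProductSpace.Core ℂ V) (d : InnerProductSpace.Core ℂ W)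
    (T : V →ₗ[ℂ] W) (x : V) : T (mpInverse c d T (T x)) = T x := by
  let _ := c.toNormedAddCommGroup
  let _ := InnerProductSpace.ofCore c.toCore
  let _ := d.toNormedAddCommGroup
  let _ := InnerProductSpace.ofCore d.toCore
  obtain ⟨x', -, z, hz, h, h'⟩ := moorePenrose_spec T (T x)
  change T (moorePenrose T (T x)) = T x
  have hz0 : z = 0 := by
    have hzr : z ∈ LinearMap.range T := ⟨x - x', by rw [map_sub, h, add_sub_cancel_left]⟩
    exact (Submodule.mem_bot ℂ).1 ((LinearMap.range T).inf_orthogonal_eq_bot ▸ ⟨hzr, hz⟩)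
  rw [h', h, hz0, add_zero]

theorem mpInverse_map_mpInverse (c : InnerProductSpace.Core ℂ V) (d : InnerProductSpace.Core ℂ W)
    (T : V →ₗ[ℂ] W) (y : W) : mpInverse c d T (T (mpInverse c d T y)) = mpInverse c d T y := by
  let _ := c.toNormedAddCommGroup
  let _ := InnerProductSpace.ofCore c.toCore
  let _ := d.toNormedAddCommGroup
  let _ := InnerProductSpace.ofCore d.toCore
  obtain ⟨x', hx', z, hz, h, h'⟩ := moorePenrose_spec T y
  change moorePenrose T (T (moorePenrose T y)) = moorePenrose T y
  rw [h', moorePenrose_apply_map T hx']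

/-- The values of `T†` are orthogonal to `ker T`, hence to `range S`, where `S†` vanishes. -/
theorem mpInverse_mpInverse (b : InnerProductSpace.Core ℂ U) (c : InnerProductSpace.Core ℂ V)
    (d : InnerProductSpace.Core ℂ W) (S : U →ₗ[ℂ] V) (T : V →ₗ[ℂ] W) (h : ∀ x, T (S x) = 0)
    (y : W) : mpInverse b c S (mpInverse c d T y) = 0 := by
  let _ := b.toNormedAddCommGroup
  let _ := InnerProductSpace.ofCore b.toCore
  let _ := c.toNormedAddCommGroup
  let _ := InnerProductSpace.ofCore c.toCore
  let _ := d.toNormedAddCommGroup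
  let _ := InnerProductSpace.ofCore d.toCore
  obtain ⟨x', hx', z, hz, -, h'⟩ := moorePenrose_spec T y
  change moorePenrose S (moorePenrose T y) = 0
  rw [h']
  refine moorePenrose_apply_orthogonal S (Submodule.orthogonal_le ?_ hx')
  rintro _ ⟨u, rfl⟩
  exact h u

/-- The kernel of `T†` is orthogonal to `range T`. -/
theorem orthProj_map_eq_zero (c : InnerProductSpace.Core ℂ V) (d : InnerProductSpace.Core ℂ W)
    (T : V →ₗ[ℂ] W) (H : Submodule ℂ W) (hH : H ≤ LinearMap.ker (mpInverse c d T)) (x : V) :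
    orthProj d H (T x) = 0 := by
  let _ := c.toNormedAddCommGroup
  let _ := InnerProductSpace.ofCore c.toCore
  let _ := d.toNormedAddCommGroup
  let _ := InnerProductSpace.ofCore d.toCore
  change H.starProjection (T x) = 0
  have hr : H ≤ (LinearMap.range T)ᗮ := fun y hy => by
    obtain ⟨x', -, z, hz, h, h'⟩ := moorePenrose_spec T y
    have h0 : moorePenrose T y = 0 := hH hy
    rw [h, ← h', h0, map_zero, zero_add]
    exact hz
  rw [Submodule.starProjection_apply_eq_zero_iff]
  exact Submodule.orthogonal_le hr ((LinearMap.range T).le_orthogonal_orthogonal ⟨x, rfl⟩)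

theorem orthProj_of_mem (c : InnerProductSpace.Core ℂ V) (H : Submodule ℂ V) {x : V}
    (hx : x ∈ H) : orthProj c H x = x := by
  let _ := c.toNormedAddCommGroup
  let _ := InnerProductSpace.ofCore c.toCore
  exact Submodule.starProjection_eq_self_iff.2 hx

/-- Every finite-dimensional complex vector space has a Hermitian inner product. -/
theorem nonempty_innerProductSpaceCore (V : Type*) [AddCommGroup V] [Module ℂ V]
    [FiniteDimensional ℂ V] : Nonempty (InnerProductSpace.Core ℂ V) := by
  let e : V ≃ₗ[ℂ] EuclideanSpace ℂ (Fin (Module.finrank ℂ V)) :=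
    (Module.finBasis ℂ V).equivFun.trans (WithLp.linearEquiv 2 ℂ _).symm
  exact ⟨{
    inner := fun x y => inner ℂ (e x) (e y)
    conj_inner_symm := fun x y => inner_conj_symm _ _
    re_inner_nonneg := fun x => inner_self_nonneg
    add_left := fun x y z => by rw [map_add, inner_add_left]
    smul_left := fun x y r => by rw [map_smul, inner_smul_left]
    definite := fun x hx => by
      rw [inner_self_eq_zero] at hx
      exact e.map_eq_zero_iff.1 hx }⟩

end MoorePenroseFacts

/-! ### Conjugation and real parts on `𝔤_ℂ` -/

namespace Complexification

variable {𝔤 : Type*} [LieRing 𝔤] [LieAlgebra ℝ 𝔤]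

theorem tmul_add (a : ℂ) (x y : 𝔤) : tmul a (x + y) = tmul a x + tmul a y :=
  TensorProduct.tmul_add a x y

theorem add_tmul (a b : ℂ) (x : 𝔤) : tmul (a + b) x = tmul a x + tmul b x :=
  TensorProduct.add_tmul a b x

theorem smul_tmul' (a b : ℂ) (x : 𝔤) : a • tmul b x = tmul (a * b) x := rfl

theorem tmul_real_smul (a : ℂ) (r : ℝ) (x : 𝔤) : tmul a (r • x) = tmul (r * a) x := by
  change a ⊗ₜ[ℝ] (r • x) = ((r : ℂ) * a) ⊗ₜ[ℝ] x
  rw [← TensorProduct.smul_tmul, Complex.real_smul]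

/-- The conjugation of `𝔤_ℂ` with respect to `𝔤`, as an additive map. -/
def conjHom : Complexification 𝔤 →+ Complexification 𝔤 :=
  (LinearMap.rTensor 𝔤 Complex.conjAe.toLinearMap).toAddMonoidHom

theorem conjHom_tmul (a : ℂ) (x : 𝔤) : conjHom (tmul a x) = tmul (starRingEnd ℂ a) x := rfl

theorem conjHom_smul (c : ℂ) (x : Complexification 𝔤) :
    conjHom (c • x) = starRingEnd ℂ c • conjHom x := by
  induction x using Complexification.induction_on with
  | zero => simp
  | tmul a x => simp [conjHom_tmul, smul_tmul']
  | add x y hx hy => rw [smul_add, map_add, hx, hy, map_add, smul_add]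

/-- The conjugation of `𝔤_ℂ` with respect to `𝔤`. -/
def conj : Complexification 𝔤 →ₗ[ℝ] Complexification 𝔤 where
  toFun := conjHom
  map_add' := map_add _
  map_smul' r x := by
    rw [RingHom.id_apply, ← Complex.coe_smul, ← Complex.coe_smul, conjHom_smul, Complex.conj_ofReal]

theorem conj_tmul (a : ℂ) (x : 𝔤) : conj (tmul a x) = tmul (starRingEnd ℂ a) x := rfl

/-- The real part `𝔤_ℂ → 𝔤`. -/
def re : Complexification 𝔤 →+ 𝔤 :=
  ((TensorProduct.lid ℝ 𝔤).toLinearMap ∘ₗ LinearMap.rTensor 𝔤 Complex.reLm).toAddMonoidHom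

theorem re_tmul (a : ℂ) (x : 𝔤) : re (tmul a x) = a.re • x := rfl

theorem tmul_one_injective : Function.Injective (tmul (𝔤 := 𝔤) 1) := fun x y h => by
  have := congrArg re h
  simpa [re_tmul] using this

theorem conj_conj (x : Complexification 𝔤) : conj (conj x) = x := by
  induction x using Complexification.induction_on with
  | zero => simp
  | tmul a x => simp [conj_tmul]
  | add x y hx hy => rw [map_add, map_add, hx, hy]

theorem conj_smul (c : ℂ) (x : Complexification 𝔤) : conj (c • x) = starRingEnd ℂ c • conj x :=
  conjHom_smul c x

theorem conj_lie (x y : Complexification 𝔤) : conj ⁅x, y⁆ = ⁅conj x, conj y⁆ := by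
  induction x using Complexification.induction_on with
  | zero => simp
  | add x x' hx hx' => rw [add_lie, map_add, hx, hx', map_add, add_lie]
  | tmul a x =>
    induction y using Complexification.induction_on with
    | zero => simp
    | add y y' hy hy' => rw [lie_add, map_add, hy, hy', map_add, lie_add]
    | tmul b y => simp [conj_tmul, bracket_tmul]

theorem exists_eq_add_smul (z : Complexification 𝔤) :
    ∃ a b : 𝔤, z = tmul 1 a + Complex.I • tmul 1 b := by
  induction z using Complexification.induction_on with
  | zero => exact ⟨0, 0, by simp [tmul_zero]⟩
  | tmul c x =>
    refine ⟨c.re • x, c.im • x, ?_⟩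
    rw [tmul_real_smul, tmul_real_smul, smul_tmul', ← add_tmul]
    congr 1
    rw [mul_one, mul_one, mul_comm]
    exact (Complex.re_add_im c).symm
  | add x y hx hy =>
    obtain ⟨a, b, rfl⟩ := hx
    obtain ⟨a', b', rfl⟩ := hy
    exact ⟨a + a', b + b', by rw [tmul_add, tmul_add, smul_add]; abel⟩

theorem exists_tmul_of_conj_eq {z : Complexification 𝔤} (hz : conj z = z) :
    ∃ x : 𝔤, z = tmul 1 x := by
  obtain ⟨a, b, rfl⟩ := exists_eq_add_smul z
  rw [map_add, conj_smul, conj_tmul, conj_tmul, map_one, Complex.conj_I, neg_smul,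
    add_right_inj, neg_eq_iff_add_eq_zero, ← two_smul ℂ] at hz
  exact ⟨a, by rw [(smul_eq_zero.1 hz).resolve_left two_ne_zero, add_zero]⟩

theorem conj_tmul_one (x : 𝔤) : conj (tmul 1 x) = tmul 1 x := by
  rw [conj_tmul, map_one]

end Complexification

/-! ### Deformed subspaces, the Maurer-Cartan equation and the Bianchi identity -/

namespace LieComplexStructure

variable {𝔤 : Type*} [LieRing 𝔤] [LieAlgebra ℝ 𝔤] (𝒥 : LieComplexStructure 𝔤)

theorem P10_coe (x : 𝒥.g10) : 𝒥.P10 x = x := by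
  apply Subtype.ext
  rw [coe_P10, (𝒥.mem_g10).1 x.2, smul_smul, Complex.I_mul_I]
  module

theorem P01_coe (x : 𝒥.g01) : 𝒥.P01 x = x := by
  apply Subtype.ext
  rw [coe_P01, (𝒥.mem_g01).1 x.2, smul_smul, mul_neg, Complex.I_mul_I]
  module

theorem P01_coe_g10 (x : 𝒥.g10) : 𝒥.P01 x = 0 := by
  apply Subtype.ext
  rw [coe_P01, (𝒥.mem_g10).1 x.2, smul_smul, Complex.I_mul_I]
  simp

theorem P10_coe_g01 (x : 𝒥.g01) : 𝒥.P10 x = 0 := 𝒥.P10_of_mem_g01 x.2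

theorem conj_JC (x : Complexification 𝔤) :
    Complexification.conj (𝒥.JC x) = 𝒥.JC (Complexification.conj x) := by
  induction x using Complexification.induction_on with
  | zero => simp
  | tmul a x => simp [JC_tmul, Complexification.conj_tmul]
  | add x y hx hy => rw [map_add, map_add, hx, hy, map_add, map_add]

theorem conj_P01 (x : Complexification 𝔤) :
    Complexification.conj (𝒥.P01 x : Complexification 𝔤) = 𝒥.P10 (Complexification.conj x) := by
  rw [coe_P01, coe_P10, Complexification.conj_smul, map_add, Complexification.conj_smul, conj_JC,
    Complex.conj_I]
  have h2 : starRingEnd ℂ (1 / 2 : ℂ) = 1 / 2 := by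
    rw [map_div₀, map_one, map_ofNat]
  rw [h2, neg_smul, sub_eq_add_neg]

/-- The linear map with kernel `𝔤^{0,1}_φ` and value `Y` at `Y ∈ 𝔤^{1,0}`. -/
def graphMap (φ : 𝒥.A01) : Complexification 𝔤 →ₗ[ℂ] 𝒥.g10 := 𝒥.P10 + φ ∘ₗ 𝒥.P01

theorem graphMap_apply (φ : 𝒥.A01) (e : Complexification 𝔤) :
    𝒥.graphMap φ e = 𝒥.P10 e + φ (𝒥.P01 e) := rfl

theorem graphMap_coe (φ : 𝒥.A01) (x : 𝒥.g10) : 𝒥.graphMap φ x = x := by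
  rw [graphMap_apply, P10_coe, P01_coe_g10, map_zero, add_zero]

theorem graphMap_sub (φ : 𝒥.A01) (x : 𝒥.g01) :
    𝒥.graphMap φ ((x : Complexification 𝔤) - φ x) = 0 := by
  rw [map_sub, graphMap_coe, graphMap_apply, P10_coe_g01, P01_coe, zero_add, sub_self]

theorem eq_sub_add_graphMap (φ : 𝒥.A01) (e : Complexification 𝔤) :
    e = ((𝒥.P01 e : Complexification 𝔤) - φ (𝒥.P01 e)) + 𝒥.graphMap φ e := by
  rw [graphMap_apply]
  push_cast
  conv_lhs => rw [← 𝒥.P10_add_P01 e]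
  abel

theorem mem_deformed01 (φ : 𝒥.A01) (e : Complexification 𝔤) :
    e ∈ 𝒥.deformed01 φ ↔ 𝒥.graphMap φ e = 0 := by
  constructor
  · rintro ⟨x, rfl⟩
    exact 𝒥.graphMap_sub φ x
  · intro h
    refine ⟨𝒥.P01 e, ?_⟩
    conv_rhs => rw [𝒥.eq_sub_add_graphMap φ e, h]
    simp

/-- The failure `½[φ, φ] - ∂̄φ` of the Maurer-Cartan equation. -/
def mcDefect (φ : 𝒥.A01) : 𝒥.A02 := (1 / 2 : ℂ) • 𝒥.fnBracket φ φ - 𝒥.dbar1 φ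

theorem dbar1_apply (φ : 𝒥.A01) (x y : 𝒥.g01) :
    𝒥.dbar1 φ x y = 𝒥.P10 ⁅(x : Complexification 𝔤), (φ y : Complexification 𝔤)⁆ -
      𝒥.P10 ⁅(y : Complexification 𝔤), (φ x : Complexification 𝔤)⁆ - φ ⁅x, y⁆ := rfl

theorem mcDefect_apply (φ : 𝒥.A01) (x y : 𝒥.g01) :
    𝒥.mcDefect φ x y = 𝒥.fnAux φ φ x y - 𝒥.dbar1 φ x y := by
  change (1 / 2 : ℂ) • (𝒥.fnAux φ φ x y + 𝒥.fnAux φ φ x y) - 𝒥.dbar1 φ x y = _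
  module

theorem P01_lie_sub (φ : 𝒥.A01) (x y : 𝒥.g01) :
    𝒥.P01 ⁅(x : Complexification 𝔤) - φ x, (y : Complexification 𝔤) - φ y⁆ =
      ⁅x, y⁆ - (𝒥.P01 ⁅(x : Complexification 𝔤), (φ y : Complexification 𝔤)⁆ +
        𝒥.P01 ⁅(φ x : Complexification 𝔤), (y : Complexification 𝔤)⁆) := by
  have h1 : 𝒥.P01 ⁅(x : Complexification 𝔤), (y : Complexification 𝔤)⁆ = ⁅x, y⁆ :=
    𝒥.P01_coe ⁅x, y⁆
  have h2 : 𝒥.P01 ⁅(φ x : Complexification 𝔤), (φ y : Complexification 𝔤)⁆ = 0 :=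
    𝒥.P01_coe_g10 ⁅φ x, φ y⁆
  rw [sub_lie, lie_sub, lie_sub]
  simp only [map_sub, h1, h2]
  abel

/-- The defect is a curvature: it is the component in `𝔤^{1,0}`, along `𝔤^{0,1}_φ`, of the bracket
of two vectors of `𝔤^{0,1}_φ`. -/
theorem graphMap_lie_sub (φ : 𝒥.A01) (x y : 𝒥.g01) :
    𝒥.graphMap φ ⁅(x : Complexification 𝔤) - φ x, (y : Complexification 𝔤) - φ y⁆ =
      𝒥.mcDefect φ x y := by
  have h1 : 𝒥.P10 ⁅(x : Complexification 𝔤), (y : Complexification 𝔤)⁆ = 0 :=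
    𝒥.P10_coe_g01 ⁅x, y⁆
  have h2 : 𝒥.P10 ⁅(y : Complexification 𝔤), (φ x : Complexification 𝔤)⁆ =
      -𝒥.P10 ⁅(φ x : Complexification 𝔤), (y : Complexification 𝔤)⁆ := by
    rw [← map_neg, lie_skew]
  rw [graphMap_apply, P01_lie_sub, mcDefect_apply, fnAux_apply, dbar1_apply, h2]
  rw [sub_lie, lie_sub, lie_sub]
  simp only [map_sub, map_add, h1]
  abel

/-- The Maurer-Cartan equation says that `𝔤^{0,1}_φ` is a subalgebra. -/
theorem maurerCartan_iff (φ : 𝒥.A01) :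
    𝒥.dbar1 φ = (1 / 2 : ℂ) • 𝒥.fnBracket φ φ ↔
      ∀ x y, 𝒥.graphMap φ x = 0 → 𝒥.graphMap φ y = 0 → 𝒥.graphMap φ ⁅x, y⁆ = 0 := by
  rw [eq_comm, ← sub_eq_zero]
  change 𝒥.mcDefect φ = 0 ↔ _
  constructor
  · intro h x y hx hy
    rw [𝒥.eq_sub_add_graphMap φ x, 𝒥.eq_sub_add_graphMap φ y, hx, hy]
    simp only [ZeroMemClass.coe_zero, add_zero]
    rw [graphMap_lie_sub, h]
    rfl
  · intro h
    apply Subtype.ext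
    ext x y : 2
    have := h _ _ (𝒥.graphMap_sub φ x) (𝒥.graphMap_sub φ y)
    rw [graphMap_lie_sub] at this
    exact this

/-- The part of the deformed differential of `ξ` at `φ` that is linear in `φ`. -/
def dbarCorrection (x y z : 𝒥.g01) : 𝒥.A01 →ₗ[ℂ] 𝒥.A02 →ₗ[ℂ] 𝒥.g10 :=
  LinearMap.mk₂ ℂ (fun φ ξ =>
      φ (𝒥.P01 ⁅(x : Complexification 𝔤), (ξ y z : Complexification 𝔤)⁆) -
      𝒥.P10 ⁅(φ x : Complexification 𝔤), (ξ y z : Complexification 𝔤)⁆ -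
      ξ x (𝒥.P01 ⁅(y : Complexification 𝔤), (φ z : Complexification 𝔤)⁆ +
        𝒥.P01 ⁅(φ y : Complexification 𝔤), (z : Complexification 𝔤)⁆))
    (fun φ φ' ξ => by
      simp only [LinearMap.add_apply, coe_add', lie_add, add_lie, map_add]
      abel)
    (fun a φ ξ => by
      simp only [LinearMap.smul_apply, coe_smul', lie_smul, smul_lie, map_smul, smul_sub,
        ← smul_add])
    (fun φ ξ ξ' => by
      simp only [LieModule.Cohomology.add_apply_apply, coe_add', lie_add, map_add]
      abel)
    (fun a φ ξ => by
      simp only [LieModule.Cohomology.smul_apply_apply, coe_smul', lie_smul, map_smul, smul_sub])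

theorem dbarCorrection_apply (x y z : 𝒥.g01) (φ : 𝒥.A01) (ξ : 𝒥.A02) :
    𝒥.dbarCorrection x y z φ ξ =
      φ (𝒥.P01 ⁅(x : Complexification 𝔤), (ξ y z : Complexification 𝔤)⁆) -
      𝒥.P10 ⁅(φ x : Complexification 𝔤), (ξ y z : Complexification 𝔤)⁆ -
      ξ x (𝒥.P01 ⁅(y : Complexification 𝔤), (φ z : Complexification 𝔤)⁆ +
        𝒥.P01 ⁅(φ y : Complexification 𝔤), (z : Complexification 𝔤)⁆) := rfl

theorem dbar2_apply (ξ : 𝒥.A02) (x y z : 𝒥.g01) :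
    𝒥.dbar2 ξ x y z = ⁅x, ξ y z⁆ - ⁅y, ξ x z⁆ + ⁅z, ξ x y⁆ - ξ ⁅x, y⁆ z + ξ ⁅x, z⁆ y - ξ ⁅y, z⁆ x :=
  rfl

/-- The inner bracket splits into a vector of `𝔤^{0,1}_φ` and the defect. Bracketing the former
yields the defect once more; bracketing the latter yields the action of `x̄` up to terms linear in
`φ`. Cyclic summation then produces `∂̄` of the defect. -/
theorem graphMap_lie_lie (φ : 𝒥.A01) (x y z : 𝒥.g01) :
    𝒥.graphMap φ ⁅(x : Complexification 𝔤) - φ x,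
      ⁅(y : Complexification 𝔤) - φ y, (z : Complexification 𝔤) - φ z⁆⁆ =
      ⁅x, 𝒥.mcDefect φ y z⁆ + 𝒥.mcDefect φ x ⁅y, z⁆ +
        𝒥.dbarCorrection x y z φ (𝒥.mcDefect φ) := by
  rw [𝒥.eq_sub_add_graphMap φ ⁅(y : Complexification 𝔤) - φ y, (z : Complexification 𝔤) - φ z⁆,
    lie_add, map_add, graphMap_lie_sub, graphMap_lie_sub, P01_lie_sub, dbarCorrection_apply,
    sub_lie, map_sub, graphMap_apply, lie_g10_def]
  have h : 𝒥.P01 ⁅(φ x : Complexification 𝔤), (𝒥.mcDefect φ y z : Complexification 𝔤)⁆ = 0 :=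
    𝒥.P01_coe_g10 ⁅φ x, 𝒥.mcDefect φ y z⁆
  simp only [map_sub, h, map_zero]
  abel

/-- The Bianchi identity for the failure of the Maurer-Cartan equation. -/
theorem dbar2_mcDefect (φ : 𝒥.A01) (x y z : 𝒥.g01) :
    𝒥.dbar2 (𝒥.mcDefect φ) x y z + (𝒥.dbarCorrection x y z φ (𝒥.mcDefect φ) +
      𝒥.dbarCorrection y z x φ (𝒥.mcDefect φ) + 𝒥.dbarCorrection z x y φ (𝒥.mcDefect φ)) = 0 := by
  have h := congrArg (𝒥.graphMap φ) (lie_jacobi ((x : Complexification 𝔤) - φ x)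
    ((y : Complexification 𝔤) - φ y) ((z : Complexification 𝔤) - φ z))
  rw [map_add, map_add, map_zero, graphMap_lie_lie, graphMap_lie_lie, graphMap_lie_lie] at h
  rw [← h, dbar2_apply]
  have e1 : 𝒥.mcDefect φ x z = -𝒥.mcDefect φ z x :=
    (LieModule.Cohomology.twoCochain_skew (𝒥.mcDefect φ) z x).symm
  have e2 : 𝒥.mcDefect φ ⁅x, y⁆ z = -𝒥.mcDefect φ z ⁅x, y⁆ :=
    (LieModule.Cohomology.twoCochain_skew (𝒥.mcDefect φ) _ _).symm
  have e3 : 𝒥.mcDefect φ ⁅x, z⁆ y = 𝒥.mcDefect φ y ⁅z, x⁆ := by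
    rw [← lie_skew x z, map_neg, ← LieModule.Cohomology.twoCochain_skew (𝒥.mcDefect φ) _ y]
    rfl
  have e4 : 𝒥.mcDefect φ ⁅y, z⁆ x = -𝒥.mcDefect φ x ⁅y, z⁆ :=
    (LieModule.Cohomology.twoCochain_skew (𝒥.mcDefect φ) _ _).symm
  rw [e1, e2, e3, e4, lie_neg]
  abel

/-- A complex subalgebra of `𝔤_ℂ` complementary to `𝔤` is the space of `(0,1)`-vectors of a
complex structure. -/
theorem exists_of_isCompl_real (V : Submodule ℂ (Complexification 𝔤))
    (hV : ∀ x ∈ V, ∀ y ∈ V, ⁅x, y⁆ ∈ V) (hex : ∀ z, ∃ x : 𝔤, z - tmul 1 x ∈ V)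
    (huniq : ∀ x : 𝔤, tmul 1 x ∈ V → x = 0) :
    ∃ 𝒥' : LieComplexStructure 𝔤, 𝒥'.g01.toSubmodule = V := by
  -- `j x` is the real vector congruent to `ix` modulo `V`. This is the required `J`, because `x +
  -- iJx = -i(ix - Jx)` has type `(0,1)`.
  choose j hj using fun x : 𝔤 => hex (Complex.I • tmul 1 x)
  have key : ∀ x y : 𝔤, Complex.I • tmul 1 x - tmul 1 y ∈ V → j x = y := fun x y h => by
    refine sub_eq_zero.1 (huniq _ ?_)
    have := V.sub_mem h (hj x)
    rwa [sub_sub_sub_cancel_left, ← Complexification.tmul_sub] at this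
  have hI : ∀ z : Complexification 𝔤, Complex.I • Complex.I • z = -z := fun z => by
    rw [smul_smul, Complex.I_mul_I, neg_one_smul]
  have hsq : ∀ x, j (j x) = -x := fun x => by
    refine key _ _ ?_
    have := V.smul_mem (-Complex.I) (hj x)
    rw [smul_sub, neg_smul, neg_smul, hI, neg_neg] at this
    rw [Complexification.tmul_neg]
    convert this using 1
    abel
  let J : 𝔤 →ₗ[ℝ] 𝔤 :=
    { toFun := j
      map_add' := fun x y => key _ _ (by
        have := V.add_mem (hj x) (hj y)
        rw [Complexification.tmul_add, Complexification.tmul_add, smul_add]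
        convert this using 1
        abel)
      map_smul' := fun r x => key _ _ (by
        have := V.smul_mem (r : ℂ) (hj x)
        rw [RingHom.id_apply, Complexification.tmul_real_smul, Complexification.tmul_real_smul,
          ← Complexification.smul_tmul', ← Complexification.smul_tmul', smul_comm, ← smul_sub]
        exact this) }
  let 𝒥' : LieComplexStructure 𝔤 :=
    { J := J
      sq := hsq
      integrable := fun x y => by
        change ⁅j x, j y⁆ - ⁅x, y⁆ - J ⁅j x, y⁆ - J ⁅x, j y⁆ = 0
        -- Closure of `V` under `[ix - jx, iy - jy]` says that `i([jx, y] + [x, jy])` is congruent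
        -- to `[jx, jy] - [x, y]`, which is integrability.
        have h1 := hV _ (hj x) _ (hj y)
        rw [sub_sub, ← map_add, sub_eq_zero]
        symm
        refine key _ _ ?_
        have h2 := V.neg_mem h1
        rw [lie_sub, sub_lie, sub_lie, lie_smul, lie_smul, smul_lie, smul_lie, hI,
          Complexification.bracket_tmul, Complexification.bracket_tmul,
          Complexification.bracket_tmul, Complexification.bracket_tmul, mul_one] at h2
        rw [Complexification.tmul_sub, Complexification.tmul_add, smul_add]
        convert h2 using 1
        abel }
  refine ⟨𝒥', ?_⟩
  ext z
  rw [LieSubalgebra.mem_toSubmodule, mem_g01]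
  obtain ⟨a, b, rfl⟩ := Complexification.exists_eq_add_smul z
  have hJ : 𝒥'.JC (tmul 1 a + Complex.I • tmul 1 b) =
      tmul 1 (j a) + Complex.I • tmul 1 (j b) := by
    rw [map_add, map_smul, JC_tmul, JC_tmul]
    rfl
  have hmem : ∀ a : 𝔤, tmul 1 a + Complex.I • tmul 1 (j a) ∈ V := fun a => by
    have := V.smul_mem (-Complex.I) (hj a)
    rw [smul_sub, neg_smul, neg_smul, hI, neg_neg, sub_neg_eq_add] at this
    exact this
  constructor
  · intro h
    have h1 : Complexification.re (𝒥'.JC (tmul 1 a + Complex.I • tmul 1 b)) =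
        Complexification.re (-Complex.I • (tmul 1 a + Complex.I • tmul 1 b)) := congrArg _ h
    rw [hJ, smul_add, neg_smul, neg_smul, hI, neg_neg] at h1
    have h2 : j a = b := by
      simpa [Complexification.re_tmul, Complexification.smul_tmul'] using h1
    rw [← h2]
    exact hmem a
  · intro h
    have hb : j a = b := by
      refine key _ _ ?_
      have := V.smul_mem Complex.I h
      rwa [smul_add, hI, ← sub_eq_add_neg] at this
    rw [hJ, ← hb, hsq, Complexification.tmul_neg, neg_smul, smul_add, hI, smul_neg]
    abel

/-- The conjugate of a complex structure by an automorphism of `𝔤`. -/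
def conjugate (f : 𝔤 ≃ₗ⁅ℝ⁆ 𝔤) : LieComplexStructure 𝔤 where
  J := (f.symm : 𝔤 →ₗ[ℝ] 𝔤) ∘ₗ 𝒥.J ∘ₗ (f : 𝔤 →ₗ[ℝ] 𝔤)
  sq x := by
    change f.symm (𝒥.J (f (f.symm (𝒥.J (f x))))) = -x
    rw [f.apply_symm_apply, 𝒥.sq, map_neg, f.symm_apply_apply]
  integrable x y := by
    change ⁅f.symm (𝒥.J (f x)), f.symm (𝒥.J (f y))⁆ - ⁅x, y⁆ -
      f.symm (𝒥.J (f ⁅f.symm (𝒥.J (f x)), y⁆)) - f.symm (𝒥.J (f ⁅x, f.symm (𝒥.J (f y))⁆)) = 0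
    have hl : ∀ a b, f ⁅a, b⁆ = ⁅f a, f b⁆ := fun a b => f.toLieHom.map_lie a b
    have hs : ∀ a, f (f.symm a) = a := f.apply_symm_apply
    have h := congrArg f.symm (𝒥.integrable (f x) (f y))
    have e1 : ⁅f.symm (𝒥.J (f x)), f.symm (𝒥.J (f y))⁆ = f.symm ⁅𝒥.J (f x), 𝒥.J (f y)⁆ :=
      (f.symm.toLieHom.map_lie _ _).symm
    have e2 : ⁅x, y⁆ = f.symm ⁅f x, f y⁆ := by rw [← hl, f.symm_apply_apply]
    rw [hl, hl, hs, hs, e1, e2, ← map_sub, ← map_sub, ← map_sub, h, map_zero]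

theorem conjugate_J (f : 𝔤 ≃ₗ⁅ℝ⁆ 𝔤) (x : 𝔤) : (𝒥.conjugate f).J x = f.symm (𝒥.J (f x)) := rfl

/-- A real automorphism of `𝔤_ℂ` comes from an automorphism of `𝔤`. -/
theorem exists_lieEquiv_of_real (m : Complexification 𝔤 ≃ₗ[ℂ] Complexification 𝔤)
    (hm : ∀ x y, m ⁅x, y⁆ = ⁅m x, m y⁆)
    (hreal : ∀ x, m (Complexification.conj x) = Complexification.conj (m x)) :
    ∃ f : 𝔤 ≃ₗ⁅ℝ⁆ 𝔤, ∀ x, m (tmul 1 x) = tmul 1 (f x) := by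
  have hreal' : ∀ x, m.symm (Complexification.conj x) = Complexification.conj (m.symm x) :=
    fun x => m.injective (by rw [hreal, m.apply_symm_apply, m.apply_symm_apply])
  have hex : ∀ x : 𝔤, ∃ y, m (tmul 1 x) = tmul 1 y := fun x =>
    Complexification.exists_tmul_of_conj_eq (by rw [← hreal, Complexification.conj_tmul_one])
  have hex' : ∀ x : 𝔤, ∃ y, m.symm (tmul 1 x) = tmul 1 y := fun x =>
    Complexification.exists_tmul_of_conj_eq (by rw [← hreal', Complexification.conj_tmul_one])
  choose f hf using hex
  choose g hg using hex'
  have hinj := Complexification.tmul_one_injective (𝔤 := 𝔤)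
  exact ⟨{
    toFun := f
    invFun := g
    left_inv := fun x => hinj (by rw [← hg, ← hf, m.symm_apply_apply])
    right_inv := fun x => hinj (by rw [← hf, ← hg, m.apply_symm_apply])
    map_add' := fun x y => hinj (by
      rw [← hf, Complexification.tmul_add, Complexification.tmul_add, map_add, hf, hf])
    map_smul' := fun r x => hinj (by
      rw [← hf, RingHom.id_apply, Complexification.tmul_real_smul, Complexification.tmul_real_smul,
        ← Complexification.smul_tmul', ← Complexification.smul_tmul', map_smul, hf])
    map_lie' := fun {x y} => hinj (by
      have h := fun u v : 𝔤 => Complexification.bracket_tmul 1 1 u v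
      simp only [mul_one] at h
      rw [← hf, ← h, ← h, hm, hf, hf]) }, hf⟩

theorem mem_g01_conjugate (f : 𝔤 ≃ₗ⁅ℝ⁆ 𝔤) (m : Complexification 𝔤 ≃ₗ[ℂ] Complexification 𝔤)
    (hf : ∀ x, m (tmul 1 x) = tmul 1 (f x)) (z : Complexification 𝔤) :
    z ∈ (𝒥.conjugate f).g01 ↔ m z ∈ 𝒥.g01 := by
  have h : ∀ z, m ((𝒥.conjugate f).JC z) = 𝒥.JC (m z) := fun z => by
    have h1 : ∀ x : 𝔤, m ((𝒥.conjugate f).JC (tmul 1 x)) = 𝒥.JC (m (tmul 1 x)) := fun x => by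
      rw [JC_tmul, hf, hf, JC_tmul, conjugate_J, f.apply_symm_apply]
    obtain ⟨a, b, rfl⟩ := Complexification.exists_eq_add_smul z
    simp only [map_add, map_smul, h1]
  rw [mem_g01, mem_g01, ← h, ← map_smul, m.injective.eq_iff]

end LieComplexStructure

/-- Injectivity of a linear map persists under small linear perturbations. -/
theorem eventually_injective_add {X Y W : Type*} [NormedAddCommGroup X] [NormedSpace ℂ X]
    [FiniteDimensional ℂ X] [AddCommGroup Y] [Module ℂ Y] [FiniteDimensional ℂ Y]
    [AddCommGroup W] [Module ℂ W] [FiniteDimensional ℂ W] (D : Y →ₗ[ℂ] W)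
    (hD : Function.Injective D) (R : X →ₗ[ℂ] Y →ₗ[ℂ] W) :
    ∀ᶠ x in 𝓝 (0 : X), Function.Injective (D + R x) := by
  let a := (Module.finBasis ℂ Y).equivFun
  let b := (Module.finBasis ℂ W).equivFun
  -- Coordinates turn `D + R x` into a continuous family of continuous linear maps, among which
  -- injectivity is an open condition.
  let c := (a.arrowCongr b).trans LinearMap.toContinuousLinearMap
  have hc : ∀ T : Y →ₗ[ℂ] W, Function.Injective (c T) ↔ Function.Injective T := fun T => by
    have : (c T : _ → _) = b ∘ T ∘ a.symm := rfl
    rw [this, b.injective.of_comp_iff]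
    exact a.symm.toEquiv.injective_comp T
  have hcont : Continuous fun x => c (D + R x) := by
    have : (fun x => c (D + R x)) = fun x => c D + (c.toLinearMap ∘ₗ R) x := by
      ext1 x; rw [map_add]; rfl
    rw [this]
    exact continuous_const.add (LinearMap.continuous_of_finiteDimensional _)
  have h0 : Function.Injective (c (D + R 0)) := by
    rw [hc, map_zero, add_zero]; exact hD
  filter_upwards [hcont.tendsto 0 |>.eventually
    (ContinuousLinearMap.isOpen_injective.mem_nhds h0)] with x hx
  exact (hc _).1 hx

/-! ### Normed coordinate models and the automorphisms `exp (ad z)` -/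

namespace LieComplexStructure

variable {𝔤 : Type*} [LieRing 𝔤] [LieAlgebra ℝ 𝔤] [FiniteDimensional ℝ 𝔤]
  (𝒥 : LieComplexStructure 𝔤)

/-- Coordinates on `𝔤_ℂ`. -/
def coordC (𝔤 : Type*) [LieRing 𝔤] [LieAlgebra ℝ 𝔤] [FiniteDimensional ℝ 𝔤] :
    Complexification 𝔤 ≃ₗ[ℂ] (Fin (Module.finrank ℂ (Complexification 𝔤)) → ℂ) :=
  (Module.finBasis ℂ (Complexification 𝔤)).equivFun

/-- Coordinates on `𝔤^{1,0}`. -/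
def coord10 : 𝒥.g10 ≃ₗ[ℂ] (Fin (Module.finrank ℂ 𝒥.g10) → ℂ) :=
  (Module.finBasis ℂ 𝒥.g10).equivFun

/-- Coordinates on `𝔤^{0,1}`. -/
def coord01 : 𝒥.g01 ≃ₗ[ℂ] (Fin (Module.finrank ℂ 𝒥.g01) → ℂ) :=
  (Module.finBasis ℂ 𝒥.g01).equivFun

/-- `Λ^{0,1} ⊗ 𝔤^{1,0}` as a normed space. -/
abbrev A01Model : Type :=
  (Fin (Module.finrank ℂ 𝒥.g01) → ℂ) →L[ℂ] (Fin (Module.finrank ℂ 𝒥.g10) → ℂ)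

/-- Coordinates on `Λ^{0,1} ⊗ 𝔤^{1,0}`. -/
def coordA01 : 𝒥.A01 ≃ₗ[ℂ] 𝒥.A01Model :=
  (𝒥.coord01.arrowCongr 𝒥.coord10).trans LinearMap.toContinuousLinearMap

theorem coordA01_symm_apply (φ : 𝒥.A01Model) (x : 𝒥.g01) :
    𝒥.coordA01.symm φ x = 𝒥.coord10.symm (φ (𝒥.coord01 x)) := rfl

/-- The Lie bracket of `𝔤_ℂ` in coordinates. -/
def bracketC (𝔤 : Type*) [LieRing 𝔤] [LieAlgebra ℝ 𝔤] [FiniteDimensional ℝ 𝔤] :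
    (Fin (Module.finrank ℂ (Complexification 𝔤)) → ℂ) →L[ℂ]
      (Fin (Module.finrank ℂ (Complexification 𝔤)) → ℂ) →L[ℂ]
      (Fin (Module.finrank ℂ (Complexification 𝔤)) → ℂ) :=
  LinearMap.toContinuousLinearMap (LinearMap.toContinuousLinearMap.toLinearMap ∘ₗ
    LinearMap.mk₂ ℂ (fun x y => coordC 𝔤 ⁅(coordC 𝔤).symm x, (coordC 𝔤).symm y⁆)
      (fun x x' y => by rw [map_add, add_lie, map_add])
      (fun a x y => by rw [map_smul, smul_lie, map_smul])
      (fun x y y' => by rw [map_add, lie_add, map_add])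
      (fun a x y => by rw [map_smul, lie_smul, map_smul]))

theorem bracketC_apply (x y : Fin (Module.finrank ℂ (Complexification 𝔤)) → ℂ) :
    bracketC 𝔤 x y = coordC 𝔤 ⁅(coordC 𝔤).symm x, (coordC 𝔤).symm y⁆ := rfl

theorem bracketC_jacobi (x y z : Fin (Module.finrank ℂ (Complexification 𝔤)) → ℂ) :
    bracketC 𝔤 x (bracketC 𝔤 y z) =
      bracketC 𝔤 (bracketC 𝔤 x y) z + bracketC 𝔤 y (bracketC 𝔤 x z) := by
  simp only [bracketC_apply, LinearEquiv.symm_apply_apply]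
  rw [leibniz_lie, map_add]

/-- Conjugation of `𝔤_ℂ` in coordinates. -/
def conjC (𝔤 : Type*) [LieRing 𝔤] [LieAlgebra ℝ 𝔤] [FiniteDimensional ℝ 𝔤] :
    (Fin (Module.finrank ℂ (Complexification 𝔤)) → ℂ) →L[ℝ]
      (Fin (Module.finrank ℂ (Complexification 𝔤)) → ℂ) :=
  LinearMap.toContinuousLinearMap
    ((coordC 𝔤).toLinearMap.restrictScalars ℝ ∘ₗ Complexification.conj ∘ₗ
      (coordC 𝔤).symm.toLinearMap.restrictScalars ℝ)

theorem conjC_apply (x : Fin (Module.finrank ℂ (Complexification 𝔤)) → ℂ) :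
    conjC 𝔤 x = coordC 𝔤 (Complexification.conj ((coordC 𝔤).symm x)) := rfl

/-- The automorphism `exp (ad z)` of `𝔤_ℂ` as a linear map. -/
def expAdHom (z : Complexification 𝔤) : Complexification 𝔤 →ₗ[ℂ] Complexification 𝔤 :=
  (coordC 𝔤).symm.toLinearMap ∘ₗ
    (NormedSpace.exp (bracketC 𝔤 (coordC 𝔤 z))).toLinearMap ∘ₗ (coordC 𝔤).toLinearMap

theorem expAdHom_apply (z x : Complexification 𝔤) : expAdHom z x =
    (coordC 𝔤).symm (NormedSpace.exp (bracketC 𝔤 (coordC 𝔤 z)) (coordC 𝔤 x)) := rfl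

theorem coordC_expAdHom (z x : Complexification 𝔤) : coordC 𝔤 (expAdHom z x) =
    NormedSpace.exp (bracketC 𝔤 (coordC 𝔤 z)) (coordC 𝔤 x) :=
  (coordC 𝔤).apply_symm_apply _

theorem expAdHom_lie (z x y : Complexification 𝔤) :
    expAdHom z ⁅x, y⁆ = ⁅expAdHom z x, expAdHom z y⁆ := by
  apply (coordC 𝔤).injective
  have h := exp_derivation_bracket (bracketC 𝔤) (bracketC 𝔤 (coordC 𝔤 z))
    (bracketC_jacobi _) (coordC 𝔤 x) (coordC 𝔤 y)
  rw [coordC_expAdHom, expAdHom_apply, expAdHom_apply, ← bracketC_apply, ← h, bracketC_apply]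
  simp

theorem expAdHom_expAdHom_neg (z x : Complexification 𝔤) : expAdHom z (expAdHom (-z) x) = x := by
  rw [expAdHom_apply, coordC_expAdHom, map_neg, map_neg]
  have := DFunLike.congr_fun (exp_mul_exp_neg (bracketC 𝔤 (coordC 𝔤 z))) (coordC 𝔤 x)
  rw [mul_apply_eq_comp] at this
  rw [this]
  simp

/-- The automorphism `exp (ad z)` of `𝔤_ℂ`. -/
def expAd (z : Complexification 𝔤) : Complexification 𝔤 ≃ₗ⁅ℂ⁆ Complexification 𝔤 where
  __ := expAdHom z
  map_lie' := expAdHom_lie z _ _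
  invFun := expAdHom (-z)
  left_inv x := by
    have := expAdHom_expAdHom_neg (-z) x
    rwa [neg_neg] at this
  right_inv := expAdHom_expAdHom_neg z

theorem expAd_apply (z x : Complexification 𝔤) : expAd z x = expAdHom z x := rfl

/-- `t ↦ exp (ad z(t)) x` is analytic in coordinates if `z` is. -/
theorem analyticAt_expAd {T : Type*} [NormedAddCommGroup T] [NormedSpace ℂ T]
    {z : T → Complexification 𝔤} {t : T} (hz : AnalyticAt ℂ (fun t => coordC 𝔤 (z t)) t)
    (x : Complexification 𝔤) : AnalyticAt ℂ (fun t => coordC 𝔤 (expAd (z t) x)) t := by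
  have h1 : AnalyticAt ℂ (fun t => bracketC 𝔤 (coordC 𝔤 (z t))) t :=
    ((bracketC 𝔤).analyticAt _).comp hz
  have h2 : AnalyticAt ℂ (fun t => NormedSpace.exp (bracketC 𝔤 (coordC 𝔤 (z t)))) t :=
    AnalyticAt.comp (g := NormedSpace.exp) (NormedSpace.exp_analytic (𝕂 := ℂ) _) h1
  refine (((ContinuousLinearMap.apply ℂ _ (coordC 𝔤 x)).analyticAt _).comp h2).congr ?_
  exact Filter.Eventually.of_forall fun t => (coordC_expAdHom _ _).symm

end LieComplexStructure

/-! ### Conjugacy, gauge fixing and the Maurer-Cartan equation for small parameters -/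

namespace LieComplexStructure

variable {𝔤 : Type*} [LieRing 𝔤] [LieAlgebra ℝ 𝔤] [FiniteDimensional ℝ 𝔤]
  (𝒥 : LieComplexStructure 𝔤)

/-- The inclusion of `𝔤^{1,0}` in coordinates. -/
def incl10 : (Fin (Module.finrank ℂ 𝒥.g10) → ℂ) →L[ℂ]
    (Fin (Module.finrank ℂ (Complexification 𝔤)) → ℂ) :=
  LinearMap.toContinuousLinearMap
    ((coordC 𝔤).toLinearMap ∘ₗ 𝒥.g10.toSubmodule.subtype ∘ₗ 𝒥.coord10.symm.toLinearMap)

/-- The inclusion of `𝔤^{0,1}` in coordinates. -/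
def incl01 : (Fin (Module.finrank ℂ 𝒥.g01) → ℂ) →L[ℂ]
    (Fin (Module.finrank ℂ (Complexification 𝔤)) → ℂ) :=
  LinearMap.toContinuousLinearMap
    ((coordC 𝔤).toLinearMap ∘ₗ 𝒥.g01.toSubmodule.subtype ∘ₗ 𝒥.coord01.symm.toLinearMap)

/-- The projection to `𝔤^{1,0}` in coordinates. -/
def proj10 : (Fin (Module.finrank ℂ (Complexification 𝔤)) → ℂ) →L[ℂ]
    (Fin (Module.finrank ℂ 𝒥.g10) → ℂ) :=
  LinearMap.toContinuousLinearMap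
    (𝒥.coord10.toLinearMap ∘ₗ 𝒥.P10 ∘ₗ (coordC 𝔤).symm.toLinearMap)

/-- The projection to `𝔤^{0,1}` in coordinates. -/
def proj01 : (Fin (Module.finrank ℂ (Complexification 𝔤)) → ℂ) →L[ℂ]
    (Fin (Module.finrank ℂ 𝒥.g01) → ℂ) :=
  LinearMap.toContinuousLinearMap
    (𝒥.coord01.toLinearMap ∘ₗ 𝒥.P01 ∘ₗ (coordC 𝔤).symm.toLinearMap)

theorem incl10_apply (x) : 𝒥.incl10 x = coordC 𝔤 (𝒥.coord10.symm x : Complexification 𝔤) := rfl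

theorem incl01_apply (x) : 𝒥.incl01 x = coordC 𝔤 (𝒥.coord01.symm x : Complexification 𝔤) := rfl

theorem proj10_apply (e) : 𝒥.proj10 e = 𝒥.coord10 (𝒥.P10 ((coordC 𝔤).symm e)) := rfl

theorem proj01_apply (e) : 𝒥.proj01 e = 𝒥.coord01 (𝒥.P01 ((coordC 𝔤).symm e)) := rfl

theorem proj10_incl10 (x) : 𝒥.proj10 (𝒥.incl10 x) = x := by
  rw [proj10_apply, incl10_apply, LinearEquiv.symm_apply_apply, P10_coe,
    LinearEquiv.apply_symm_apply]

theorem proj01_incl01 (x) : 𝒥.proj01 (𝒥.incl01 x) = x := by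
  rw [proj01_apply, incl01_apply, LinearEquiv.symm_apply_apply, P01_coe,
    LinearEquiv.apply_symm_apply]

theorem proj10_incl01 (x) : 𝒥.proj10 (𝒥.incl01 x) = 0 := by
  rw [proj10_apply, incl01_apply, LinearEquiv.symm_apply_apply, P10_coe_g01, map_zero]

theorem proj01_incl10 (x) : 𝒥.proj01 (𝒥.incl10 x) = 0 := by
  rw [proj01_apply, incl10_apply, LinearEquiv.symm_apply_apply, P01_coe_g10, map_zero]

theorem incl10_proj10_add (e) : 𝒥.incl10 (𝒥.proj10 e) + 𝒥.incl01 (𝒥.proj01 e) = e := by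
  rw [proj10_apply, incl10_apply, LinearEquiv.symm_apply_apply, proj01_apply, incl01_apply,
    LinearEquiv.symm_apply_apply, ← map_add, P10_add_P01, LinearEquiv.apply_symm_apply]

theorem graphMap_symm_eq_zero_iff (φ : 𝒥.A01Model) (e : Complexification 𝔤) :
    𝒥.graphMap (𝒥.coordA01.symm φ) e = 0 ↔
      𝒥.proj10 (coordC 𝔤 e) + φ (𝒥.proj01 (coordC 𝔤 e)) = 0 := by
  rw [← 𝒥.coord10.map_eq_zero_iff, graphMap_apply, map_add, coordA01_symm_apply,
    LinearEquiv.apply_symm_apply, proj10_apply, proj01_apply, LinearEquiv.symm_apply_apply]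

/-- If `exp (ad Z)` carries `𝔤^{0,1}_φ` to `𝔤^{0,1}_ψ` for small `φ` and `Z`, then `φ` and `ψ`
determine complex structures that are conjugate under an automorphism of `𝔤`. -/
theorem eventually_exists_conjugate :
    ∀ᶠ p : (Fin (Module.finrank ℂ 𝒥.g10) → ℂ) × 𝒥.A01Model in 𝓝 0, ∀ ψ : 𝒥.A01,
      𝒥.dbar1 ψ = (1 / 2 : ℂ) • 𝒥.fnBracket ψ ψ →
      (∀ e, 𝒥.graphMap (𝒥.coordA01.symm p.2) e = 0 ↔
        𝒥.graphMap ψ (expAd (𝒥.coord10.symm p.1 : Complexification 𝔤) e) = 0) →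
      𝒥.dbar1 (𝒥.coordA01.symm p.2) =
        (1 / 2 : ℂ) • 𝒥.fnBracket (𝒥.coordA01.symm p.2) (𝒥.coordA01.symm p.2) ∧
      ∃ 𝒥₁ 𝒥₂ : LieComplexStructure 𝔤, 𝒥.Determines ψ 𝒥₁ ∧
        𝒥.Determines (𝒥.coordA01.symm p.2) 𝒥₂ ∧
        ∃ f : 𝔤 ≃ₗ⁅ℝ⁆ 𝔤, ∀ x, 𝒥₂.J x = f.symm (𝒥₁.J (f x)) := by
  obtain ⟨C, hC⟩ := exists_projection_to_real 𝒥.incl10 𝒥.incl01 𝒥.proj10 𝒥.proj01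
    𝒥.proj10_incl10 𝒥.proj01_incl01 𝒥.proj10_incl01 𝒥.proj01_incl10 𝒥.incl10_proj10_add
    (conjC 𝔤) (fun e => by
      rw [conjC_apply, conjC_apply, LinearEquiv.symm_apply_apply, Complexification.conj_conj,
        LinearEquiv.apply_symm_apply])
    (fun e => by
      rw [conjC_apply, conjC_apply, incl01_apply, proj01_apply, incl10_apply, proj10_apply]
      simp only [LinearEquiv.symm_apply_apply]
      rw [conj_P01])
  have hsmall : ∀ᶠ Z : Fin (Module.finrank ℂ 𝒥.g10) → ℂ in 𝓝 0,
      ‖bracketC 𝔤‖ * |C| * ‖𝒥.incl10 Z‖ < 1 / 5 := by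
    have : Continuous fun Z => ‖bracketC 𝔤‖ * |C| * ‖𝒥.incl10 Z‖ := by fun_prop
    exact (this.tendsto 0).eventually_lt_const (by simp)
  have h1 := (continuous_snd.tendsto
    (0 : (Fin (Module.finrank ℂ 𝒥.g10) → ℂ) × 𝒥.A01Model)).eventually hC
  have h2 := (continuous_fst.tendsto
    (0 : (Fin (Module.finrank ℂ 𝒥.g10) → ℂ) × 𝒥.A01Model)).eventually hsmall
  filter_upwards [h1, h2]
  rintro ⟨Z, φ⟩ ⟨⟨ρ, hρC, hρσ, hρ⟩, huniq⟩ hZ ψ hψ hgraph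
  dsimp only at *
  set φ' := 𝒥.coordA01.symm φ with hφ'
  -- `exp (ad Z)` is an automorphism, so `𝔤^{0,1}_φ'` is a subalgebra because `𝔤^{0,1}_ψ` is one.
  have hcl : ∀ x y, 𝒥.graphMap φ' x = 0 → 𝒥.graphMap φ' y = 0 → 𝒥.graphMap φ' ⁅x, y⁆ = 0 :=
    fun x y hx hy => by
      rw [hgraph] at hx hy ⊢
      rw [LieEquiv.map_lie]
      exact (𝒥.maurerCartan_iff ψ).1 hψ _ _ hx hy
  refine ⟨(𝒥.maurerCartan_iff φ').2 hcl, ?_⟩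
  obtain ⟨m, hmu, hmaut, hmσ, hmgraph⟩ := exists_real_automorphism (bracketC 𝔤) bracketC_jacobi
    (conjC 𝔤) (fun x y => by
      simp only [conjC_apply, bracketC_apply, LinearEquiv.symm_apply_apply]
      rw [Complexification.conj_lie])
    (𝒥.proj10 + φ.comp 𝒥.proj01) 𝒥.incl10 (fun p => by
      simp [proj10_incl10, proj01_incl10])
    (fun x y hx hy => by
      have h := hcl ((coordC 𝔤).symm x) ((coordC 𝔤).symm y)
      simp only [hφ', graphMap_symm_eq_zero_iff, LinearEquiv.apply_symm_apply] at h
      exact h hx hy)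
    ρ hρσ hρ (𝒥.incl10 Z) (le_trans (by
      gcongr
      exact hρC.trans (le_abs_self C)) hZ.le)
  let mE : Complexification 𝔤 ≃ₗ[ℂ] Complexification 𝔤 :=
    ((coordC 𝔤).trans (ContinuousLinearEquiv.ofUnit hmu.unit).toLinearEquiv).trans (coordC 𝔤).symm
  have hmE : ∀ z, mE z = (coordC 𝔤).symm (m (coordC 𝔤 z)) := fun z => rfl
  have hmE' : ∀ z, coordC 𝔤 (mE z) = m (coordC 𝔤 z) := fun z => (coordC 𝔤).apply_symm_apply _
  obtain ⟨𝒥₂, h𝒥₂⟩ := exists_of_isCompl_real (𝒥.deformed01 φ')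
    (fun x hx y hy => by
      rw [mem_deformed01] at hx hy ⊢
      exact hcl x y hx hy)
    (fun z => by
      obtain ⟨x, hx⟩ := Complexification.exists_tmul_of_conj_eq
        (z := (coordC 𝔤).symm (ρ (coordC 𝔤 z))) (by
          apply (coordC 𝔤).injective
          rw [← conjC_apply, hρσ, LinearEquiv.apply_symm_apply])
      refine ⟨x, ?_⟩
      rw [mem_deformed01, hφ', graphMap_symm_eq_zero_iff, ← hx, map_sub,
        LinearEquiv.apply_symm_apply]
      exact hρ _)
    (fun x hx => by
      rw [mem_deformed01, hφ', graphMap_symm_eq_zero_iff] at hx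
      have := huniq (coordC 𝔤 (tmul 1 x)) (by
        rw [conjC_apply, LinearEquiv.symm_apply_apply, Complexification.conj_tmul_one]) hx
      rw [LinearEquiv.map_eq_zero_iff] at this
      exact Complexification.tmul_one_injective (this.trans (Complexification.tmul_zero 1).symm))
  obtain ⟨f, hf⟩ := exists_lieEquiv_of_real mE
    (fun x y => by
      apply (coordC 𝔤).injective
      have := hmaut (coordC 𝔤 x) (coordC 𝔤 y)
      simp only [bracketC_apply, LinearEquiv.symm_apply_apply] at this
      rw [hmE', this, ← hmE, ← hmE])
    (fun x => by
      apply (coordC 𝔤).injective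
      have := hmσ (coordC 𝔤 x)
      simp only [conjC_apply, LinearEquiv.symm_apply_apply] at this
      rw [hmE', this, ← hmE])
  -- Only `𝒥₂` is built from a complement of the real form. As `m` carries `𝔤^{0,1}_ψ` to
  -- `𝔤^{0,1}_φ'`, the structure of `ψ` is the conjugate of `𝒥₂` by `f`, and `f.symm` conjugates
  -- back.
  refine ⟨𝒥₂.conjugate f, 𝒥₂, ?_, h𝒥₂, f.symm, fun x => ?_⟩
  · ext z
    obtain ⟨e, rfl⟩ : ∃ e, expAd (𝒥.coord10.symm Z : Complexification 𝔤) e = z :=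
      ⟨_, LieEquiv.apply_symm_apply _ z⟩
    rw [LieSubalgebra.mem_toSubmodule, 𝒥₂.mem_g01_conjugate f mE hf,
      ← LieSubalgebra.mem_toSubmodule, h𝒥₂, mem_deformed01, mem_deformed01, ← hgraph, hφ',
      graphMap_symm_eq_zero_iff, graphMap_symm_eq_zero_iff, hmE', expAd_apply, coordC_expAdHom]
    exact hmgraph (coordC 𝔤 e)
  · change _ = f (f.symm (𝒥₂.J (f (f.symm x))))
    rw [f.apply_symm_apply, f.apply_symm_apply]

section Gauge

variable (c₀ : InnerProductSpace.Core ℂ 𝒥.g10) (c₁ : InnerProductSpace.Core ℂ 𝒥.A01)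
  (c₂ : InnerProductSpace.Core ℂ 𝒥.A02)

/-- Every small element of `Λ^{0,1} ⊗ 𝔤^{1,0}` can be moved into the kernel of `∂̄†`,
analytically, by `exp (ad Z)` with `Z ∈ 𝔤^{1,0}`. -/
theorem exists_analytic_gauge :
    ∃ (ζ : 𝒥.A01Model → (Fin (Module.finrank ℂ 𝒥.g10) → ℂ)) (Φ : 𝒥.A01Model → 𝒥.A01Model),
      AnalyticAt ℂ ζ 0 ∧ AnalyticAt ℂ Φ 0 ∧ ζ 0 = 0 ∧ Φ 0 = 0 ∧
      ∀ᶠ ψ in 𝓝 0, 𝒥.dbarDagger0 c₀ c₁ (𝒥.coordA01.symm (Φ ψ)) = 0 ∧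
        ∀ e, 𝒥.graphMap (𝒥.coordA01.symm (Φ ψ)) e = 0 ↔
          𝒥.graphMap (𝒥.coordA01.symm ψ)
            (expAd (𝒥.coord10.symm (ζ ψ) : Complexification 𝔤) e) = 0 := by
  let d : (Fin (Module.finrank ℂ 𝒥.g10) → ℂ) →L[ℂ] 𝒥.A01Model :=
    LinearMap.toContinuousLinearMap
      (𝒥.coordA01.toLinearMap ∘ₗ 𝒥.dbar0 ∘ₗ 𝒥.coord10.symm.toLinearMap)
  let δ : 𝒥.A01Model →L[ℂ] (Fin (Module.finrank ℂ 𝒥.g10) → ℂ) :=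
    LinearMap.toContinuousLinearMap
      (𝒥.coord10.toLinearMap ∘ₗ 𝒥.dbarDagger0 c₀ c₁ ∘ₗ 𝒥.coordA01.symm.toLinearMap)
  have hδ : ∀ φ, δ φ = 𝒥.coord10 (𝒥.dbarDagger0 c₀ c₁ (𝒥.coordA01.symm φ)) := fun φ => rfl
  have hd : ∀ Z, d Z = 𝒥.coordA01 (𝒥.dbar0 (𝒥.coord10.symm Z)) := fun Z => rfl
  obtain ⟨ζ, Φ, h1, h2, h3, h4, h5⟩ := exists_gauge_fixing (bracketC 𝔤) 𝒥.incl10 𝒥.incl01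
    𝒥.proj10 𝒥.proj01 𝒥.proj01_incl01 𝒥.proj10_incl01 𝒥.proj10_incl10 𝒥.proj01_incl10
    𝒥.incl10_proj10_add d (fun Z => by
      refine ContinuousLinearMap.ext fun v => ?_
      change 𝒥.coord10 (𝒥.P10 ⁅(𝒥.coord01.symm v : Complexification 𝔤),
        (𝒥.coord10.symm Z : Complexification 𝔤)⁆) =
        -𝒥.proj10 (bracketC 𝔤 (𝒥.incl10 Z) (𝒥.incl01 v))
      rw [proj10_apply, bracketC_apply, incl10_apply, incl01_apply]
      simp only [LinearEquiv.symm_apply_apply]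
      rw [← lie_skew, map_neg, map_neg]) δ (fun φ => by
      rw [hδ, hδ, hd, LinearEquiv.symm_apply_apply, LinearEquiv.symm_apply_apply]
      exact congrArg _ (mpInverse_map_mpInverse c₀ c₁ 𝒥.dbar0 _))
  refine ⟨ζ, Φ, h1, h2, h3, h4, ?_⟩
  filter_upwards [h5] with ψ hψ
  refine ⟨𝒥.coord10.map_eq_zero_iff.1 hψ.1, fun e => ?_⟩
  rw [graphMap_symm_eq_zero_iff, graphMap_symm_eq_zero_iff, expAd_apply, coordC_expAdHom]
  exact hψ.2 (coordC 𝔤 e)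

/-- For small `φ`, the Maurer-Cartan equation holds as soon as the components of its failure in
the range of `∂̄` and in `ℋ^{0,2}` vanish. -/
theorem eventually_maurerCartan :
    ∀ᶠ φ : 𝒥.A01Model in 𝓝 0,
      𝒥.dbarDagger1 c₁ c₂ (𝒥.mcDefect (𝒥.coordA01.symm φ)) = 0 →
      orthProj c₂ (𝒥.harmonic2 c₁ c₂) (𝒥.mcDefect (𝒥.coordA01.symm φ)) = 0 →
      𝒥.mcDefect (𝒥.coordA01.symm φ) = 0 := by
  let ι := Fin (Module.finrank ℂ 𝒥.g01)
  let b : Module.Basis ι ℂ 𝒥.g01 := Module.finBasis ℂ 𝒥.g01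
  -- Evaluation of `∂̄` on triples of basis vectors gives a finite-dimensional target, as the
  -- perturbation lemma requires.
  let D₂ : 𝒥.A02 →ₗ[ℂ] (ι × ι × ι → 𝒥.g10) :=
    { toFun := fun ξ i => 𝒥.dbar2 ξ (b i.1) (b i.2.1) (b i.2.2)
      map_add' := fun ξ ξ' => by ext1 i; simp only [map_add, LinearMap.add_apply, Pi.add_apply]
      map_smul' := fun a ξ => by
        ext1 i; simp only [map_smul, LinearMap.smul_apply, Pi.smul_apply, RingHom.id_apply] }
  let D : 𝒥.A02 →ₗ[ℂ] (ι × ι × ι → 𝒥.g10) × 𝒥.A01 × 𝒥.A02 :=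
    D₂.prod ((𝒥.dbarDagger1 c₁ c₂).prod (orthProj c₂ (𝒥.harmonic2 c₁ c₂)))
  let R₂ : 𝒥.A01 →ₗ[ℂ] 𝒥.A02 →ₗ[ℂ] (ι × ι × ι → 𝒥.g10) := LinearMap.mk₂ ℂ
    (fun φ ξ i => 𝒥.dbarCorrection (b i.1) (b i.2.1) (b i.2.2) φ ξ +
      𝒥.dbarCorrection (b i.2.1) (b i.2.2) (b i.1) φ ξ +
      𝒥.dbarCorrection (b i.2.2) (b i.1) (b i.2.1) φ ξ)
    (fun φ φ' ξ => by
      ext1 i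
      simp only [map_add, LinearMap.add_apply, Pi.add_apply]
      abel)
    (fun a φ ξ => by
      ext1 i
      simp only [map_smul, LinearMap.smul_apply, Pi.smul_apply, smul_add])
    (fun φ ξ ξ' => by
      ext1 i
      simp only [map_add, Pi.add_apply]
      abel)
    (fun a φ ξ => by
      ext1 i
      simp only [map_smul, Pi.smul_apply, smul_add])
  let R : 𝒥.A01Model →ₗ[ℂ] 𝒥.A02 →ₗ[ℂ] (ι × ι × ι → 𝒥.g10) × 𝒥.A01 × 𝒥.A02 :=
    (R₂.compr₂ (LinearMap.inl ℂ _ _)) ∘ₗ 𝒥.coordA01.symm.toLinearMap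
  -- An element killed by `∂̄` and `∂̄†` is harmonic, hence equal to its own harmonic projection.
  have hD : Function.Injective D := by
    rw [injective_iff_map_eq_zero]
    intro ξ hξ
    have h1 : D₂ ξ = 0 := congrArg Prod.fst hξ
    have h2 : 𝒥.dbarDagger1 c₁ c₂ ξ = 0 := congrArg (fun w => w.2.1) hξ
    have h3 : orthProj c₂ (𝒥.harmonic2 c₁ c₂) ξ = 0 := congrArg (fun w => w.2.2) hξ
    have h4 : 𝒥.dbar2 ξ = 0 := by
      refine b.ext fun i => b.ext fun j => b.ext fun k => ?_
      exact congrFun h1 (i, j, k)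
    rw [← h3, orthProj_of_mem]
    exact ⟨h4, h2⟩
  filter_upwards [eventually_injective_add (Y := 𝒥.A02)
    (W := (ι × ι × ι → 𝒥.g10) × 𝒥.A01 × 𝒥.A02) D hD R] with φ hφ h1 h2
  set φ' := 𝒥.coordA01.symm φ
  refine (injective_iff_map_eq_zero _).1 hφ _ ?_
  refine Prod.ext (funext fun i => ?_) (Prod.ext ?_ ?_)
  · exact 𝒥.dbar2_mcDefect φ' (b i.1) (b i.2.1) (b i.2.2)
  · change 𝒥.dbarDagger1 c₁ c₂ (𝒥.mcDefect φ') + 0 = 0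
    rw [h1, add_zero]
  · change orthProj c₂ (𝒥.harmonic2 c₁ c₂) (𝒥.mcDefect φ') + 0 = 0
    rw [h2, add_zero]

end Gauge

end LieComplexStructure

/-! ### Holomorphic maps and quadratic equations in normed models -/

/-- A function that is holomorphic on a set extends, near each point of it, to an analytic function
with values in any normed model of the target. -/
theorem HolomorphicOnSet.exists_analyticAt {m : ℕ} {V X : Type*} [AddCommGroup V] [Module ℂ V]
    [FiniteDimensional ℂ V] [NormedAddCommGroup X] [NormedSpace ℂ X] (α : V ≃ₗ[ℂ] X)
    {S : Set (Fin m → ℂ)} {f : (Fin m → ℂ) → V} (hf : HolomorphicOnSet S f) {p : Fin m → ℂ}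
    (hp : p ∈ S) :
    ∃ g : (Fin m → ℂ) → X, AnalyticAt ℂ g p ∧ ∀ᶠ t in 𝓝[S] p, α (f t) = g t := by
  let b := Module.finBasis ℂ V
  choose g hg hfg using fun i => hf (b.coord i) p hp
  refine ⟨fun t => ∑ i, g i t • α (b i),
    Finset.analyticAt_fun_sum _ fun i _ => (hg i).smul analyticAt_const, ?_⟩
  filter_upwards [Filter.eventually_all.2 hfg] with t ht
  rw [← b.sum_repr (f t), map_sum]
  refine Finset.sum_congr rfl fun i _ => ?_
  rw [map_smul, ← ht i]
  rfl

theorem holomorphicOnSet_of_analyticAt {m : ℕ} {V X : Type*} [AddCommGroup V] [Module ℂ V]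
    [NormedAddCommGroup X] [NormedSpace ℂ X] [FiniteDimensional ℂ X] (α : V ≃ₗ[ℂ] X)
    {S : Set (Fin m → ℂ)} {f : (Fin m → ℂ) → V}
    (hf : ∀ p ∈ S, AnalyticAt ℂ (fun t => α (f t)) p) : HolomorphicOnSet S f := fun ℓ p hp => by
  let k : X →L[ℂ] ℂ := LinearMap.toContinuousLinearMap (ℓ ∘ₗ α.symm.toLinearMap)
  refine ⟨fun t => k (α (f t)), (k.analyticAt _).comp (hf p hp), Filter.Eventually.of_forall
    fun t => ?_⟩
  change ℓ (f t) = ℓ (α.symm (α (f t)))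
  rw [α.symm_apply_apply]

/-- A bilinear map on a finite-dimensional normed space is continuous. -/
def bilinToCLM {X F : Type*} [NormedAddCommGroup X] [NormedSpace ℂ X] [FiniteDimensional ℂ X]
    [NormedAddCommGroup F] [NormedSpace ℂ F] (B : X →ₗ[ℂ] X →ₗ[ℂ] F) : X →L[ℂ] X →L[ℂ] F :=
  LinearMap.toContinuousLinearMap (LinearMap.toContinuousLinearMap.toLinearMap ∘ₗ B)

theorem eventually_quadratic_solution_unique {V : Type*} [NormedAddCommGroup V] [NormedSpace ℂ V]
    (Q : V →L[ℂ] V →L[ℂ] V) : ∀ᶠ p in 𝓝 ((0 : V), (0 : V)), ∀ v,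
      p.1 = v + Q p.1 p.1 → p.2 = v + Q p.2 p.2 → p.1 = p.2 := by
  have h : Filter.Tendsto (fun p : V × V => ‖Q‖ * (‖p.1‖ + ‖p.2‖)) (𝓝 (0, 0)) (𝓝 0) := by
    have : Continuous (fun p : V × V => ‖Q‖ * (‖p.1‖ + ‖p.2‖)) := by fun_prop
    simpa using this.tendsto (0, 0)
  filter_upwards [h.eventually_lt_const one_pos] with p hp v hx hy
  exact quadratic_solution_unique Q hx hy hp

theorem map_sub_eq_zero_of_eq_add {X Y : Type*} [AddCommGroup X] [Module ℂ X] [AddCommGroup Y]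
    [Module ℂ Y] (d : X →ₗ[ℂ] Y) (T : Y →ₗ[ℂ] X) (hT : ∀ y, T (d (T y)) = T y) {v x : X}
    {y : Y} (hv : d v = 0) (hx : x = v + T y) : T (y - d x) = 0 := by
  rw [hx, map_add, hv, zero_add, map_sub, hT, sub_self]

theorem map_smul_eq_zero_of_map_eq_zero {Y Z : Type*} [AddCommGroup Y] [Module ℂ Y]
    [AddCommGroup Z] [Module ℂ Z] (P : Y →ₗ[ℂ] Z) (c : ℂ) {y : Y} (hy : P y = 0) :
    P (c • y) = 0 := by
  rw [map_smul, hy, smul_zero]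

/-! ### The Kuranishi family and its completeness -/

namespace LieComplexStructure

variable {𝔤 : Type*} [LieRing 𝔤] [LieAlgebra ℝ 𝔤] (𝒥 : LieComplexStructure 𝔤)

/-- The Frölicher-Nijenhuis bracket as a bilinear map. -/
def fnBilin : 𝒥.A01 →ₗ[ℂ] 𝒥.A01 →ₗ[ℂ] 𝒥.A02 :=
  have hadd : ∀ φ φ' ψ, 𝒥.fnBracket (φ + φ') ψ = 𝒥.fnBracket φ ψ + 𝒥.fnBracket φ' ψ :=
    fun φ φ' ψ => by
      apply Subtype.ext
      ext x y : 2
      change 𝒥.fnAux (φ + φ') ψ x y + 𝒥.fnAux ψ (φ + φ') x y =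
        (𝒥.fnAux φ ψ x y + 𝒥.fnAux ψ φ x y) + (𝒥.fnAux φ' ψ x y + 𝒥.fnAux ψ φ' x y)
      simp only [fnAux_apply, LinearMap.add_apply, coe_add', add_lie, lie_add, map_add]
      abel
  have hsmul : ∀ (a : ℂ) φ ψ, 𝒥.fnBracket (a • φ) ψ = a • 𝒥.fnBracket φ ψ := fun a φ ψ => by
    apply Subtype.ext
    ext x y : 2
    change 𝒥.fnAux (a • φ) ψ x y + 𝒥.fnAux ψ (a • φ) x y =
      a • (𝒥.fnAux φ ψ x y + 𝒥.fnAux ψ φ x y)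
    simp only [fnAux_apply, LinearMap.smul_apply, coe_smul', smul_lie, lie_smul, map_smul,
      ← smul_add, ← smul_sub]
  have hsymm : ∀ φ ψ, 𝒥.fnBracket φ ψ = 𝒥.fnBracket ψ φ := fun φ ψ => Subtype.ext (add_comm _ _)
  LinearMap.mk₂ ℂ 𝒥.fnBracket hadd hsmul
    (fun φ ψ ψ' => by rw [hsymm, hadd, hsymm ψ, hsymm ψ'])
    (fun a φ ψ => by rw [hsymm, hsmul, hsymm ψ])

theorem fnBilin_apply (φ ψ : 𝒥.A01) : 𝒥.fnBilin φ ψ = 𝒥.fnBracket φ ψ := rfl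

theorem dbar1_dbar0 (X : 𝒥.g10) : 𝒥.dbar1 (𝒥.dbar0 X) = 0 := by
  apply Subtype.ext
  ext x y : 2
  change ⁅x, ⁅y, X⁆⁆ - ⁅y, ⁅x, X⁆⁆ - ⁅⁅x, y⁆, X⁆ = 0
  rw [leibniz_lie x y X]
  abel

instance free_A02 : Module.Free ℂ 𝒥.A02 := Module.Free.of_divisionRing ℂ 𝒥.A02

variable [FiniteDimensional ℝ 𝔤] (c₀ : InnerProductSpace.Core ℂ 𝒥.g10)
  (c₁ : InnerProductSpace.Core ℂ 𝒥.A01) (c₂ : InnerProductSpace.Core ℂ 𝒥.A02)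

/-- The bilinear map `½ ∂̄†[φ, ψ]`. -/
def kuranishiBilin : 𝒥.A01 →ₗ[ℂ] 𝒥.A01 →ₗ[ℂ] 𝒥.A01 :=
  𝒥.fnBilin.compr₂ ((1 / 2 : ℂ) • 𝒥.dbarDagger1 c₁ c₂)

theorem kuranishiBilin_apply (φ ψ : 𝒥.A01) : 𝒥.kuranishiBilin c₁ c₂ φ ψ =
    (1 / 2 : ℂ) • 𝒥.dbarDagger1 c₁ c₂ (𝒥.fnBracket φ ψ) := rfl

/-- The bilinear map `½ ∂̄†[φ, ψ]` in coordinates. -/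
def kuranishiCLM : 𝒥.A01Model →L[ℂ] 𝒥.A01Model →L[ℂ] 𝒥.A01Model :=
  bilinToCLM (((𝒥.kuranishiBilin c₁ c₂).compl₁₂ 𝒥.coordA01.symm.toLinearMap
    𝒥.coordA01.symm.toLinearMap).compr₂ 𝒥.coordA01.toLinearMap)

theorem kuranishiCLM_apply (x y : 𝒥.A01Model) : 𝒥.kuranishiCLM c₁ c₂ x y =
    𝒥.coordA01 (𝒥.kuranishiBilin c₁ c₂ (𝒥.coordA01.symm x) (𝒥.coordA01.symm y)) := rfl

theorem dbarDagger1_dbar1_dbarDagger1 (y : 𝒥.A02) :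
    𝒥.dbarDagger1 c₁ c₂ (𝒥.dbar1 (𝒥.dbarDagger1 c₁ c₂ y)) = 𝒥.dbarDagger1 c₁ c₂ y :=
  mpInverse_map_mpInverse c₁ c₂ 𝒥.dbar1 y

theorem dbar1_dbarDagger1_dbar1 (x : 𝒥.A01) :
    𝒥.dbar1 (𝒥.dbarDagger1 c₁ c₂ (𝒥.dbar1 x)) = 𝒥.dbar1 x :=
  map_mpInverse_map c₁ c₂ 𝒥.dbar1 x

theorem dbarDagger0_dbarDagger1 (y : 𝒥.A02) :
    𝒥.dbarDagger0 c₀ c₁ (𝒥.dbarDagger1 c₁ c₂ y) = 0 :=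
  mpInverse_mpInverse c₀ c₁ c₂ 𝒥.dbar0 𝒥.dbar1 𝒥.dbar1_dbar0 y

theorem orthProj_dbar1 (x : 𝒥.A01) : orthProj c₂ (𝒥.harmonic2 c₁ c₂) (𝒥.dbar1 x) = 0 :=
  orthProj_map_eq_zero c₁ c₂ 𝒥.dbar1 _ inf_le_right x

variable {r : ℕ} (η : Module.Basis (Fin r) ℂ (𝒥.harmonic1 c₀ c₁))

/-- The linear term `∑ t_ν η_ν` of the Kuranishi series. -/
def kuranishiLinear : (Fin r → ℂ) →ₗ[ℂ] 𝒥.A01 :=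
  (𝒥.harmonic1 c₀ c₁).subtype ∘ₗ η.equivFun.symm.toLinearMap

theorem kuranishiLinear_apply (t : Fin r → ℂ) :
    𝒥.kuranishiLinear c₀ c₁ η t = ∑ ν, t ν • (η ν : 𝒥.A01) := by
  change ((η.equivFun.symm t : 𝒥.harmonic1 c₀ c₁) : 𝒥.A01) = _
  rw [Module.Basis.equivFun_symm_apply]
  push_cast
  rfl

theorem dbar1_kuranishiLinear (t : Fin r → ℂ) : 𝒥.dbar1 (𝒥.kuranishiLinear c₀ c₁ η t) = 0 :=
  (η.equivFun.symm t).2.1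

/-- Harmonic coordinates are extended linearly to all of `A¹` through a left inverse of the
inclusion, so that the base change `h` is defined and analytic off the base as well. -/
theorem exists_coordinates : ∃ ℓ : 𝒥.A01 →ₗ[ℂ] (Fin r → ℂ), ∀ x, 𝒥.dbar1 x = 0 →
    𝒥.dbarDagger0 c₀ c₁ x = 0 → 𝒥.kuranishiLinear c₀ c₁ η (ℓ x) = x := by
  obtain ⟨g, hg⟩ := LinearMap.exists_leftInverse_of_injective (𝒥.harmonic1 c₀ c₁).subtype
    (Submodule.ker_subtype _)
  refine ⟨η.equivFun.toLinearMap ∘ₗ g, fun x h1 h2 => ?_⟩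
  have h3 : g x = ⟨x, h1, h2⟩ := DFunLike.congr_fun hg ⟨x, h1, h2⟩
  change ((η.equivFun.symm (η.equivFun (g x)) : 𝒥.harmonic1 c₀ c₁) : 𝒥.A01) = x
  rw [LinearEquiv.symm_apply_apply, h3]

theorem kuranishiTerm_succ (t : Fin r → ℂ) (k : ℕ) :
    𝒥.kuranishiTerm c₁ c₂ (fun ν => (η ν : 𝒥.A01)) t (k + 1 + 1) =
      ∑ p ∈ Finset.HasAntidiagonal.antidiagonal k, 𝒥.kuranishiBilin c₁ c₂
        (𝒥.kuranishiTerm c₁ c₂ (fun ν => (η ν : 𝒥.A01)) t (p.1 + 1))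
        (𝒥.kuranishiTerm c₁ c₂ (fun ν => (η ν : 𝒥.A01)) t (p.2 + 1)) := by
  rw [kuranishiTerm, Finset.smul_sum, Finset.Nat.sum_antidiagonal_eq_sum_range_succ_mk,
    Finset.sum_range]
  refine Finset.sum_congr rfl fun j _ => ?_
  rw [kuranishiBilin_apply]
  have : k + 1 - (j : ℕ) = k - j + 1 := by omega
  rw [this]

/-- Solutions of the Kuranishi equation with vanishing obstruction satisfy the Maurer-Cartan
equation up to components that `eventually_maurerCartan` controls. -/
theorem mcDefect_components {φ : 𝒥.A01} {t : Fin r → ℂ}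
    (h : φ = 𝒥.kuranishiLinear c₀ c₁ η t + 𝒥.kuranishiBilin c₁ c₂ φ φ)
    (hobs : orthProj c₂ (𝒥.harmonic2 c₁ c₂) (𝒥.fnBracket φ φ) = 0) :
    𝒥.dbarDagger1 c₁ c₂ (𝒥.mcDefect φ) = 0 ∧
      orthProj c₂ (𝒥.harmonic2 c₁ c₂) (𝒥.mcDefect φ) = 0 := by
  rw [kuranishiBilin_apply, ← LinearMap.map_smul] at h
  have hP := map_smul_eq_zero_of_map_eq_zero (orthProj c₂ (𝒥.harmonic2 c₁ c₂)) (1 / 2 : ℂ) hobs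
  rw [mcDefect]
  generalize (1 / 2 : ℂ) • 𝒥.fnBracket φ φ = z at h hP ⊢
  constructor
  -- From `φ = v + ∂̄†z` with `∂̄v = 0` it follows that `∂̄†(z - ∂̄φ) = ∂̄†z - ∂̄†∂̄∂̄†z = 0`.
  · refine map_sub_eq_zero_of_eq_add (X := 𝒥.A01) (Y := 𝒥.A02)
      (v := 𝒥.kuranishiLinear c₀ c₁ η t) (x := φ) (y := z) 𝒥.dbar1 (𝒥.dbarDagger1 c₁ c₂)
      ?_ ?_ ?_
    · exact 𝒥.dbarDagger1_dbar1_dbarDagger1 c₁ c₂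
    · exact 𝒥.dbar1_kuranishiLinear c₀ c₁ η t
    · exact h
  · have h0 := 𝒥.orthProj_dbar1 c₁ c₂ φ
    generalize 𝒥.dbar1 φ = w at h0 ⊢
    have e := LinearMap.map_sub (orthProj c₂ (𝒥.harmonic2 c₁ c₂)) z w
    rw [hP, h0] at e
    exact e.trans (sub_self (0 : 𝒥.A02))

theorem kuranishi_isHolomorphicDeformation {ε : ℝ} (hε : 0 < ε)
    {φ : (Fin r → ℂ) → 𝒥.A01} (hφ0 : φ 0 = 0)
    (hφ : ∀ t, ‖t‖ < ε → AnalyticAt ℂ (fun t => 𝒥.coordA01 (φ t)) t)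
    (hmc : ∀ t ∈ 𝒥.kuranishiBase c₁ c₂ φ ε, 𝒥.mcDefect (φ t) = 0) :
    𝒥.IsHolomorphicDeformation (Metric.ball 0 ε) (𝒥.kuranishiBase c₁ c₂ φ ε) φ where
  analytic :=
    { isOpen := Metric.isOpen_ball
      subset := fun t ht => mem_ball_zero_iff.2 ht.1
      local_eq := fun p hp => by
        refine ⟨Metric.ball 0 ε, Metric.isOpen_ball, hp, subset_rfl, Module.finrank ℂ 𝒥.A02,
          fun i t => (Module.finBasis ℂ 𝒥.A02).equivFun
            (orthProj c₂ (𝒥.harmonic2 c₁ c₂) (𝒥.fnBracket (φ t) (φ t))) i,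
          fun i t ht => ?_, fun t ht => ?_⟩
        · let B := bilinToCLM ((𝒥.fnBilin.compl₁₂ 𝒥.coordA01.symm.toLinearMap
            𝒥.coordA01.symm.toLinearMap).compr₂
            ((Module.finBasis ℂ 𝒥.A02).coord i ∘ₗ orthProj c₂ (𝒥.harmonic2 c₁ c₂)))
          have hd := (hφ t (mem_ball_zero_iff.1 ht)).differentiableAt
          have h1 : DifferentiableAt ℂ
              (fun t => B (𝒥.coordA01 (φ t)) (𝒥.coordA01 (φ t))) t :=
            (B.differentiableAt.comp t hd).clm_apply hd
          have h2 : (fun t => B (𝒥.coordA01 (φ t)) (𝒥.coordA01 (φ t))) = fun t =>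
              (Module.finBasis ℂ 𝒥.A02).equivFun
                (orthProj c₂ (𝒥.harmonic2 c₁ c₂) (𝒥.fnBracket (φ t) (φ t))) i := by
            ext1 t
            change (Module.finBasis ℂ 𝒥.A02).coord i (orthProj c₂ (𝒥.harmonic2 c₁ c₂)
              (𝒥.fnBracket (𝒥.coordA01.symm (𝒥.coordA01 (φ t)))
                (𝒥.coordA01.symm (𝒥.coordA01 (φ t))))) = _
            rw [LinearEquiv.symm_apply_apply]
            rfl
          rw [h2] at h1
          exact h1.differentiableWithinAt
        · rw [← funext_iff (g := fun _ => (0 : ℂ))]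
          change (_ ∧ _) ↔ (Module.finBasis ℂ 𝒥.A02).equivFun _ = 0
          rw [LinearEquiv.map_eq_zero_iff]
          exact and_iff_right (mem_ball_zero_iff.1 ht) }
  zero_mem := ⟨by simpa using hε, by
    rw [hφ0, ← fnBilin_apply, map_zero, map_zero]⟩
  holomorphic := holomorphicOnSet_of_analyticAt 𝒥.coordA01 fun p hp => hφ p hp.1
  map_zero := hφ0
  maurerCartan := fun t ht => (sub_eq_zero.1 (hmc t ht)).symm

theorem kuranishi_isComplete {ε : ℝ} (hε : 0 < ε)
    {φ : (Fin r → ℂ) → 𝒥.A01} (hφ0 : φ 0 = 0)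
    (hφ : ContinuousAt (fun t => 𝒥.coordA01 (φ t)) 0)
    (hK : ∀ t, ‖t‖ < ε →
      φ t = 𝒥.kuranishiLinear c₀ c₁ η t + 𝒥.kuranishiBilin c₁ c₂ (φ t) (φ t)) :
    𝒥.IsComplete (𝒥.kuranishiBase c₁ c₂ φ ε) φ := by
  intro l Ω D ψ hψ
  obtain ⟨ζ, Φ, hζ, hΦ, hζ0, hΦ0, hgauge⟩ := 𝒥.exists_analytic_gauge c₀ c₁
  obtain ⟨Ψ, hΨ, hψΨ⟩ := hψ.holomorphic.exists_analyticAt 𝒥.coordA01 hψ.zero_mem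
  have hΨ0 : Ψ 0 = 0 := by
    rw [← hψΨ.self_of_nhdsWithin hψ.zero_mem, hψ.map_zero, map_zero]
  obtain ⟨ℓ, hℓ⟩ := 𝒥.exists_coordinates c₀ c₁ η
  let A : 𝒥.A01Model →L[ℂ] (Fin r → ℂ) := LinearMap.toContinuousLinearMap
    (ℓ ∘ₗ (LinearMap.id - 𝒥.dbarDagger1 c₁ c₂ ∘ₗ 𝒥.dbar1) ∘ₗ 𝒥.coordA01.symm.toLinearMap)
  have hA : ∀ x, A x = ℓ (𝒥.coordA01.symm x -
      𝒥.dbarDagger1 c₁ c₂ (𝒥.dbar1 (𝒥.coordA01.symm x))) := fun x => rfl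
  -- `h` reads off the coordinates of `Φ - ∂̄†∂̄Φ`. Gauge fixing does not need the Maurer-Cartan
  -- equation, so it applies to the ambient extension `Ψ` of `ψ`, and `h` is analytic in the ambient
  -- variables.
  let h : (Fin l → ℂ) → (Fin r → ℂ) := fun t => A (Φ (Ψ t))
  have hΦΨ : AnalyticAt ℂ (fun t => Φ (Ψ t)) 0 := by
    refine AnalyticAt.comp (g := Φ) ?_ hΨ
    rwa [hΨ0]
  have hζΨ : AnalyticAt ℂ (fun t => ζ (Ψ t)) 0 := by
    refine AnalyticAt.comp (g := ζ) ?_ hΨ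
    rwa [hΨ0]
  have hh : AnalyticAt ℂ h 0 := (A.analyticAt _).comp hΦΨ
  have hh0 : h 0 = 0 := by simp only [h, hΨ0, hΦ0, map_zero]
  have tΨ : Filter.Tendsto Ψ (𝓝 0) (𝓝 0) := by
    have := hΨ.continuousAt.tendsto; rwa [hΨ0] at this
  have tΦ : Filter.Tendsto (fun t => Φ (Ψ t)) (𝓝 0) (𝓝 0) := by
    have := hΦΨ.continuousAt.tendsto; simpa only [hΨ0, hΦ0] using this
  have tζ : Filter.Tendsto (fun t => ζ (Ψ t)) (𝓝 0) (𝓝 0) := by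
    have := hζΨ.continuousAt.tendsto; simpa only [hΨ0, hζ0] using this
  have th : Filter.Tendsto h (𝓝 0) (𝓝 0) := by
    have := hh.continuousAt.tendsto; rwa [hh0] at this
  have tφ : Filter.Tendsto (fun t => 𝒥.coordA01 (φ (h t))) (𝓝 0) (𝓝 0) := by
    have := hφ.tendsto
    simp only [hφ0, map_zero] at this
    exact this.comp th
  have e2 := (Filter.Tendsto.prodMk_nhds tζ tΦ).eventually 𝒥.eventually_exists_conjugate
  have e3 : ∀ᶠ t in 𝓝 0, ‖h t‖ < ε := by
    have := th.norm
    rw [norm_zero] at this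
    exact this.eventually_lt_const hε
  have e4 := (Filter.Tendsto.prodMk_nhds tΦ tφ).eventually
    (eventually_quadratic_solution_unique (𝒥.kuranishiCLM c₁ c₂))
  have e6 := eventually_nhdsWithin_iff.1 hψΨ
  have hall := (tΨ.eventually hgauge).and (e2.and (e3.and (e4.and (e6.and
    (hh.eventually_analyticAt.and hζΨ.eventually_analyticAt)))))
  refine ⟨h, _, hall, holomorphicOnSet_of_analyticAt (LinearEquiv.refl ℂ _) ?_, hh0, ?_⟩
  · rintro p ⟨-, -, -, -, -, -, hp, -⟩
    exact hp
  -- Both `Φ(Ψ t)` and `φ(h t)` are small solutions of the Kuranishi equation with the same linear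
  -- term, so they coincide.
  have key : ∀ t ∈ D, (𝒥.dbarDagger0 c₀ c₁ (𝒥.coordA01.symm (Φ (Ψ t))) = 0) → ‖h t‖ < ε →
      (∀ v, Φ (Ψ t) = v + 𝒥.kuranishiCLM c₁ c₂ (Φ (Ψ t)) (Φ (Ψ t)) →
        𝒥.coordA01 (φ (h t)) =
          v + 𝒥.kuranishiCLM c₁ c₂ (𝒥.coordA01 (φ (h t))) (𝒥.coordA01 (φ (h t))) →
        Φ (Ψ t) = 𝒥.coordA01 (φ (h t))) →
      𝒥.dbar1 (𝒥.coordA01.symm (Φ (Ψ t))) = (1 / 2 : ℂ) •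
        𝒥.fnBracket (𝒥.coordA01.symm (Φ (Ψ t))) (𝒥.coordA01.symm (Φ (Ψ t))) →
      φ (h t) = 𝒥.coordA01.symm (Φ (Ψ t)) := by
    intro t _ h0 hhε hsmall hmc
    set a := 𝒥.coordA01.symm (Φ (Ψ t)) with ha
    have hv : 𝒥.kuranishiLinear c₀ c₁ η (h t) = a - 𝒥.dbarDagger1 c₁ c₂ (𝒥.dbar1 a) :=
      hℓ (a - 𝒥.dbarDagger1 c₁ c₂ (𝒥.dbar1 a)) (by rw [map_sub, dbar1_dbarDagger1_dbar1, sub_self])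
        (by rw [map_sub, dbarDagger0_dbarDagger1, h0, sub_zero])
    have ha' : a = 𝒥.kuranishiLinear c₀ c₁ η (h t) + 𝒥.kuranishiBilin c₁ c₂ a a := by
      rw [hv, hmc, kuranishiBilin_apply, map_smul, sub_add_cancel]
    have hΦa : Φ (Ψ t) = 𝒥.coordA01 a := by rw [ha, LinearEquiv.apply_symm_apply]
    apply 𝒥.coordA01.injective
    rw [← hΦa]
    symm
    refine hsmall (𝒥.coordA01 (𝒥.kuranishiLinear c₀ c₁ η (h t))) ?_ ?_
    · rw [kuranishiCLM_apply, ← ha, ← map_add, ← ha', hΦa]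
    · rw [kuranishiCLM_apply, LinearEquiv.symm_apply_apply, ← map_add, ← hK _ hhε]
  have hmem : ∀ t ∈ D, 𝒥.coordA01 (ψ t) = Ψ t → ψ t = 𝒥.coordA01.symm (Ψ t) := fun t _ ht => by
    rw [← ht, LinearEquiv.symm_apply_apply]
  refine ⟨?_, _, hall, ⟨fun t => expAd (𝒥.coord10.symm (ζ (Ψ t)) : Complexification 𝔤), ?_, ?_⟩, ?_⟩
  · rintro t ⟨htD, h1, h2, h3, h4, h6, -⟩
    have hψt := hmem t htD (h6 htD)
    obtain ⟨hmc, -⟩ := h2 (ψ t) (hψ.maurerCartan t htD) (fun e => by rw [hψt]; exact h1.2 e)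
    have hφh := key t htD h1.1 h3 h4 hmc
    refine ⟨h3, ?_⟩
    rw [hφh]
    -- The obstruction vanishes because `½[Φ, Φ]` equals the exact element `∂̄Φ`, which puts `h t`
    -- in the base.
    have h7 := 𝒥.orthProj_dbar1 c₁ c₂ (𝒥.coordA01.symm (Φ (Ψ t)))
    rw [hmc, map_smul] at h7
    exact (smul_eq_zero.1 h7).resolve_left (by norm_num)
  · intro x
    refine holomorphicOnSet_of_analyticAt (coordC 𝔤) ?_
    rintro p ⟨-, -, -, -, -, -, -, hp⟩
    exact analyticAt_expAd (z := fun t => (𝒥.coord10.symm (ζ (Ψ t)) : Complexification 𝔤))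
      ((𝒥.incl10.analyticAt _).comp hp) x
  · rintro t ⟨htD, h1, h2, h3, h4, h6, -⟩ x
    have hψt := hmem t htD (h6 htD)
    obtain ⟨hmc, -⟩ := h2 (ψ t) (hψ.maurerCartan t htD) (fun e => by rw [hψt]; exact h1.2 e)
    have hφh := key t htD h1.1 h3 h4 hmc
    rw [mem_deformed01, mem_deformed01, Function.comp_apply, hφh, hψt]
    exact h1.2 x
  · rintro t ⟨htD, h1, h2, h3, h4, h6, -⟩
    have hψt := hmem t htD (h6 htD)
    obtain ⟨hmc, hres⟩ := h2 (ψ t) (hψ.maurerCartan t htD) (fun e => by rw [hψt]; exact h1.2 e)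
    have hφh := key t htD h1.1 h3 h4 hmc
    rw [Function.comp_apply, hφh]
    exact hres

/-- Convergence of the Kuranishi series, and completeness of the Kuranishi deformation. -/
theorem exists_kuranishi : ∃ ε₀ : ℝ, 0 < ε₀ ∧ ∃ φ : (Fin r → ℂ) → 𝒥.A01,
    (∀ t : Fin r → ℂ, ‖t‖ < ε₀ → ∀ ℓ : 𝒥.A01 →ₗ[ℂ] ℂ,
      HasSum (fun k => ℓ (𝒥.kuranishiTerm c₁ c₂ (fun ν => (η ν : 𝒥.A01)) t k)) (ℓ (φ t))) ∧
    ∀ ε : ℝ, 0 < ε → ε ≤ ε₀ →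
      𝒥.IsHolomorphicDeformation (Metric.ball 0 ε) (𝒥.kuranishiBase c₁ c₂ φ ε) φ ∧
      𝒥.IsComplete (𝒥.kuranishiBase c₁ c₂ φ ε) φ := by
  obtain ⟨ε₀, hε₀, φ, hφ0, hφ⟩ := exists_analytic_quadratic_solution
    (LinearMap.toContinuousLinearMap (𝒥.coordA01.toLinearMap ∘ₗ 𝒥.kuranishiLinear c₀ c₁ η))
    (𝒥.kuranishiCLM c₁ c₂)
    -- The index is shifted by one because the quadratic recursion starts at the linear term, while
    -- the Kuranishi series has a zero term in degree 0. Taking `eventually_maurerCartan` as the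
    -- property of small vectors makes the same radius serve for convergence and for the
    -- Maurer-Cartan equation.
    (fun t k => 𝒥.coordA01 (𝒥.kuranishiTerm c₁ c₂ (fun ν => (η ν : 𝒥.A01)) t (k + 1)))
    (fun t => by
      change _ = 𝒥.coordA01 (𝒥.kuranishiLinear c₀ c₁ η t)
      rw [kuranishiLinear_apply, zero_add, kuranishiTerm])
    (fun t k => by
      rw [kuranishiTerm_succ, map_sum]
      refine Finset.sum_congr rfl fun p _ => ?_
      rw [kuranishiCLM_apply, LinearEquiv.symm_apply_apply, LinearEquiv.symm_apply_apply])
    (𝒥.eventually_maurerCartan c₁ c₂)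
  have hcoord : ∀ t, 𝒥.coordA01 (𝒥.coordA01.symm (φ t)) = φ t :=
    fun t => LinearEquiv.apply_symm_apply _ _
  have hK : ∀ t, ‖t‖ < ε₀ → 𝒥.coordA01.symm (φ t) = 𝒥.kuranishiLinear c₀ c₁ η t +
      𝒥.kuranishiBilin c₁ c₂ (𝒥.coordA01.symm (φ t)) (𝒥.coordA01.symm (φ t)) := fun t ht => by
    apply 𝒥.coordA01.injective
    rw [hcoord, map_add, ← kuranishiCLM_apply]
    exact (hφ t ht).2.2.1
  refine ⟨ε₀, hε₀, fun t => 𝒥.coordA01.symm (φ t), fun t ht ℓ => ?_, fun ε hε hεε₀ => ⟨?_, ?_⟩⟩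
  · let k : 𝒥.A01Model →L[ℂ] ℂ :=
      LinearMap.toContinuousLinearMap (ℓ ∘ₗ 𝒥.coordA01.symm.toLinearMap)
    have h1 := (hφ t ht).1.mapL k
    have h2 : ∀ x, k (𝒥.coordA01 x) = ℓ x := fun x =>
      congrArg ℓ (𝒥.coordA01.symm_apply_apply x)
    simp only [h2] at h1
    have h3 := (hasSum_nat_add_iff
      (f := fun k => ℓ (𝒥.kuranishiTerm c₁ c₂ (fun ν => (η ν : 𝒥.A01)) t k)) 1).1 h1
    have h4 : ∑ i ∈ Finset.range 1,
        ℓ (𝒥.kuranishiTerm c₁ c₂ (fun ν => (η ν : 𝒥.A01)) t i) = 0 := by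
      rw [Finset.sum_range_one, kuranishiTerm, map_zero]
    rw [h4, add_zero] at h3
    exact h3
  · refine 𝒥.kuranishi_isHolomorphicDeformation c₁ c₂ hε (by rw [hφ0, map_zero])
      (fun t ht => ?_) (fun t ht => ?_)
    · simp only [hcoord]
      exact (hφ t (ht.trans_le hεε₀)).2.1
    · have ht' := ht.1.trans_le hεε₀
      obtain ⟨h1, h2⟩ := 𝒥.mcDefect_components c₀ c₁ c₂ η (hK t ht') ht.2
      exact (hφ t ht').2.2.2 h1 h2
  · refine 𝒥.kuranishi_isComplete c₀ c₁ c₂ η hε (by rw [hφ0, map_zero]) ?_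
      (fun t ht => hK t (ht.trans_le hεε₀))
    simp only [hcoord]
    exact (hφ 0 (by simpa using hε₀)).2.1.continuousAt

end LieComplexStructure

end

theorem theorem1p1 {𝔤 : Type*} [LieRing 𝔤] [LieAlgebra ℝ 𝔤] [FiniteDimensional ℝ 𝔤]
    (𝒥 : LieComplexStructure 𝔤) :
    (∃ (m : ℕ) (Ω B : Set (Fin m → ℂ)) (φ : (Fin m → ℂ) → 𝒥.A01),
      𝒥.IsHolomorphicDeformation Ω B φ ∧ 𝒥.IsComplete B φ) ∧
    ∀ (c₀ : InnerProductSpace.Core ℂ 𝒥.g10) (c₁ : InnerProductSpace.Core ℂ 𝒥.A01)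
      (c₂ : InnerProductSpace.Core ℂ 𝒥.A02)
      (r : ℕ) (η : Module.Basis (Fin r) ℂ (𝒥.harmonic1 c₀ c₁)),
      ∃ ε₀ : ℝ, 0 < ε₀ ∧ ∃ φ : (Fin r → ℂ) → 𝒥.A01,
        (∀ t : Fin r → ℂ, ‖t‖ < ε₀ → ∀ ℓ : 𝒥.A01 →ₗ[ℂ] ℂ,
          HasSum (fun k => ℓ (𝒥.kuranishiTerm c₁ c₂ (fun ν => (η ν : 𝒥.A01)) t k)) (ℓ (φ t))) ∧
        ∀ ε : ℝ, 0 < ε → ε ≤ ε₀ →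
          𝒥.IsHolomorphicDeformation (Metric.ball 0 ε) (𝒥.kuranishiBase c₁ c₂ φ ε) φ ∧
          𝒥.IsComplete (𝒥.kuranishiBase c₁ c₂ φ ε) φ := by
  refine ⟨?_, fun c₀ c₁ c₂ r η => 𝒥.exists_kuranishi c₀ c₁ c₂ η⟩
  obtain ⟨c₀⟩ := nonempty_innerProductSpaceCore 𝒥.g10
  obtain ⟨c₁⟩ := nonempty_innerProductSpaceCore 𝒥.A01
  obtain ⟨c₂⟩ := nonempty_innerProductSpaceCore 𝒥.A02
  obtain ⟨ε₀, hε₀, φ, -, h⟩ :=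
    𝒥.exists_kuranishi c₀ c₁ c₂ (Module.finBasis ℂ (𝒥.harmonic1 c₀ c₁))
  exact ⟨_, _, _, φ, (h ε₀ hε₀ le_rfl).1, (h ε₀ hε₀ le_rfl).2⟩
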